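/- Let $k$ be a positive integer, let $G$ be a finite simple bipartite graph of order $2n$ with bipartition $(X,Y)$, where $|X|=|Y|=n$, and let $S\subseteq X$. Suppose that $d(x)+d(y)\ge n+1$ for every pair of nonadjacent vertices $x\in S$, $y\in Y$ (no condition if there is no such pair), and that $|S|\ge 2k+1$. Then $G$ contains $k$ pairwise vertex-disjoint cycles, each of which contains at least two vertices of $S$. Moreover, $k$ pairwise vertex-disjoint cycles, each containing at least two vertices of $S$, can be chosen in $G$ so that either these $k$ cycles together cover $V(G)$, or each of them contains exactly two vertices of $S$. -/

import Mathlib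

open scoped Function

/-- A subgraph `H` of `G` is a cycle if it consists of the vertices and edges of a closed walk
without repeated vertices or edges (in a simple graph, necessarily of length at least three). -/
def IsCycleSubgraph {V : Type*} {G : SimpleGraph V} (H : G.Subgraph) : Prop :=
  ∃ (v : V) (c : G.Walk v v), c.IsCycle ∧ H = c.toSubgraph

/-- `σ_{1,1}(S)` for a finite graph `G` with bipartition `(X, Y)`: the minimum of `d(x) + d(y)`
over the nonadjacent pairs `x ∈ X`, `y ∈ Y` with `x ∈ S` or `y ∈ S`, and `∞` if there is no such
pair. -/
noncomputable def sigmaOneOne {V : Type*} [Fintype V] (G : SimpleGraph V) [DecidableRel G.Adj]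
    (X Y S : Set V) : ℕ∞ :=
  ⨅ (x : V) (y : V) (_ : x ∈ X) (_ : y ∈ Y) (_ : x ∈ S ∨ y ∈ S) (_ : ¬ G.Adj x y),
    ((G.degree x + G.degree y : ℕ) : ℕ∞)

/-- A cycle of a bipartite graph is feasible (with respect to a set `S` of vertices) if it
contains at least two vertices of `S`. -/
def IsFeasibleCycle {V : Type*} {G : SimpleGraph V} (S : Set V) (H : G.Subgraph) : Prop :=
  IsCycleSubgraph H ∧ 2 ≤ (H.verts ∩ S).ncard

/-- `C` is a family of `k` pairwise (vertex-)disjoint feasible cycles. -/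
def IsDisjointFeasibleFamily {V : Type*} {G : SimpleGraph V} (S : Set V) {k : ℕ}
    (C : Fin k → G.Subgraph) : Prop :=
  (∀ i, IsFeasibleCycle S (C i)) ∧ Pairwise (Disjoint on fun i => (C i).verts)

/-- A bipartite graph `G` is `S`-`k`-feasible if it contains `k` disjoint feasible cycles. -/
def IsSKFeasible {V : Type*} (G : SimpleGraph V) (S : Set V) (k : ℕ) : Prop :=
  ∃ C : Fin k → G.Subgraph, IsDisjointFeasibleFamily S C

set_option linter.unusedSectionVars false

/-! ### Packings of short cycles and their updates -/

section Packing

open Finset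

/-! Only very short cycles are needed: four-cycles with two marked vertices, hexagons with exactly
two, and octagons with exactly two opposite ones (`Good`). Each contains exactly two marked
vertices. By induction on `k` there are `k` disjoint such cycles, or `k - 1` of them together with a
hexagon through three marked vertices that uses up all other vertices (`exists_packing_or_hexagon`).
The first outcome gives cycles with exactly two marked vertices each, the second gives cycles
covering the graph.

Suppose that both outcomes fail for `m + 1`, and take a packing of `m` short cycles covering as few
vertices as possible (`State`). At least three marked vertices are uncovered. By minimality a
hexagon or octagon of the packing receives few edges from an uncovered marked `s` and an uncovered
`y`. The degree condition is then used in two ways. For one nonadjacent pair `s`, `y` with few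
uncovered neighbours, some cycle receives more edges than half its length, and exchanging `s` or `y`
with a vertex of that cycle creates an edge between uncovered vertices (`State.pair`). For three
disjoint uncovered edges, summing three nonadjacent pairs gives a four-cycle that receives at least
7 of the 12 possible edges (`State.exists_four`). A finite check then finds either two disjoint
four-cycles in place of one, or one four-cycle that leaves a configuration already excluded.

In this way smaller and smaller uncovered configurations are ruled out: a hexagon through three
marked vertices (`State.no_hexagon`), a path on six vertices (`State.no_path`), a path on five
vertices with marked ends (`State.no_cherries`), a common neighbour of two marked vertices
(`State.no_link`), and finally three disjoint edges at marked vertices (`State.no_matching`). But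
three exchanges always produce such edges (`State.exists_adj_step`), which is the contradiction
`State.elim`. -/

/-- The elements outside all members of a family of finite sets. -/
def familyRest {α : Type*} [Fintype α] [DecidableEq α] {m : ℕ} (D : Fin m → Finset α) :
    Finset α :=
  univ.filter fun a => ∀ i, a ∉ D i

theorem mem_familyRest {α : Type*} [Fintype α] [DecidableEq α] {m : ℕ} {D : Fin m → Finset α}
    {a : α} : a ∈ familyRest D ↔ ∀ i, a ∉ D i := by
  simp [familyRest]

theorem card_filter_familyRest {α : Type*} [Fintype α] [DecidableEq α] {m : ℕ}
    {D : Fin m → Finset α} (hD : ∀ i j, i ≠ j → Disjoint (D i) (D j))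
    (p : α → Prop) [DecidablePred p] :
    #(univ.filter p) = #((familyRest D).filter p) + ∑ i, #((D i).filter p) := by
  have h1 : univ.filter p =
      ((familyRest D).filter p) ∪ univ.biUnion fun i => (D i).filter p := by
    ext a
    simp only [mem_filter, mem_univ, true_and, mem_union, mem_familyRest, mem_biUnion]
    constructor
    · intro ha
      by_cases h : ∃ i, a ∈ D i
      · exact Or.inr (h.imp fun i hi => ⟨hi, ha⟩)
      · exact Or.inl ⟨not_exists.1 h, ha⟩
    · rintro (h | ⟨i, h⟩) <;> exact h.2
  rw [h1, card_union_of_disjoint, card_biUnion]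
  · intro i _ j _ hij
    exact (hD i j hij).mono (filter_subset _ _) (filter_subset _ _)
  · rw [disjoint_biUnion_right]
    intro i _
    rw [Finset.disjoint_left]
    intro a ha ha'
    exact mem_familyRest.1 (mem_filter.1 ha).1 i (mem_filter.1 ha').1

/-- A bipartite graph with colour classes `A`, `B` and a set `S ⊆ A` of marked vertices. -/
structure MarkedBigraph (A B : Type*) where
  adj : A → B → Prop
  S : Finset A

namespace MarkedBigraph

variable {A B : Type*} [DecidableEq A] [DecidableEq B]

/-- The vertex sets of the cycles of lengths four, six and eight through exactly two marked
vertices, where in the cycles of length eight the two marked vertices are opposite. -/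
inductive Good (G : MarkedBigraph A B) : Finset A → Finset B → Prop
  | four {u v : A} {c d : B} (hu : u ∈ G.S) (hv : v ∈ G.S) (huv : u ≠ v) (hcd : c ≠ d)
      (huc : G.adj u c) (hud : G.adj u d) (hvc : G.adj v c) (hvd : G.adj v d) :
      Good G {u, v} {c, d}
  | six {u x v : A} {a b c : B} (hu : u ∈ G.S) (hx : x ∉ G.S) (hv : v ∈ G.S) (huv : u ≠ v)
      (hab : a ≠ b) (hac : a ≠ c) (hbc : b ≠ c) (hua : G.adj u a) (hxa : G.adj x a)
      (hxb : G.adj x b) (hvb : G.adj v b) (hvc : G.adj v c) (huc : G.adj u c) :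
      Good G {u, x, v} {a, b, c}
  | eight {u x v x' : A} {a b c d : B} (hu : u ∈ G.S) (hx : x ∉ G.S) (hv : v ∈ G.S)
      (hx' : x' ∉ G.S) (huv : u ≠ v) (hxx' : x ≠ x') (hab : a ≠ b) (hac : a ≠ c) (had : a ≠ d)
      (hbc : b ≠ c) (hbd : b ≠ d) (hcd : c ≠ d) (hua : G.adj u a) (hxa : G.adj x a)
      (hxb : G.adj x b) (hvb : G.adj v b) (hvc : G.adj v c) (hxc : G.adj x' c)
      (hxd : G.adj x' d) (hud : G.adj u d) : Good G {u, x, v, x'} {a, b, c, d}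

theorem Good.card_eq {G : MarkedBigraph A B} {P : Finset A} {Q : Finset B} (h : G.Good P Q) :
    #P = #Q := by
  cases h with
  | four => rw [card_pair, card_pair] <;> assumption
  | six hu hx hv huv =>
    have h1 : ∀ w ∈ G.S, w ≠ _ := fun w hw => ne_of_mem_of_not_mem hw hx
    rw [card_eq_three.2 ⟨_, _, _, h1 _ hu, huv, (h1 _ hv).symm, rfl⟩,
      card_eq_three.2 ⟨_, _, _, ‹_›, ‹_›, ‹_›, rfl⟩]
  | @eight u x v x' a b c d hu hx hv hx' =>
    have h1 : ∀ w ∈ G.S, w ≠ x := fun w hw => ne_of_mem_of_not_mem hw hx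
    have h2 : ∀ w ∈ G.S, w ≠ x' := fun w hw => ne_of_mem_of_not_mem hw hx'
    have := h1 u hu
    have := (h1 v hv).symm
    have := h2 u hu
    have := h2 v hv
    rw [card_insert_of_notMem, card_insert_of_notMem, card_insert_of_notMem,
      card_insert_of_notMem, card_insert_of_notMem, card_insert_of_notMem] <;> simp [*]

theorem Good.card_marked {G : MarkedBigraph A B} {P : Finset A} {Q : Finset B}
    (h : G.Good P Q) : #(P.filter (· ∈ G.S)) = 2 := by
  cases h <;> simp [filter_insert, filter_singleton, *]

variable [Fintype A] [Fintype B]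

/-- A family of pairwise disjoint short cycles. -/
structure IsPacking (G : MarkedBigraph A B) {m : ℕ} (C : Fin m → Finset A × Finset B) :
    Prop where
  good : ∀ i, G.Good (C i).1 (C i).2
  disjL : ∀ i j, i ≠ j → Disjoint (C i).1 (C j).1
  disjR : ∀ i j, i ≠ j → Disjoint (C i).2 (C j).2

/-- The vertices of `A` missed by a family. -/
def restL {m : ℕ} (C : Fin m → Finset A × Finset B) : Finset A := familyRest fun i => (C i).1

/-- The vertices of `B` missed by a family. -/
def restR {m : ℕ} (C : Fin m → Finset A × Finset B) : Finset B := familyRest fun i => (C i).2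

theorem mem_restL {m : ℕ} {C : Fin m → Finset A × Finset B} {a : A} :
    a ∈ restL C ↔ ∀ i, a ∉ (C i).1 := mem_familyRest

theorem mem_restR {m : ℕ} {C : Fin m → Finset A × Finset B} {b : B} :
    b ∈ restR C ↔ ∀ i, b ∉ (C i).2 := mem_familyRest

open Classical in
/-- The number of neighbours of `s` in `Q`. -/
noncomputable def degL (G : MarkedBigraph A B) (s : A) (Q : Finset B) : ℕ :=
  #(Q.filter fun y => G.adj s y)

open Classical in
/-- The number of neighbours of `y` in `P`. -/
noncomputable def degR (G : MarkedBigraph A B) (y : B) (P : Finset A) : ℕ :=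
  #(P.filter fun x => G.adj x y)

/-- A minimal counterexample: `m` disjoint short cycles may exist, but neither `m + 1` of them,
nor `m` of them together with a marked hexagon covering all other vertices. -/
structure Extremal (G : MarkedBigraph A B) (m : ℕ) : Prop where
  card_eq : Fintype.card A = Fintype.card B
  ore : ∀ s ∈ G.S, ∀ y, ¬ G.adj s y →
    Fintype.card A + 1 ≤ G.degL s univ + G.degR y univ
  many : 2 * m + 3 ≤ #G.S
  no_more : ∀ C : Fin (m + 1) → Finset A × Finset B, ¬ G.IsPacking C
  no_hexagon : ∀ C : Fin m → Finset A × Finset B, G.IsPacking C → ∀ s₁ s₂ s₃ z₁ z₂ z₃,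
    s₁ ∈ G.S → s₂ ∈ G.S → s₃ ∈ G.S → s₁ ≠ s₂ → s₁ ≠ s₃ → s₂ ≠ s₃ → z₁ ≠ z₂ → z₁ ≠ z₃ → z₂ ≠ z₃ →
    G.adj s₁ z₁ → G.adj s₂ z₁ → G.adj s₂ z₂ → G.adj s₃ z₂ → G.adj s₃ z₃ → G.adj s₁ z₃ →
    restL C = {s₁, s₂, s₃} → restR C = {z₁, z₂, z₃} → False

/-- A packing of `m` cycles in an extremal graph that covers as little as possible. -/
structure State (G : MarkedBigraph A B) {m : ℕ} (C : Fin m → Finset A × Finset B) : Prop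
    extends IsPacking G C where
  ext : G.Extremal m
  max : ∀ C' : Fin m → Finset A × Finset B, G.IsPacking C' → #(restL C') ≤ #(restL C)

variable {G : MarkedBigraph A B} {m : ℕ} {C : Fin m → Finset A × Finset B}

theorem IsPacking.card_restL (h : G.IsPacking C) :
    #(restL C) + ∑ i, #(C i).1 = Fintype.card A := by
  simpa [restL] using (card_filter_familyRest h.disjL fun _ => True).symm

theorem IsPacking.card_restR (h : G.IsPacking C) :
    #(restR C) + ∑ i, #(C i).1 = Fintype.card B := by
  have := (card_filter_familyRest h.disjR fun _ => True).symm
  simp only [filter_true, card_univ] at this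
  rw [← this, restR]
  exact congrArg _ (sum_congr rfl fun i _ => (h.good i).card_eq)

theorem IsPacking.card_marked (h : G.IsPacking C) :
    #((restL C).filter (· ∈ G.S)) + 2 * m = #G.S := by
  have := (card_filter_familyRest h.disjL (· ∈ G.S)).symm
  have h2 : ∑ i, #((C i).1.filter (· ∈ G.S)) = 2 * m := by
    rw [sum_congr rfl fun i _ => (h.good i).card_marked]
    simp [mul_comm]
  rw [h2] at this
  simpa [restL] using this

theorem State.card_eq (h : G.State C) : #(restR C) = #(restL C) := by
  have h1 := h.card_restL
  have h2 := h.card_restR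
  have h3 := h.ext.card_eq
  omega

/-- Each cycle uses exactly two marked vertices, so the bound `2 * m + 3` leaves three of them over.
-/
theorem State.three_le_marked (h : G.State C) : 3 ≤ #((restL C).filter (· ∈ G.S)) := by
  have h1 := h.card_marked
  have h3 := h.ext.many
  omega

theorem State.three_le_card (h : G.State C) : 3 ≤ #(restL C) :=
  h.three_le_marked.trans (card_filter_le _ _)

/-- The degree condition, counted along the packing. -/
theorem State.ore_sum (h : G.State C) {s : A} {y : B} (hs : s ∈ G.S) (hsy : ¬ G.adj s y) :
    ∑ i, #(C i).1 + #(restL C) + 1 ≤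
      ∑ i, (G.degL s (C i).2 + G.degR y (C i).1) + (G.degL s (restR C) + G.degR y (restL C)) := by
  classical
  have h1 := h.ext.ore s hs y hsy
  have h2 := h.card_restL
  have h3 : G.degL s univ = G.degL s (restR C) + ∑ i, G.degL s (C i).2 := by
    simpa [degL, restR] using card_filter_familyRest h.disjR (fun y => G.adj s y)
  have h4 : G.degR y univ = G.degR y (restL C) + ∑ i, G.degR y (C i).1 := by
    simpa [degR, restL] using card_filter_familyRest h.disjL (fun x => G.adj x y)
  rw [sum_add_distrib]
  omega

theorem State.no_good (h : G.State C) {P : Finset A} {Q : Finset B} (hg : G.Good P Q)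
    (hP : P ⊆ restL C) (hQ : Q ⊆ restR C) : False := by
  have hP' : ∀ i, Disjoint P (C i).1 := fun i => Finset.disjoint_left.2 fun a ha =>
    mem_restL.1 (hP ha) i
  have hQ' : ∀ i, Disjoint Q (C i).2 := fun i => Finset.disjoint_left.2 fun a ha =>
    mem_restR.1 (hQ ha) i
  refine h.ext.no_more (Fin.cons (P, Q) C) ⟨?_, ?_, ?_⟩
  · intro i
    cases i using Fin.cases <;> simp [hg, h.good]
  · intro i j hij
    cases i using Fin.cases <;> cases j using Fin.cases
    · exact absurd rfl hij
    · simpa using hP' _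
    · simpa using (hP' _).symm
    · simpa using h.disjL _ _ (by simpa using hij)
  · intro i j hij
    cases i using Fin.cases <;> cases j using Fin.cases
    · exact absurd rfl hij
    · simpa using hQ' _
    · simpa using (hQ' _).symm
    · simpa using h.disjR _ _ (by simpa using hij)

theorem disjoint_update {α : Type*} [Fintype α] [DecidableEq α] {D : Fin m → Finset α}
    (hD : ∀ i j, i ≠ j → Disjoint (D i) (D j)) {i : Fin m} {P : Finset α}
    (hP : P ⊆ familyRest D ∪ D i) (j : Fin m) (hj : j ≠ i) : Disjoint P (D j) := by
  rw [Finset.disjoint_left]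
  intro a ha
  rcases mem_union.1 (hP ha) with h | h
  · exact mem_familyRest.1 h j
  · exact Finset.disjoint_left.1 (hD i j hj.symm) h

theorem IsPacking.update (h : G.IsPacking C) {i : Fin m} {P : Finset A} {Q : Finset B}
    (hg : G.Good P Q) (hP : P ⊆ restL C ∪ (C i).1) (hQ : Q ⊆ restR C ∪ (C i).2) :
    G.IsPacking (Function.update C i (P, Q)) := by
  have hP' := disjoint_update h.disjL hP
  have hQ' := disjoint_update h.disjR hQ
  refine ⟨fun j => ?_, fun j k hjk => ?_, fun j k hjk => ?_⟩
  · by_cases hj : j = i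
    · subst hj
      simpa using hg
    · simpa [hj] using h.good j
  · by_cases hj : j = i <;> by_cases hk : k = i
    · exact absurd (hj.trans hk.symm) hjk
    · subst hj
      simpa [hk] using hP' k hk
    · subst hk
      simpa [hj] using (hP' j hj).symm
    · simpa [hj, hk] using h.disjL j k hjk
  · by_cases hj : j = i <;> by_cases hk : k = i
    · exact absurd (hj.trans hk.symm) hjk
    · subst hj
      simpa [hk] using hQ' k hk
    · subst hk
      simpa [hj] using (hQ' j hj).symm
    · simpa [hj, hk] using h.disjR j k hjk

theorem sum_update (i : Fin m) (P : Finset A) (Q : Finset B) :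
    ∑ j, #(Function.update C i (P, Q) j).1 + #(C i).1 = ∑ j, #(C j).1 + #P := by
  rw [← add_sum_erase univ (fun j => #(Function.update C i (P, Q) j).1) (mem_univ i),
    ← add_sum_erase univ (fun j => #(C j).1) (mem_univ i)]
  have : ∑ j ∈ univ.erase i, #(Function.update C i (P, Q) j).1 = ∑ j ∈ univ.erase i, #(C j).1 :=
    sum_congr rfl fun j hj => by simp [ne_of_mem_erase hj]
  rw [this]
  simp only [Function.update_self]
  ring

/-- Otherwise the replacement would cover fewer vertices, against the choice of the packing. -/
theorem State.le_card (h : G.State C) {i : Fin m} {P : Finset A} {Q : Finset B}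
    (hg : G.Good P Q) (hP : P ⊆ restL C ∪ (C i).1) (hQ : Q ⊆ restR C ∪ (C i).2) :
    #(C i).1 ≤ #P := by
  have h1 := h.toIsPacking.update hg hP hQ
  have h2 := h1.card_restL
  have h3 := h.card_restL
  have h4 := sum_update (C := C) i P Q
  have h5 := h.max _ h1
  omega

/-- The new packing covers no more than the old one, so it is again extremal and every later
exclusion applies to it. -/
theorem State.update (h : G.State C) {i : Fin m} {P : Finset A} {Q : Finset B}
    (hg : G.Good P Q) (hP : P ⊆ restL C ∪ (C i).1) (hQ : Q ⊆ restR C ∪ (C i).2)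
    (hc : #P ≤ #(C i).1) : G.State (Function.update C i (P, Q)) := by
  have h1 := h.toIsPacking.update hg hP hQ
  refine ⟨h1, h.ext, fun C' hC' => (h.max C' hC').trans ?_⟩
  have h2 := h1.card_restL
  have h3 := h.card_restL
  have h4 := sum_update (C := C) i P Q
  omega

theorem mem_restL_update (h : G.IsPacking C) {i : Fin m} {P : Finset A} {Q : Finset B} {a : A} :
    a ∈ restL (Function.update C i (P, Q)) ↔ (a ∈ restL C ∨ a ∈ (C i).1) ∧ a ∉ P := by
  simp only [mem_restL]
  constructor
  · intro h'
    refine ⟨or_iff_not_imp_right.2 fun hi j => ?_, by simpa using h' i⟩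
    by_cases hj : j = i
    · exact hj ▸ hi
    · simpa [hj] using h' j
  · rintro ⟨h1, h2⟩ j
    by_cases hj : j = i
    · subst hj; simpa using h2
    · simp only [Function.update_of_ne hj]
      exact h1.elim (fun h => h j) fun h' => Finset.disjoint_left.1 (h.disjL i j (Ne.symm hj)) h'

theorem mem_restR_update (h : G.IsPacking C) {i : Fin m} {P : Finset A} {Q : Finset B} {b : B} :
    b ∈ restR (Function.update C i (P, Q)) ↔ (b ∈ restR C ∨ b ∈ (C i).2) ∧ b ∉ Q := by
  simp only [mem_restR]
  constructor
  · intro h'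
    refine ⟨or_iff_not_imp_right.2 fun hi j => ?_, by simpa using h' i⟩
    by_cases hj : j = i
    · exact hj ▸ hi
    · simpa [hj] using h' j
  · rintro ⟨h1, h2⟩ j
    by_cases hj : j = i
    · subst hj; simpa using h2
    · simp only [Function.update_of_ne hj]
      exact h1.elim (fun h => h j) fun h' => Finset.disjoint_left.1 (h.disjR i j (Ne.symm hj)) h'

end MarkedBigraph
end Packing

/-! ### Exchanging an uncovered vertex with a vertex of a cycle -/

section Exchange
open Finset
namespace MarkedBigraph
variable {A B : Type*} [DecidableEq A] [DecidableEq B] [Fintype A] [Fintype B]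
variable {G : MarkedBigraph A B} {m : ℕ} {C : Fin m → Finset A × Finset B}

/-- A marked vertex that is not covered by the packing. -/
abbrev Avail (G : MarkedBigraph A B) (C : Fin m → Finset A × Finset B) (s : A) : Prop :=
  s ∈ restL C ∧ s ∈ G.S

open Classical in
/-- The truth value of a proposition as a natural number. -/
noncomputable def ind (p : Prop) : ℕ := if p then 1 else 0

theorem ind_le (p : Prop) : ind p ≤ 1 := by
  unfold ind; split <;> simp

theorem ind_of {p : Prop} (h : p) : ind p = 1 := if_pos h

theorem ind_not {p : Prop} (h : ¬ p) : ind p = 0 := if_neg h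

theorem ind_add_le {p q : Prop} (h : p → q → False) : ind p + ind q ≤ 1 := by
  by_cases hp : p <;> by_cases hq : q <;> simp [ind, hp, hq]
  exact h hp hq

theorem degL_insert {s : A} {c : B} {Q : Finset B} (h : c ∉ Q) :
    G.degL s (insert c Q) = ind (G.adj s c) + G.degL s Q := by
  unfold degL ind
  split_ifs with h1
  · rw [filter_insert, if_pos h1, card_insert_of_notMem (by simp [h]), add_comm]
  · rw [filter_insert, if_neg h1, zero_add]

theorem degL_singleton {s : A} {c : B} : G.degL s {c} = ind (G.adj s c) := by
  unfold degL ind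
  split_ifs with h1 <;> simp [filter_singleton, h1]

theorem degR_insert {y : B} {x : A} {P : Finset A} (h : x ∉ P) :
    G.degR y (insert x P) = ind (G.adj x y) + G.degR y P := by
  unfold degR ind
  split_ifs with h1
  · rw [filter_insert, if_pos h1, card_insert_of_notMem (by simp [h]), add_comm]
  · rw [filter_insert, if_neg h1, zero_add]

theorem degR_singleton {y : B} {x : A} : G.degR y {x} = ind (G.adj x y) := by
  unfold degR ind
  split_ifs with h1 <;> simp [filter_singleton, h1]

theorem degL_pair {s : A} {c d : B} (h : c ≠ d) :
    G.degL s {c, d} = ind (G.adj s c) + ind (G.adj s d) := by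
  rw [degL_insert (by simpa), degL_singleton]

theorem degR_pair {y : B} {u v : A} (h : u ≠ v) :
    G.degR y {u, v} = ind (G.adj u y) + ind (G.adj v y) := by
  rw [degR_insert (by simpa), degR_singleton]

/-- The packing `C'` arises from `C` by exchanging `s` for `w` in the `i`-th cycle. -/
structure SwapL (G : MarkedBigraph A B) (C C' : Fin m → Finset A × Finset B) (i : Fin m)
    (s w : A) : Prop where
  state : G.State C'
  mem : w ∈ (C i).1
  marked : w ∈ G.S
  notMem : w ∉ restL C
  mem_restL : ∀ a, a ∈ restL C' ↔ (a ∈ restL C ∧ a ≠ s) ∨ a = w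
  restR_eq : restR C' = restR C
  other : ∀ j, j ≠ i → C' j = C j
  good : G.Good (insert s ((C i).1.erase w)) (C i).2

/-- The packing `C'` arises from `C` by exchanging `y` for `p` in the `i`-th cycle. -/
structure SwapR (G : MarkedBigraph A B) (C C' : Fin m → Finset A × Finset B) (i : Fin m)
    (y p : B) : Prop where
  state : G.State C'
  mem : p ∈ (C i).2
  notMem : p ∉ restR C
  restL_eq : restL C' = restL C
  mem_restR : ∀ b, b ∈ restR C' ↔ (b ∈ restR C ∧ b ≠ y) ∨ b = p
  other : ∀ j, j ≠ i → C' j = C j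
  good : G.Good (C i).1 (insert y ((C i).2.erase p))

/-- Minimality in its usable form: a longer cycle could be replaced by this four-cycle, which covers
less. -/
theorem State.no_four (h : G.State C) {i : Fin m} (hi : 2 < #(C i).1) {u v : A} {c d : B}
    (hu : u ∈ restL C ∪ (C i).1) (hv : v ∈ restL C ∪ (C i).1)
    (hc : c ∈ restR C ∪ (C i).2) (hd : d ∈ restR C ∪ (C i).2)
    (hus : u ∈ G.S) (hvs : v ∈ G.S) (huv : u ≠ v) (hcd : c ≠ d)
    (huc : G.adj u c) (hud : G.adj u d) (hvc : G.adj v c) (hvd : G.adj v d) : False := by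
  have h1 := h.le_card (i := i) (Good.four hus hvs huv hcd huc hud hvc hvd)
    (by simp only [insert_subset_iff, singleton_subset_iff]; exact ⟨hu, hv⟩)
    (by simp only [insert_subset_iff, singleton_subset_iff]; exact ⟨hc, hd⟩)
  have h2 : #({u, v} : Finset A) ≤ 2 := card_le_two
  omega

theorem State.no_six (h : G.State C) {i : Fin m} (hi : 3 < #(C i).1) {u x v : A} {a b c : B}
    (hu' : u ∈ restL C ∪ (C i).1) (hx' : x ∈ restL C ∪ (C i).1) (hv' : v ∈ restL C ∪ (C i).1)
    (ha : a ∈ restR C ∪ (C i).2) (hb : b ∈ restR C ∪ (C i).2) (hc : c ∈ restR C ∪ (C i).2)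
    (hu : u ∈ G.S) (hx : x ∉ G.S) (hv : v ∈ G.S) (huv : u ≠ v)
    (hab : a ≠ b) (hac : a ≠ c) (hbc : b ≠ c) (hua : G.adj u a) (hxa : G.adj x a)
    (hxb : G.adj x b) (hvb : G.adj v b) (hvc : G.adj v c) (huc : G.adj u c) : False := by
  have h1 := h.le_card (i := i) (Good.six hu hx hv huv hab hac hbc hua hxa hxb hvb hvc huc)
    (by simp only [insert_subset_iff, singleton_subset_iff]; exact ⟨hu', hx', hv'⟩)
    (by simp only [insert_subset_iff, singleton_subset_iff]; exact ⟨ha, hb, hc⟩)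
  have h2 : #({u, x, v} : Finset A) ≤ 3 := card_le_three
  omega

/-- Four-cycles of the packing. -/
structure IsFour (G : MarkedBigraph A B) (p : Finset A × Finset B) (u v : A) (c d : B) :
    Prop where
  eq₁ : p.1 = {u, v}
  eq₂ : p.2 = {c, d}
  hu : u ∈ G.S
  hv : v ∈ G.S
  huv : u ≠ v
  hcd : c ≠ d
  huc : G.adj u c
  hud : G.adj u d
  hvc : G.adj v c
  hvd : G.adj v d

theorem IsFour.card {p : Finset A × Finset B} {u v : A} {c d : B} (h : G.IsFour p u v c d) :
    #p.1 = 2 := by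
  rw [h.eq₁, card_pair h.huv]

theorem IsFour.symmL {p : Finset A × Finset B} {u v : A} {c d : B} (h : G.IsFour p u v c d) :
    G.IsFour p v u c d :=
  ⟨by rw [h.eq₁, pair_comm], h.eq₂, h.hv, h.hu, h.huv.symm, h.hcd, h.hvc, h.hvd, h.huc, h.hud⟩

theorem IsFour.symmR {p : Finset A × Finset B} {u v : A} {c d : B} (h : G.IsFour p u v c d) :
    G.IsFour p u v d c :=
  ⟨h.eq₁, by rw [h.eq₂, pair_comm], h.hu, h.hv, h.huv, h.hcd.symm, h.hud, h.huc, h.hvd, h.hvc⟩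

theorem State.ne_of_mem (_h : G.State C) {i : Fin m} {s w : A} (hs : s ∈ restL C)
    (hw : w ∈ (C i).1) : s ≠ w := by
  rintro rfl
  exact mem_restL.1 hs i hw

theorem State.ne_of_mem' (_h : G.State C) {i : Fin m} {s w : B} (hs : s ∈ restR C)
    (hw : w ∈ (C i).2) : s ≠ w := by
  rintro rfl
  exact mem_restR.1 hs i hw

theorem State.swapL_of_good (h : G.State C) {i : Fin m} {s w : A} (hs : G.Avail C s)
    (hw : w ∈ (C i).1) (hwS : w ∈ G.S) (hg : G.Good (insert s ((C i).1.erase w)) (C i).2) :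
    ∃ C', G.SwapL C C' i s w := by
  have h1 : insert s ((C i).1.erase w) ⊆ restL C ∪ (C i).1 := by
    intro b
    simp only [mem_insert, mem_erase, mem_union]
    rintro (rfl | h)
    · exact Or.inl hs.1
    · exact Or.inr h.2
  have hw' : w ∉ restL C := fun h' => mem_restL.1 h' i hw
  have hc : #(insert s ((C i).1.erase w)) ≤ #(C i).1 := by
    rw [hg.card_eq, (h.good i).card_eq]
  refine ⟨_, h.update hg h1 subset_union_right hc, hw, hwS, hw', fun a => ?_, ?_,
    fun j hj => by simp [hj], hg⟩
  · rw [mem_restL_update h.toIsPacking]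
    have : a ∈ restL C → a ∉ (C i).1 := fun h => mem_restL.1 h i
    simp only [mem_insert, mem_erase, not_or]
    grind
  · ext b
    rw [mem_restR_update h.toIsPacking]
    have : b ∈ restR C → b ∉ (C i).2 := fun h => mem_restR.1 h i
    tauto

theorem State.swapL (h : G.State C) {i : Fin m} {s u v : A} {c d : B}
    (hi : G.IsFour (C i) u v c d) (hs : G.Avail C s) (hc : G.adj s c) (hd : G.adj s d) :
    ∃ C', G.SwapL C C' i s u := by
  have hsv : s ≠ v := h.ne_of_mem hs.1 (i := i) (by simp [hi.eq₁])
  refine h.swapL_of_good hs (by simp [hi.eq₁]) hi.hu ?_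
  rw [hi.eq₁, hi.eq₂, erase_insert (by simpa using hi.huv)]
  exact Good.four hs.2 hi.hv hsv hi.hcd hc hd hi.hvc hi.hvd

theorem State.swapR_of_good (h : G.State C) {i : Fin m} {y p : B} (hy : y ∈ restR C)
    (hp : p ∈ (C i).2) (hg : G.Good (C i).1 (insert y ((C i).2.erase p))) :
    ∃ C', G.SwapR C C' i y p := by
  have h1 : insert y ((C i).2.erase p) ⊆ restR C ∪ (C i).2 := by
    intro b
    simp only [mem_insert, mem_erase, mem_union]
    rintro (rfl | h)
    · exact Or.inl hy
    · exact Or.inr h.2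
  have hp' : p ∉ restR C := fun h' => mem_restR.1 h' i hp
  refine ⟨_, h.update hg subset_union_right h1 le_rfl, hp, hp', ?_, fun b => ?_,
    fun j hj => by simp [hj], hg⟩
  · ext b
    rw [mem_restL_update h.toIsPacking]
    have : b ∈ restL C → b ∉ (C i).1 := fun h => mem_restL.1 h i
    tauto
  · rw [mem_restR_update h.toIsPacking]
    have : b ∈ restR C → b ∉ (C i).2 := fun h => mem_restR.1 h i
    simp only [mem_insert, mem_erase, not_or]
    grind

theorem State.swapR (h : G.State C) {i : Fin m} {y : B} {u v : A} {c d : B}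
    (hi : G.IsFour (C i) u v c d) (hy : y ∈ restR C) (hu : G.adj u y) (hv : G.adj v y) :
    ∃ C', G.SwapR C C' i y c := by
  have hyd : y ≠ d := h.ne_of_mem' hy (i := i) (by simp [hi.eq₂])
  refine h.swapR_of_good hy (by simp [hi.eq₂]) ?_
  rw [hi.eq₁, hi.eq₂, erase_insert (by simpa using hi.hcd)]
  exact Good.four hi.hu hi.hv hi.huv hyd hu hi.hud hv hi.hvd

/-- Exchanges at different cycles are independent. This carries out an exchange found for `C` after
another one that left the `j`-th cycle alone. -/
theorem SwapL.transfer {C' C'' : Fin m → Finset A × Finset B} {j : Fin m} {t w : A}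
    (hsw : G.SwapL C C' j t w) (h : G.State C'') (hj : C'' j = C j) (ht : G.Avail C'' t) :
    ∃ C₃, G.SwapL C'' C₃ j t w :=
  h.swapL_of_good ht (by rw [hj]; exact hsw.mem) hsw.marked (by rw [hj]; exact hsw.good)

theorem SwapR.transfer {C' C'' : Fin m → Finset A × Finset B} {j : Fin m} {y p : B}
    (hsw : G.SwapR C C' j y p) (h : G.State C'') (hj : C'' j = C j) (hy : y ∈ restR C'') :
    ∃ C₃, G.SwapR C'' C₃ j y p :=
  h.swapR_of_good hy (by rw [hj]; exact hsw.mem) (by rw [hj]; exact hsw.good)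

/-- A marked neighbour of `y` can be released at the cost of `s`. -/
def PairL (G : MarkedBigraph A B) (C : Fin m → Finset A × Finset B) (i : Fin m) (s : A) (y : B) :
    Prop :=
  ∃ C' w, G.SwapL C C' i s w ∧ G.adj w y

/-- A neighbour of `s` can be released at the cost of `y`. -/
def PairR (G : MarkedBigraph A B) (C : Fin m → Finset A × Finset B) (i : Fin m) (s : A) (y : B) :
    Prop :=
  ∃ C' p, G.SwapR C C' i y p ∧ G.adj s p

/-- With three edges, one of `s` and `y` sees both cycle vertices of the opposite colour, so it can
take the place of either cycle vertex of its own colour; the other one has an edge to the cycle,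
which decides whom to release. With four edges both exchanges are possible. -/
theorem State.pair_four (h : G.State C) {i : Fin m} {s : A} {y : B} (hs : G.Avail C s)
    (hy : y ∈ restR C) {u v : A} {c d : B} (hi : G.IsFour (C i) u v c d) :
    G.degL s (C i).2 + G.degR y (C i).1 ≤ #(C i).1 ∨
    (G.degL s (C i).2 + G.degR y (C i).1 = #(C i).1 + 1 ∧
      (G.PairL C i s y ∨ G.PairR C i s y)) ∨ (G.PairL C i s y ∧ G.PairR C i s y) := by
  have hL : G.adj s c → G.adj s d → (G.adj u y ∨ G.adj v y) → G.PairL C i s y := by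
    rintro h1 h2 (h3 | h3)
    · obtain ⟨C', h'⟩ := h.swapL hi hs h1 h2
      exact ⟨C', _, h', h3⟩
    · obtain ⟨C', h'⟩ := h.swapL hi.symmL hs h1 h2
      exact ⟨C', _, h', h3⟩
  have hR : G.adj u y → G.adj v y → (G.adj s c ∨ G.adj s d) → G.PairR C i s y := by
    rintro h1 h2 (h3 | h3)
    · obtain ⟨C', h'⟩ := h.swapR hi hy h1 h2
      exact ⟨C', _, h', h3⟩
    · obtain ⟨C', h'⟩ := h.swapR hi.symmR hy h1 h2
      exact ⟨C', _, h', h3⟩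
  rw [hi.card, hi.eq₁, hi.eq₂, degL_pair hi.hcd, degR_pair hi.huv]
  by_cases h1 : G.adj s c <;> by_cases h2 : G.adj s d <;> by_cases h3 : G.adj u y <;>
    by_cases h4 : G.adj v y <;> simp [ind, h1, h2, h3, h4] at hL hR ⊢ <;> tauto

/-- Too many edges would close a four-cycle, or in the octagon case a hexagon with two marked
vertices, inside the cycle together with `s` and `y`. The only exception is a hexagon with four
edges, where `y` can be exchanged. If `s` and `y` are adjacent, even this case closes a four-cycle.
-/
theorem State.pair_long (h : G.State C) {i : Fin m} {s : A} {y : B} (hs : G.Avail C s)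
    (hy : y ∈ restR C) (hg : G.Good (C i).1 (C i).2) (hi : 2 < #(C i).1) :
    G.degL s (C i).2 + G.degR y (C i).1 ≤ #(C i).1 ∨
    (G.degL s (C i).2 + G.degR y (C i).1 = #(C i).1 + 1 ∧ #(C i).1 = 3 ∧ G.PairR C i s y ∧
      ¬ G.adj s y) := by
  have hsU : s ∈ restL C ∪ (C i).1 := mem_union_left _ hs.1
  have hyU : y ∈ restR C ∪ (C i).2 := mem_union_left _ hy
  obtain ⟨P, hP⟩ : ∃ P, (C i).1 = P := ⟨_, rfl⟩
  obtain ⟨Q, hQ⟩ : ∃ Q, (C i).2 = Q := ⟨_, rfl⟩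
  have hs' : ∀ {w}, w ∈ P → s ≠ w := fun hw => h.ne_of_mem hs.1 (i := i) (hP ▸ hw)
  have hy' : ∀ {w}, w ∈ Q → y ≠ w := fun hw => h.ne_of_mem' hy (i := i) (hQ ▸ hw)
  have hUL : ∀ {w}, w ∈ P → w ∈ restL C ∪ (C i).1 := fun hw => mem_union_right _ (hP ▸ hw)
  have hUR : ∀ {w}, w ∈ Q → w ∈ restR C ∪ (C i).2 := fun hw => mem_union_right _ (hQ ▸ hw)
  rw [hP, hQ] at hg
  have h4 := @State.no_four _ _ _ _ _ _ G m C h i hi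
  have hss := hs.2
  cases hg with
  | four _ _ huv => rw [hP, card_pair huv] at hi; omega
  | @six u x v a b c hu hx hv huv hab hac hbc hua hxa hxb hvb hvc huc =>
    have hux := ne_of_mem_of_not_mem hu hx
    have hvx := ne_of_mem_of_not_mem hv hx
    have e1 : #({u, x, v} : Finset A) = 3 :=
      card_eq_three.2 ⟨_, _, _, hux, huv, hvx.symm, rfl⟩
    simp only [mem_insert, mem_singleton, forall_eq_or_imp, forall_eq] at hs' hy' hUL hUR
    have k1 : ind (G.adj s a) + ind (G.adj s c) ≤ 1 := ind_add_le fun p q =>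
      h4 (c := a) (d := c) hsU hUL.1 hUR.1 hUR.2.2 hss hu hs'.1 hac p q hua huc
    have k2 : ind (G.adj s b) + ind (G.adj s c) ≤ 1 := ind_add_le fun p q =>
      h4 (c := b) (d := c) hsU hUL.2.2 hUR.2.1 hUR.2.2 hss hv hs'.2.2 hbc p q hvb hvc
    have k3 : ind (G.adj u y) + ind (G.adj v y) ≤ 1 := ind_add_le fun p q =>
      h4 (c := y) (d := c) hUL.1 hUL.2.2 hyU hUR.2.2 hu hv huv hy'.2.2 p huc q hvc
    have k4 : G.adj s y → ind (G.adj s a) + ind (G.adj u y) ≤ 1 := fun t => ind_add_le fun p q =>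
      h4 (c := y) (d := a) hsU hUL.1 hyU hUR.1 hss hu hs'.1 hy'.1 t p q hua
    have k5 : G.adj s y → ind (G.adj s b) + ind (G.adj v y) ≤ 1 := fun t => ind_add_le fun p q =>
      h4 (c := y) (d := b) hsU hUL.2.2 hyU hUR.2.1 hss hv hs'.2.2 hy'.2.1 t p q hvb
    -- The hexagon is `u a x b v c`. If `y` sees `x` and `u` it can replace `a`, and if it sees `x`
    -- and `v` it can replace `b`; in both cases the released vertex is a neighbour of `s`.
    have k6 : G.adj s a → G.adj s b → G.adj x y → G.adj u y ∨ G.adj v y → G.PairR C i s y := by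
      rintro p q r (t | t)
      · obtain ⟨C', h'⟩ := h.swapR_of_good (i := i) (p := a) hy (by simp [hQ]) (by
          rw [hP, hQ, erase_insert (by simp [hab, hac])]
          exact Good.six hu hx hv huv hy'.2.1 hy'.2.2 hbc t r hxb hvb hvc huc)
        exact ⟨_, _, h', p⟩
      · obtain ⟨C', h'⟩ := h.swapR_of_good (i := i) (p := b) hy (by simp [hQ]) (by
          have e : insert y (({a, b, c} : Finset B).erase b) = {a, y, c} := by
            rw [insert_comm a b, erase_insert (by simp [hab.symm, hbc]), insert_comm]
          rw [hP, hQ, e]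
          exact Good.six hu hx hv huv hy'.1.symm hac hy'.2.2 hua hxa r t hvc huc)
        exact ⟨_, _, h', q⟩
    rw [hP, hQ, degL_insert (by simp [hab, hac]), degL_pair hbc, degR_insert (by simp [hux, huv]),
      degR_pair hvx.symm, e1]
    have b1 := ind_le (G.adj s a)
    have b2 := ind_le (G.adj s b)
    have b3 := ind_le (G.adj x y)
    by_cases a1 : G.adj s a
    swap
    · have := ind_not a1
      omega
    by_cases a2 : G.adj s b
    swap
    · have := ind_not a2
      omega
    by_cases a3 : G.adj x y
    swap
    · have := ind_not a3
      omega
    by_cases a4 : G.adj u y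
    · have := ind_of a4
      have := ind_of a1
      by_cases t : G.adj s y
      · have := k4 t
        omega
      · have := k6 a1 a2 a3 (Or.inl a4)
        by_cases h' : ind (G.adj s a) + (ind (G.adj s b) + ind (G.adj s c)) +
          (ind (G.adj u y) + (ind (G.adj x y) + ind (G.adj v y))) ≤ 3
        · exact Or.inl h'
        · exact Or.inr ⟨by omega, rfl, this, t⟩
    by_cases a5 : G.adj v y
    · have := ind_of a5
      have := ind_of a2
      by_cases t : G.adj s y
      · have := k5 t
        omega
      · have := k6 a1 a2 a3 (Or.inr a5)
        by_cases h' : ind (G.adj s a) + (ind (G.adj s b) + ind (G.adj s c)) +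
          (ind (G.adj u y) + (ind (G.adj x y) + ind (G.adj v y))) ≤ 3
        · exact Or.inl h'
        · exact Or.inr ⟨by omega, rfl, this, t⟩
    have := ind_not a4
    have := ind_not a5
    omega
  | @eight u x v x' a b c d hu hx hv hx' huv hxx' hab hac had hbc hbd hcd hua hxa hxb hvb hvc hxc
      hxd hud =>
    left
    have hux := ne_of_mem_of_not_mem hu hx
    have hvx := ne_of_mem_of_not_mem hv hx
    have hux' := ne_of_mem_of_not_mem hu hx'
    have hvx' := ne_of_mem_of_not_mem hv hx'
    have e1 : #({u, x, v, x'} : Finset A) = 4 := by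
      rw [card_insert_of_notMem (by simp [*]),
        card_eq_three.2 ⟨_, _, _, hvx.symm, hxx', hvx', rfl⟩]
    have h6 := @State.no_six _ _ _ _ _ _ G m C h i (by rw [hP, e1]; simp)
    simp only [mem_insert, mem_singleton, forall_eq_or_imp, forall_eq] at hs' hy' hUL hUR
    obtain ⟨su, sx, sv, sx'⟩ := hs'
    obtain ⟨ya, yb, yc, yd⟩ := hy'
    obtain ⟨Uu, Ux, Uv, Ux'⟩ := hUL
    obtain ⟨Ua, Ub, Uc, Ud⟩ := hUR
    -- The octagon is `u a x b v c x' d`. By `k1` to `k4`, two neighbours of `s` on it must be `a,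
    -- b` or `c, d`. Then `k6` to `k9` cap the neighbours of `y` at two; otherwise `k5` caps them at
    -- three.
    have k1 : ind (G.adj s a) + ind (G.adj s d) ≤ 1 := ind_add_le fun p q =>
      h4 (c := a) (d := d) hsU Uu Ua Ud hss hu su had p q hua hud
    have k2 : ind (G.adj s b) + ind (G.adj s c) ≤ 1 := ind_add_le fun p q =>
      h4 (c := b) (d := c) hsU Uv Ub Uc hss hv sv hbc p q hvb hvc
    have k3 : ind (G.adj s a) + ind (G.adj s c) ≤ 1 := ind_add_le fun p q =>
      h6 Uu Ux' hsU Ud Uc Ua hu hx' hss su.symm hcd.symm had.symm hac.symm hud hxd hxc q p hua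
    have k4 : ind (G.adj s b) + ind (G.adj s d) ≤ 1 := ind_add_le fun p q =>
      h6 Uv Ux' hsU Uc Ud Ub hv hx' hss sv.symm hcd hbc.symm hbd.symm hvc hxc hxd q p hvb
    have k5 : ind (G.adj u y) + ind (G.adj v y) ≤ 1 := ind_add_le fun p q =>
      h6 Uu Ux Uv Ua Ub hyU hu hx hv huv hab ya.symm yb.symm hua hxa hxb hvb q p
    have k6 : G.adj s a → G.adj s b → ind (G.adj u y) + ind (G.adj x y) ≤ 1 := fun m n =>
      ind_add_le fun p q =>
      h6 Uu Ux hsU hyU Ub Ua hu hx hss su.symm yb ya hab.symm p q hxb n m hua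
    have k7 : G.adj s a → G.adj s b → ind (G.adj v y) + ind (G.adj x y) ≤ 1 := fun m n =>
      ind_add_le fun p q =>
      h6 Uv Ux hsU hyU Ua Ub hv hx hss sv.symm ya yb hab p q hxa m n hvb
    have k8 : G.adj s c → G.adj s d → ind (G.adj v y) + ind (G.adj x' y) ≤ 1 := fun m n =>
      ind_add_le fun p q =>
      h6 Uv Ux' hsU hyU Ud Uc hv hx' hss sv.symm yd yc hcd.symm p q hxd n m hvc
    have k9 : G.adj s c → G.adj s d → ind (G.adj u y) + ind (G.adj x' y) ≤ 1 := fun m n =>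
      ind_add_le fun p q =>
      h6 Uu Ux' hsU hyU Uc Ud hu hx' hss su.symm yc yd hcd p q hxc m n hud
    rw [hP, hQ, degL_insert (by simp [*]), degL_insert (by simp [*]), degL_pair hcd,
      degR_insert (by simp [*]), degR_insert (by simp [hvx.symm, *]), degR_pair hvx', e1]
    have b1 := ind_le (G.adj s a)
    have b2 := ind_le (G.adj s b)
    have b3 := ind_le (G.adj s c)
    have b4 := ind_le (G.adj s d)
    have b5 := ind_le (G.adj x y)
    have b6 := ind_le (G.adj x' y)
    by_cases a1 : G.adj s a
    · by_cases a2 : G.adj s b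
      · have := k6 a1 a2
        have := k7 a1 a2
        have := ind_of a1
        have := ind_of a2
        omega
      · have := ind_of a1
        have := ind_not a2
        omega
    · have := ind_not a1
      by_cases a3 : G.adj s c
      · by_cases a4 : G.adj s d
        · have := k8 a3 a4
          have := k9 a3 a4
          have := ind_of a3
          have := ind_of a4
          omega
        · have := ind_of a3
          have := ind_not a4
          omega
      · have := ind_not a3
        omega

theorem State.four_or_long (h : G.State C) (i : Fin m) :
    (∃ u v c d, G.IsFour (C i) u v c d) ∨ 2 < #(C i).1 := by
  have hg := h.good i
  generalize hP : (C i).1 = P, hQ : (C i).2 = Q at hg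
  cases hg with
  | @four u v c d => left; exact ⟨u, v, c, d, by assumption, by assumption, by assumption,
      by assumption, by assumption, by assumption, by assumption, by assumption, by assumption,
      by assumption⟩
  | @six u x v a b c hu hx hv huv =>
    right
    rw [card_eq_three.2 ⟨_, _, _, ne_of_mem_of_not_mem hu hx, huv,
      (ne_of_mem_of_not_mem hv hx).symm, rfl⟩]
    simp
  | @eight u x v x' a b c d hu hx hv hx' huv =>
    right
    have : #({u, x, v} : Finset A) = 3 := card_eq_three.2 ⟨_, _, _, ne_of_mem_of_not_mem hu hx, huv,
      (ne_of_mem_of_not_mem hv hx).symm, rfl⟩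
    have h2 : #({u, x, v} : Finset A) ≤ #({u, x, v, x'} : Finset A) :=
      card_le_card (by intro; simp; tauto)
    omega

/-- How a marked vertex `s` and a vertex `y` outside the packing may attach to one of its cycles. -/
theorem State.pair (h : G.State C) (i : Fin m) {s : A} {y : B} (hs : G.Avail C s)
    (hy : y ∈ restR C) :
    G.degL s (C i).2 + G.degR y (C i).1 ≤ #(C i).1 ∨
    (G.degL s (C i).2 + G.degR y (C i).1 = #(C i).1 + 1 ∧
      (G.PairL C i s y ∨ G.PairR C i s y)) ∨ (G.PairL C i s y ∧ G.PairR C i s y) := by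
  rcases h.four_or_long i with ⟨u, v, c, d, hi⟩ | hi
  · exact h.pair_four hs hy hi
  · rcases h.pair_long hs hy (h.good i) hi with h1 | h1
    · exact Or.inl h1
    · exact Or.inr (Or.inl ⟨h1.1, Or.inr h1.2.2.1⟩)

theorem State.pair_long_of_adj (h : G.State C) {i : Fin m} {s : A} {y : B} (hs : G.Avail C s)
    (hy : y ∈ restR C) (hi : 2 < #(C i).1) (hsy : G.adj s y) :
    G.degL s (C i).2 + G.degR y (C i).1 ≤ #(C i).1 :=
  (h.pair_long hs hy (h.good i) hi).resolve_right fun h' => h'.2.2.2 hsy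

/-! ### Degree counts and pigeonhole arguments -/

theorem degL_eq_sum (s : A) (Q : Finset B) : G.degL s Q = ∑ y ∈ Q, ind (G.adj s y) := by
  simp [degL, ind]

theorem degR_eq_sum (y : B) (P : Finset A) : G.degR y P = ∑ x ∈ P, ind (G.adj x y) := by
  simp [degR, ind]

/-- `T` holds the exceptional elements, each exceeding the normal bound by at most `k`. -/
theorem sum_le_card_add {α : Type*} [DecidableEq α] {Y : Finset α} {f : α → ℕ} (T : Finset α)
    (k : ℕ) (h1 : ∀ y ∈ Y, y ∉ T → f y ≤ 1) (h2 : ∀ y ∈ Y, f y ≤ 1 + k) :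
    ∑ y ∈ Y, f y ≤ #Y + k * #T := by
  calc ∑ y ∈ Y, f y ≤ ∑ y ∈ Y, (1 + if y ∈ T then k else 0) := by
        refine sum_le_sum fun y hy => ?_
        by_cases h : y ∈ T
        · simpa [h] using h2 y hy
        · simpa [h] using h1 y hy h
    _ = #Y + k * #(Y.filter (· ∈ T)) := by
        rw [sum_add_distrib, ← sum_filter]
        simp [mul_comm]
    _ ≤ #Y + k * #T := by
        gcongr
        intro a ha
        exact (mem_filter.1 ha).2

theorem degL_add_add_le {s₁ s₂ s₃ : A} {Y : Finset B} (T : Finset B) (k : ℕ)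
    (h1 : ∀ y ∈ Y, y ∉ T → ind (G.adj s₁ y) + ind (G.adj s₂ y) + ind (G.adj s₃ y) ≤ 1)
    (h2 : ∀ y ∈ Y, ind (G.adj s₁ y) + ind (G.adj s₂ y) + ind (G.adj s₃ y) ≤ 1 + k) :
    G.degL s₁ Y + G.degL s₂ Y + G.degL s₃ Y ≤ #Y + k * #T := by
  rw [degL_eq_sum, degL_eq_sum, degL_eq_sum, ← sum_add_distrib, ← sum_add_distrib]
  exact sum_le_card_add T k h1 h2

theorem degR_add_add_le {y₁ y₂ y₃ : B} {X : Finset A} (T : Finset A) (k : ℕ)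
    (h1 : ∀ x ∈ X, x ∉ T → ind (G.adj x y₁) + ind (G.adj x y₂) + ind (G.adj x y₃) ≤ 1)
    (h2 : ∀ x ∈ X, ind (G.adj x y₁) + ind (G.adj x y₂) + ind (G.adj x y₃) ≤ 1 + k) :
    G.degR y₁ X + G.degR y₂ X + G.degR y₃ X ≤ #X + k * #T := by
  rw [degR_eq_sum, degR_eq_sum, degR_eq_sum, ← sum_add_distrib, ← sum_add_distrib]
  exact sum_le_card_add T k h1 h2

theorem degR_add_le {y₁ y₂ : B} {X : Finset A} (T : Finset A)
    (h1 : ∀ x ∈ X, G.adj x y₁ → G.adj x y₂ → x ∈ T) :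
    G.degR y₁ X + G.degR y₂ X ≤ #X + #T := by
  rw [degR_eq_sum, degR_eq_sum, ← sum_add_distrib]
  have := sum_le_card_add (Y := X) (f := fun x => ind (G.adj x y₁) + ind (G.adj x y₂)) T 1
    (fun x hx hT => ind_add_le fun p q => hT (h1 x hx p q))
    (fun x hx => add_le_add (ind_le _) (ind_le _))
  simpa using this

theorem degL_le_card {s : A} {Y : Finset B} (T : Finset B) (h : ∀ y ∈ Y, G.adj s y → y ∈ T) :
    G.degL s Y ≤ #T := by
  classical
  refine card_le_card fun y hy => ?_
  rw [mem_filter] at hy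
  exact h y hy.1 hy.2

theorem degL_le_one {s : A} {Y : Finset B} (z : B) (h : ∀ y ∈ Y, G.adj s y → y = z) :
    G.degL s Y ≤ 1 :=
  degL_le_card {z} (by simpa using h)

theorem degR_add_card_le {y : B} {X : Finset A} (T : Finset A) (hT : T ⊆ X)
    (h : ∀ x ∈ T, ¬ G.adj x y) : G.degR y X + #T ≤ #X := by
  classical
  unfold degR
  rw [← card_union_of_disjoint]
  · exact card_le_card (union_subset (filter_subset _ _) hT)
  · rw [Finset.disjoint_right]
    intro x hx hx'
    exact h x hx (mem_filter.1 hx').2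

theorem degR_add_one_le {y : B} {X : Finset A} {x : A} (hx : x ∈ X) (h : ¬ G.adj x y) :
    G.degR y X + 1 ≤ #X := by
  simpa using degR_add_card_le {x} (by simpa using hx) (by simpa using h)

theorem degR_add_two_le {y : B} {X : Finset A} {x x' : A} (hx : x ∈ X) (hx' : x' ∈ X)
    (hne : x ≠ x') (h : ¬ G.adj x y) (h' : ¬ G.adj x' y) : G.degR y X + 2 ≤ #X := by
  have := degR_add_card_le (G := G) (y := y) (X := X) {x, x'}
    (by simp [insert_subset_iff, hx, hx']) (by simp [h, h'])
  rwa [card_pair hne] at this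

/-- A total excess of `k + 1` cannot sit at a single index, since each index carries at most `k`. -/
theorem exists_two_of_sum {f g : Fin m → ℕ} {k : ℕ} (hk : ∑ i, g i + (k + 1) ≤ ∑ i, f i)
    (hg : ∀ i, f i ≤ g i + k) : ∃ i j, i ≠ j ∧ g i < f i ∧ g j < f j := by
  by_contra! hcon
  obtain ⟨i, -, hi⟩ : ∃ i ∈ univ, g i < f i := exists_lt_of_sum_lt (by omega)
  have h1 : ∑ j ∈ univ.erase i, f j ≤ ∑ j ∈ univ.erase i, g j :=
    sum_le_sum fun j hj => hcon i j (ne_of_mem_erase hj).symm hi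
  have h2 := add_sum_erase univ f (mem_univ i)
  have h3 := add_sum_erase univ g (mem_univ i)
  have := hg i
  omega

theorem State.exists_avail (h : G.State C) (s₁ s₂ : A) :
    ∃ s₃, G.Avail C s₃ ∧ s₃ ≠ s₁ ∧ s₃ ≠ s₂ := by
  have h1 : #({s₁, s₂} : Finset A) < #((restL C).filter (· ∈ G.S)) :=
    card_le_two.trans_lt h.three_le_marked
  obtain ⟨x, hx, hx'⟩ := exists_mem_notMem_of_card_lt_card h1
  simp only [mem_insert, mem_singleton, not_or] at hx'
  exact ⟨x, mem_filter.1 hx, hx'⟩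

theorem State.exists_restR (h : G.State C) (y₁ y₂ : B) :
    ∃ y₃ ∈ restR C, y₃ ≠ y₁ ∧ y₃ ≠ y₂ := by
  have h1 : #({y₁, y₂} : Finset B) < #(restR C) :=
    card_le_two.trans_lt (h.card_eq ▸ h.three_le_card)
  obtain ⟨x, hx, hx'⟩ := exists_mem_notMem_of_card_lt_card h1
  simp only [mem_insert, mem_singleton, not_or] at hx'
  exact ⟨x, hx, hx'⟩

/-- The degree condition has a surplus of one, so if the uncovered part contributes at most `#(restL
C)` edges, some cycle receives more than half its length. -/
theorem State.exists_pair (h : G.State C) {s : A} {y : B} (hs : G.Avail C s)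
    (hy : y ∈ restR C) (hsy : ¬ G.adj s y)
    (hd : G.degL s (restR C) + G.degR y (restL C) ≤ #(restL C)) :
    ∃ i, G.PairL C i s y ∨ G.PairR C i s y := by
  have h1 := h.ore_sum hs.2 hsy
  obtain ⟨i, -, hi⟩ : ∃ i ∈ univ, #(C i).1 < G.degL s (C i).2 + G.degR y (C i).1 :=
    exists_lt_of_sum_lt (by omega)
  refine ⟨i, ?_⟩
  rcases h.pair i hs hy with h2 | h2 | h2
  · omega
  · exact h2.2
  · exact Or.inl h2.1

/-- Here the excess on the cycles is at least two: either one cycle allows both kinds of exchange,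
or two different cycles allow one each. -/
theorem State.exists_pairs (h : G.State C) {s : A} {y : B} (hs : G.Avail C s)
    (hy : y ∈ restR C) (hsy : ¬ G.adj s y)
    (hd : G.degL s (restR C) + G.degR y (restL C) < #(restL C)) :
    (∃ i, G.PairL C i s y ∧ G.PairR C i s y) ∨
      ∃ i j, i ≠ j ∧ (G.PairL C i s y ∨ G.PairR C i s y) ∧
        (G.PairL C j s y ∨ G.PairR C j s y) := by
  have h1 := h.ore_sum hs.2 hsy
  by_cases h3 : ∃ i, G.PairL C i s y ∧ G.PairR C i s y
  · exact Or.inl h3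
  have h4 : ∀ i, G.degL s (C i).2 + G.degR y (C i).1 ≤ #(C i).1 ∨
      (G.degL s (C i).2 + G.degR y (C i).1 = #(C i).1 + 1 ∧
        (G.PairL C i s y ∨ G.PairR C i s y)) := by
    intro i
    rcases h.pair i hs hy with h2 | h2 | h2
    · exact Or.inl h2
    · exact Or.inr h2
    · exact absurd ⟨i, h2⟩ h3
  obtain ⟨i, j, hij, hi, hj⟩ := exists_two_of_sum (k := 1)
    (f := fun i => G.degL s (C i).2 + G.degR y (C i).1) (g := fun i => #(C i).1)
    (by omega) (fun i => by rcases h4 i with h5 | h5 <;> omega)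
  exact Or.inr ⟨i, j, hij, ((h4 i).resolve_left (by omega)).2, ((h4 j).resolve_left (by omega)).2⟩

/-! ### Six uncovered vertices against one four-cycle -/

/-- The number of edges between `s₁, s₂, s₃, y₁, y₂, y₃` and a member of the packing. -/
noncomputable def deg₆ (G : MarkedBigraph A B) (p : Finset A × Finset B) (s₁ s₂ s₃ : A)
    (y₁ y₂ y₃ : B) : ℕ :=
  (G.degL s₁ p.2 + G.degL s₂ p.2 + G.degL s₃ p.2) +
    (G.degR y₁ p.1 + G.degR y₂ p.1 + G.degR y₃ p.1)

theorem IsFour.deg₆_eq {p : Finset A × Finset B} {u v : A} {c d : B} (h : G.IsFour p u v c d)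
    (s₁ s₂ s₃ : A) (y₁ y₂ y₃ : B) :
    G.deg₆ p s₁ s₂ s₃ y₁ y₂ y₃ = ind (G.adj s₁ c) + ind (G.adj s₁ d) + ind (G.adj s₂ c) +
      ind (G.adj s₂ d) + ind (G.adj s₃ c) + ind (G.adj s₃ d) + ind (G.adj u y₁) +
      ind (G.adj v y₁) + ind (G.adj u y₂) + ind (G.adj v y₂) + ind (G.adj u y₃) +
      ind (G.adj v y₃) := by
  rw [deg₆, h.eq₁, h.eq₂]
  simp only [degL_pair h.hcd, degR_pair h.huv]
  omega

/-- The nonadjacent pairs are a cyclic shift of the pairs `sⱼ, yⱼ`, so each of the six vertices is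
counted once. -/
theorem State.ore_six (h : G.State C) {s₁ s₂ s₃ : A} {y₁ y₂ y₃ : B}
    (h1 : s₁ ∈ G.S) (h2 : s₂ ∈ G.S) (h3 : s₃ ∈ G.S)
    (n1 : ¬ G.adj s₁ y₂) (n2 : ¬ G.adj s₂ y₃) (n3 : ¬ G.adj s₃ y₁) :
    ∑ i, 3 * #(C i).1 + 3 * #(restL C) + 3 ≤ ∑ i, G.deg₆ (C i) s₁ s₂ s₃ y₁ y₂ y₃ +
      G.deg₆ (restL C, restR C) s₁ s₂ s₃ y₁ y₂ y₃ := by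
  have e1 := h.ore_sum h1 n1
  have e2 := h.ore_sum h2 n2
  have e3 := h.ore_sum h3 n3
  rw [← mul_sum]
  simp only [deg₆, sum_add_distrib] at *
  omega

/-- Since each `sⱼ` is adjacent to `yⱼ`, the exceptional hexagon case cannot occur, and a longer
cycle would receive at most half its length from each of the three pairs. -/
theorem State.four_of_deg₆ (h : G.State C) {s₁ s₂ s₃ : A} {y₁ y₂ y₃ : B}
    (h1 : G.Avail C s₁) (h2 : G.Avail C s₂) (h3 : G.Avail C s₃)
    (hy1 : y₁ ∈ restR C) (hy2 : y₂ ∈ restR C) (hy3 : y₃ ∈ restR C)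
    (a1 : G.adj s₁ y₁) (a2 : G.adj s₂ y₂) (a3 : G.adj s₃ y₃) {i : Fin m}
    (hi : 3 * #(C i).1 < G.deg₆ (C i) s₁ s₂ s₃ y₁ y₂ y₃) :
    ∃ u v c d, G.IsFour (C i) u v c d := by
  refine (h.four_or_long i).resolve_right fun h4 => ?_
  have e1 := h.pair_long_of_adj h1 hy1 h4 a1
  have e2 := h.pair_long_of_adj h2 hy2 h4 a2
  have e3 := h.pair_long_of_adj h3 hy3 h4 a3
  unfold deg₆ at hi
  omega

theorem State.exists_four (h : G.State C) {s₁ s₂ s₃ : A} {y₁ y₂ y₃ : B}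
    (h1 : G.Avail C s₁) (h2 : G.Avail C s₂) (h3 : G.Avail C s₃)
    (hy1 : y₁ ∈ restR C) (hy2 : y₂ ∈ restR C) (hy3 : y₃ ∈ restR C)
    (a1 : G.adj s₁ y₁) (a2 : G.adj s₂ y₂) (a3 : G.adj s₃ y₃)
    (n1 : ¬ G.adj s₁ y₂) (n2 : ¬ G.adj s₂ y₃) (n3 : ¬ G.adj s₃ y₁)
    (hd : G.deg₆ (restL C, restR C) s₁ s₂ s₃ y₁ y₂ y₃ ≤ 3 * #(restL C) + 2) :
    ∃ i u v c d, G.IsFour (C i) u v c d ∧ 7 ≤ G.deg₆ (C i) s₁ s₂ s₃ y₁ y₂ y₃ := by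
  have e := h.ore_six h1.2 h2.2 h3.2 n1 n2 n3
  obtain ⟨i, -, hi⟩ : ∃ i ∈ univ, 3 * #(C i).1 < G.deg₆ (C i) s₁ s₂ s₃ y₁ y₂ y₃ :=
    exists_lt_of_sum_lt (by omega)
  obtain ⟨u, v, c, d, h4⟩ := h.four_of_deg₆ h1 h2 h3 hy1 hy2 hy3 a1 a2 a3 hi
  rw [h4.card] at hi
  exact ⟨i, u, v, c, d, h4, hi⟩

/-- Five marked vertices and `k` vertices on the other side that are uncovered or lie on the
`i`-th cycle. -/
structure Labeling (G : MarkedBigraph A B) (C : Fin m → Finset A × Finset B) (i : Fin m) {k : ℕ}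
    (f : Fin 5 → A) (g : Fin k → B) : Prop where
  state : G.State C
  card : #(C i).1 = 2
  injL : Function.Injective f
  injR : Function.Injective g
  memL : ∀ j, f j ∈ restL C ∪ (C i).1
  memR : ∀ j, g j ∈ restR C ∪ (C i).2
  marked : ∀ j, f j ∈ G.S

variable {i : Fin m} {k : ℕ} {f : Fin 5 → A} {g : Fin k → B}

/-- Any four-cycle on labelled vertices may replace the `i`-th cycle, also a four-cycle. All unused
labelled vertices become uncovered. -/
theorem Labeling.swap (h : G.Labeling C i f g) {p q : Fin 5} {r t : Fin k} (hpq : p ≠ q)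
    (hrt : r ≠ t) (a1 : G.adj (f p) (g r)) (a2 : G.adj (f p) (g t)) (a3 : G.adj (f q) (g r))
    (a4 : G.adj (f q) (g t)) : ∃ C' : Fin m → Finset A × Finset B, G.State C' ∧
      (∀ x, x ≠ p → x ≠ q → G.Avail C' (f x)) ∧ ∀ y, y ≠ r → y ≠ t → g y ∈ restR C' := by
  have hg := Good.four (h.marked p) (h.marked q) (h.injL.ne hpq) (h.injR.ne hrt) a1 a2 a3 a4
  have hP : {f p, f q} ⊆ restL C ∪ (C i).1 := by
    simp only [insert_subset_iff, singleton_subset_iff]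
    exact ⟨h.memL p, h.memL q⟩
  have hQ : {g r, g t} ⊆ restR C ∪ (C i).2 := by
    simp only [insert_subset_iff, singleton_subset_iff]
    exact ⟨h.memR r, h.memR t⟩
  refine ⟨_, h.state.update hg hP hQ (by rw [h.card]; exact card_le_two), fun x hp hq => ⟨?_, h.marked x⟩,
    fun y hr ht => ?_⟩
  · rw [mem_restL_update h.state.toIsPacking]
    exact ⟨mem_union.1 (h.memL x), by simp [h.injL.eq_iff, hp, hq]⟩
  · rw [mem_restR_update h.state.toIsPacking]
    exact ⟨mem_union.1 (h.memR y), by simp [h.injR.eq_iff, hr, ht]⟩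

theorem State.no_four_rest (h : G.State C) {u v : A} {c d : B}
    (hu : G.Avail C u) (hv : G.Avail C v) (hc : c ∈ restR C) (hd : d ∈ restR C)
    (huv : u ≠ v) (hcd : c ≠ d)
    (huc : G.adj u c) (hud : G.adj u d) (hvc : G.adj v c) (hvd : G.adj v d) : False :=
  h.no_good (Good.four hu.2 hv.2 huv hcd huc hud hvc hvd)
    (by simp [insert_subset_iff, hu.1, hv.1]) (by simp [insert_subset_iff, hc, hd])

theorem State.no_six_rest (h : G.State C) {u x v : A} {a b c : B}
    (hu : G.Avail C u) (hx : x ∈ restL C) (hxS : x ∉ G.S) (hv : G.Avail C v)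
    (ha : a ∈ restR C) (hb : b ∈ restR C) (hc : c ∈ restR C) (huv : u ≠ v)
    (hab : a ≠ b) (hac : a ≠ c) (hbc : b ≠ c) (hua : G.adj u a) (hxa : G.adj x a)
    (hxb : G.adj x b) (hvb : G.adj v b) (hvc : G.adj v c) (huc : G.adj u c) : False :=
  h.no_good (Good.six hu.2 hxS hv.2 huv hab hac hbc hua hxa hxb hvb hvc huc)
    (by simp [insert_subset_iff, hu.1, hv.1, hx]) (by simp [insert_subset_iff, ha, hb, hc])

/-- Two disjoint four-cycles in place of one would give `m + 1` cycles. The versions below named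
after a configuration use one four-cycle and leave that configuration uncovered. -/
theorem Labeling.two (h : G.Labeling C i f g) (p q p' q' : Fin 5) (r t r' t' : Fin k)
    (a1 : G.adj (f p) (g r)) (a2 : G.adj (f p) (g t)) (a3 : G.adj (f q) (g r))
    (a4 : G.adj (f q) (g t)) (b1 : G.adj (f p') (g r')) (b2 : G.adj (f p') (g t'))
    (b3 : G.adj (f q') (g r')) (b4 : G.adj (f q') (g t'))
    (hd : [p, q, p', q'].Nodup := by decide) (hd' : [r, t, r', t'].Nodup := by decide) :
    False := by
  simp only [List.nodup_cons, List.mem_cons, List.not_mem_nil, or_false, not_or] at hd hd'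
  obtain ⟨C', h', hf, hg⟩ := h.swap hd.1.1 hd'.1.1 a1 a2 a3 a4
  exact h'.no_four_rest (hf p' (Ne.symm hd.1.2.1) (Ne.symm hd.2.1.1))
    (hf q' (Ne.symm hd.1.2.2) (Ne.symm hd.2.1.2))
    (hg r' (Ne.symm hd'.1.2.1) (Ne.symm hd'.2.1.1))
    (hg t' (Ne.symm hd'.1.2.2) (Ne.symm hd'.2.1.2)) (h.injL.ne hd.2.2.1) (h.injR.ne hd'.2.2.1)
    b1 b2 b3 b4

theorem ind_add_add_le_one {p q r : Prop} (h1 : p → q → False) (h2 : p → r → False)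
    (h3 : q → r → False) : ind p + ind q + ind r ≤ 1 := by
  by_cases hp : p <;> by_cases hq : q <;> by_cases hr : r <;> simp [ind, hp, hq, hr] <;> tauto

theorem ind_add_add_le_two {p q r : Prop} (h1 : p → q → r → False) :
    ind p + ind q + ind r ≤ 2 := by
  have hp := ind_le p
  have hq := ind_le q
  have hr := ind_le r
  by_contra hlt
  have pos : ∀ {p : Prop}, ind p ≠ 0 → p := fun {p} hp => by
    by_contra h
    exact hp (ind_not h)
  exact h1 (pos (by omega)) (pos (by omega)) (pos (by omega))

theorem ind_add_add_le_three (p q r : Prop) : ind p + ind q + ind r ≤ 3 :=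
  add_le_add (add_le_add (ind_le p) (ind_le q)) (ind_le r)

/-- Lets the cyclic order of the nonadjacent pairs differ from the order of the labels. -/
theorem deg₆_swap (p : Finset A × Finset B) (s₁ s₂ s₃ : A) (y₁ y₂ y₃ : B) :
    G.deg₆ p s₁ s₃ s₂ y₁ y₃ y₂ = G.deg₆ p s₁ s₂ s₃ y₁ y₂ y₃ := by
  unfold deg₆
  omega

/-- Turns unknown propositions into Booleans, so that the edge patterns can be checked by `decide`.
-/
theorem exists_eq_true (p : Prop) : ∃ b : Bool, p = (b = true) := by
  by_cases h : p
  · exact ⟨true, by simp [h]⟩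
  · exact ⟨false, by simp [h]⟩

theorem ind_eq_toNat (b : Bool) : ind (b = true) = b.toNat := by
  cases b <;> simp [ind]

theorem labeling_three (h : G.State C) {i : Fin m} {u v : A} {c d : B}
    (hi : G.IsFour (C i) u v c d) {s₁ s₂ s₃ : A} {y₁ y₂ y₃ : B}
    (h1 : G.Avail C s₁) (h2 : G.Avail C s₂) (h3 : G.Avail C s₃)
    (hy1 : y₁ ∈ restR C) (hy2 : y₂ ∈ restR C) (hy3 : y₃ ∈ restR C)
    (h12 : s₁ ≠ s₂) (h13 : s₁ ≠ s₃) (h23 : s₂ ≠ s₃)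
    (k12 : y₁ ≠ y₂) (k13 : y₁ ≠ y₃) (k23 : y₂ ≠ y₃) :
    G.Labeling C i ![s₁, s₂, s₃, u, v] ![y₁, y₂, y₃, c, d] := by
  have hu : u ∈ (C i).1 := by simp [hi.eq₁]
  have hv : v ∈ (C i).1 := by simp [hi.eq₁]
  have hc : c ∈ (C i).2 := by simp [hi.eq₂]
  have hd : d ∈ (C i).2 := by simp [hi.eq₂]
  refine ⟨h, hi.card, ?_, ?_, ?_, ?_, ?_⟩
  · have := fun s (hs : G.Avail C s) => h.ne_of_mem hs.1 hu
    have := fun s (hs : G.Avail C s) => h.ne_of_mem hs.1 hv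
    have := hi.huv
    rw [← List.nodup_ofFn]
    simp [List.ofFn_succ]
    grind
  · have := fun s (hs : s ∈ restR C) => h.ne_of_mem' hs hc
    have := fun s (hs : s ∈ restR C) => h.ne_of_mem' hs hd
    have := hi.hcd
    rw [← List.nodup_ofFn]
    simp [List.ofFn_succ]
    grind
  · simp [Fin.forall_fin_succ, h1.1, h2.1, h3.1, hu, hv]
  · simp [Fin.forall_fin_succ, hy1, hy2, hy3, hc, hd]
  · simp [Fin.forall_fin_succ, h1.2, h2.2, h3.2, hi.hu, hi.hv]

/-- The extra label `z` is the common neighbour of `s₁` and `s₂`, which lies outside the three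
matched edges. -/
theorem labeling_four (h : G.State C) {i : Fin m} {u v : A} {c d : B}
    (hi : G.IsFour (C i) u v c d) {s₁ s₂ s₃ : A} {y₁ y₂ y₃ z : B}
    (h1 : G.Avail C s₁) (h2 : G.Avail C s₂) (h3 : G.Avail C s₃)
    (hy1 : y₁ ∈ restR C) (hy2 : y₂ ∈ restR C) (hy3 : y₃ ∈ restR C) (hz : z ∈ restR C)
    (h12 : s₁ ≠ s₂) (h13 : s₁ ≠ s₃) (h23 : s₂ ≠ s₃)
    (k12 : y₁ ≠ y₂) (k13 : y₁ ≠ y₃) (k23 : y₂ ≠ y₃) (z1 : y₁ ≠ z) (z2 : y₂ ≠ z) (z3 : y₃ ≠ z) :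
    G.Labeling C i ![s₁, s₂, s₃, u, v] ![y₁, y₂, y₃, z, c, d] := by
  have h0 := labeling_three h hi h1 h2 h3 hy1 hy2 hy3 h12 h13 h23 k12 k13 k23
  have hc : c ∈ (C i).2 := by simp [hi.eq₂]
  have hd : d ∈ (C i).2 := by simp [hi.eq₂]
  refine ⟨h, hi.card, h0.injL, ?_, h0.memL, ?_, h0.marked⟩
  · have := fun s (hs : s ∈ restR C) => h.ne_of_mem' hs hc
    have := fun s (hs : s ∈ restR C) => h.ne_of_mem' hs hd
    have := hi.hcd
    rw [← List.nodup_ofFn]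
    simp [List.ofFn_succ]
    grind
  · simp [Fin.forall_fin_succ, hy1, hy2, hy3, hc, hd, hz]

/-! ### Finite checks for hexagons, six-vertex paths and links -/

set_option synthInstance.maxHeartbeats 0 in
set_option synthInstance.maxSize 100000 in
set_option maxRecDepth 100000 in
/-- A finite check on the twelve possible edges between six vertices and a four-cycle; likewise
for the other statements named `no_dense` below. -/
theorem no_dense_hexagon {p0 p1 p2 p3 p4 p5 p6 p7 p8 p9 p10 p11 : Prop}
    (h : 7 ≤ ind p0 + ind p1 + ind p2 + ind p3 + ind p4 + ind p5 + ind p6 + ind p7 + ind p8 + ind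
        p9 + ind p10 + ind p11)
    (n0 : p1 → p2 → p4 → p6 → False) (n1 : p0 → p4 → p6 → p7 → False)
    (n2 : p1 → p2 → p5 → p7 → False) (n3 : p3 → p5 → p6 → p7 → False)
    (n4 : p1 → p5 → p6 → p8 → False) (n5 : p4 → p5 → p6 → p8 → False)
    (n6 : p3 → p4 → p7 → p8 → False) (n7 : p1 → p2 → p5 → p8 → False)
    (n8 : p0 → p3 → p7 → p8 → False) (n9 : p0 → p4 → p8 → p9 → False)
    (n10 : p0 → p1 → p7 → p9 → False) (n11 : p0 → p2 → p5 → p9 → False)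
    (n12 : p1 → p3 → p8 → p9 → False) (n13 : p0 → p3 → p6 → p9 → False)
    (n14 : p0 → p2 → p8 → p10 → False) (n15 : p5 → p7 → p9 → p10 → False)
    (n16 : p1 → p3 → p4 → p10 → False) (n17 : p2 → p3 → p6 → p10 → False)
    (n18 : p4 → p6 → p9 → p10 → False) (n19 : p0 → p3 → p7 → p10 → False)
    (n20 : p1 → p7 → p8 → p10 → False) (n21 : p0 → p5 → p9 → p10 → False)
    (n22 : p2 → p5 → p9 → p10 → False) (n23 : p1 → p3 → p9 → p11 → False)
    (n24 : p2 → p4 → p7 → p11 → False) (n25 : p0 → p3 → p5 → p11 → False)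
    (n26 : p2 → p6 → p9 → p11 → False) (n27 : p3 → p7 → p8 → p11 → False)
    (n28 : p1 → p4 → p8 → p11 → False) (n29 : p0 → p6 → p8 → p11 → False)
    (n30 : p2 → p4 → p10 → p11 → False) (n31 : p0 → p5 → p6 → p11 → False)
    (n32 : p2 → p5 → p8 → p11 → False) (n33 : p4 → p5 → p7 → p11 → False)
    (n34 : p1 → p2 → p6 → p11 → False) (n35 : p3 → p5 → p10 → p11 → False) :
    False := by
  obtain ⟨b0, rfl⟩ := exists_eq_true p0
  obtain ⟨b1, rfl⟩ := exists_eq_true p1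
  obtain ⟨b2, rfl⟩ := exists_eq_true p2
  obtain ⟨b3, rfl⟩ := exists_eq_true p3
  obtain ⟨b4, rfl⟩ := exists_eq_true p4
  obtain ⟨b5, rfl⟩ := exists_eq_true p5
  obtain ⟨b6, rfl⟩ := exists_eq_true p6
  obtain ⟨b7, rfl⟩ := exists_eq_true p7
  obtain ⟨b8, rfl⟩ := exists_eq_true p8
  obtain ⟨b9, rfl⟩ := exists_eq_true p9
  obtain ⟨b10, rfl⟩ := exists_eq_true p10
  obtain ⟨b11, rfl⟩ := exists_eq_true p11
  simp only [ind_eq_toNat] at h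
  revert b0 b1 b2 b3 b4 b5 b6 b7 b8 b9 b10 b11
  decide +kernel

set_option synthInstance.maxHeartbeats 0 in
set_option synthInstance.maxSize 100000 in
set_option maxRecDepth 100000 in
theorem no_dense_path {p0 p1 p2 p3 p4 p5 p6 p7 p8 p9 p10 p11 : Prop}
    (h : 7 ≤ ind p0 + ind p1 + ind p2 + ind p3 + ind p4 + ind p5 + ind p6 + ind p7 + ind p8 + ind
        p9 + ind p10 + ind p11)
    (n0 : p1 → p2 → p4 → p6 → False) (n1 : p0 → p4 → p6 → p7 → False)
    (n2 : p1 → p3 → p6 → p7 → False) (n3 : p1 → p2 → p4 → p7 → False)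
    (n4 : p2 → p4 → p6 → p8 → False) (n5 : p0 → p3 → p5 → p8 → False)
    (n6 : p0 → p3 → p7 → p8 → False) (n7 : p0 → p5 → p7 → p8 → False)
    (n8 : p3 → p5 → p6 → p8 → False) (n9 : p2 → p3 → p6 → p8 → False)
    (n10 : p3 → p5 → p7 → p8 → False) (n11 : p3 → p5 → p7 → p9 → False)
    (n12 : p1 → p2 → p6 → p9 → False) (n13 : p2 → p4 → p8 → p9 → False)
    (n14 : p1 → p4 → p6 → p9 → False) (n15 : p0 → p3 → p5 → p9 → False)
    (n16 : p2 → p4 → p7 → p9 → False) (n17 : p0 → p2 → p5 → p10 → False)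
    (n18 : p1 → p7 → p8 → p10 → False) (n19 : p3 → p4 → p9 → p10 → False)
    (n20 : p2 → p7 → p9 → p10 → False) (n21 : p4 → p5 → p6 → p10 → False)
    (n22 : p0 → p1 → p8 → p10 → False) (n23 : p0 → p5 → p7 → p10 → False)
    (n24 : p4 → p5 → p8 → p10 → False) (n25 : p2 → p5 → p9 → p10 → False)
    (n26 : p4 → p7 → p9 → p10 → False) (n27 : p3 → p4 → p7 → p10 → False)
    (n28 : p1 → p3 → p4 → p11 → False) (n29 : p0 → p6 → p9 → p11 → False)
    (n30 : p4 → p5 → p7 → p11 → False) (n31 : p1 → p2 → p8 → p11 → False)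
    (n32 : p5 → p6 → p8 → p11 → False) (n33 : p0 → p1 → p9 → p11 → False)
    (n34 : p0 → p2 → p10 → p11 → False) (n35 : p2 → p5 → p6 → p11 → False)
    (n36 : p3 → p6 → p8 → p11 → False) (n37 : p1 → p3 → p10 → p11 → False)
    (n38 : p0 → p2 → p5 → p11 → False) (n39 : p1 → p6 → p9 → p11 → False) :
    False := by
  obtain ⟨b0, rfl⟩ := exists_eq_true p0
  obtain ⟨b1, rfl⟩ := exists_eq_true p1
  obtain ⟨b2, rfl⟩ := exists_eq_true p2
  obtain ⟨b3, rfl⟩ := exists_eq_true p3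
  obtain ⟨b4, rfl⟩ := exists_eq_true p4
  obtain ⟨b5, rfl⟩ := exists_eq_true p5
  obtain ⟨b6, rfl⟩ := exists_eq_true p6
  obtain ⟨b7, rfl⟩ := exists_eq_true p7
  obtain ⟨b8, rfl⟩ := exists_eq_true p8
  obtain ⟨b9, rfl⟩ := exists_eq_true p9
  obtain ⟨b10, rfl⟩ := exists_eq_true p10
  obtain ⟨b11, rfl⟩ := exists_eq_true p11
  simp only [ind_eq_toNat] at h
  revert b0 b1 b2 b3 b4 b5 b6 b7 b8 b9 b10 b11
  decide +kernel

set_option synthInstance.maxHeartbeats 0 in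
set_option synthInstance.maxSize 100000 in
set_option maxRecDepth 100000 in
theorem no_dense_link {p0 p1 p2 p3 p4 p5 p6 p7 : Prop}
    (h : 5 ≤ ind p0 + ind p1 + ind p2 + ind p3 + ind p4 + ind p5 + ind p6 + ind p7)
    (n0 : p1 → p3 → p4 → False) (n1 : p0 → p2 → p4 → False) (n2 : p0 → p2 → p5 → False)
    (n3 : p0 → p2 → p6 → False) (n4 : p0 → p4 → p6 → False) (n5 : p2 → p4 → p6 → False)
    (n6 : p1 → p3 → p6 → False) (n7 : p1 → p5 → p7 → False) (n8 : p3 → p5 → p7 → False)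
    (n9 : p0 → p2 → p7 → False) :
    False := by
  obtain ⟨b0, rfl⟩ := exists_eq_true p0
  obtain ⟨b1, rfl⟩ := exists_eq_true p1
  obtain ⟨b2, rfl⟩ := exists_eq_true p2
  obtain ⟨b3, rfl⟩ := exists_eq_true p3
  obtain ⟨b4, rfl⟩ := exists_eq_true p4
  obtain ⟨b5, rfl⟩ := exists_eq_true p5
  obtain ⟨b6, rfl⟩ := exists_eq_true p6
  obtain ⟨b7, rfl⟩ := exists_eq_true p7
  simp only [ind_eq_toNat] at h
  revert b0 b1 b2 b3 b4 b5 b6 b7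
  decide +kernel


/-! ### Excluding uncovered hexagons and six-vertex paths -/

theorem State.eq_of_adj (h : G.State C) {s₁ s₂ : A} {y z : B} (h1 : G.Avail C s₁)
    (h2 : G.Avail C s₂) (h12 : s₁ ≠ s₂) (hy : y ∈ restR C) (hz : z ∈ restR C)
    (a1 : G.adj s₁ z) (a2 : G.adj s₂ z) (b1 : G.adj s₁ y) (b2 : G.adj s₂ y) : y = z := by
  by_contra hne
  exact h.no_four_rest h1 h2 hy hz h12 hne b1 a1 b2 a2

/-- No hexagon through three marked vertices avoids the packing. -/
theorem State.no_hexagon (h : G.State C) {s₁ s₂ s₃ : A} {z₁ z₂ z₃ : B} (h1 : G.Avail C s₁)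
    (h2 : G.Avail C s₂) (h3 : G.Avail C s₃) (h12 : s₁ ≠ s₂) (h13 : s₁ ≠ s₃) (h23 : s₂ ≠ s₃)
    (hz1 : z₁ ∈ restR C) (hz2 : z₂ ∈ restR C) (hz3 : z₃ ∈ restR C)
    (z12 : z₁ ≠ z₂) (z13 : z₁ ≠ z₃) (z23 : z₂ ≠ z₃)
    (a1 : G.adj s₁ z₁) (a2 : G.adj s₂ z₁) (a3 : G.adj s₂ z₂) (a4 : G.adj s₃ z₂)
    (a5 : G.adj s₃ z₃) (a6 : G.adj s₁ z₃) : False := by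
  have hs : ({s₁, s₂, s₃} : Finset A) ⊆ restL C := by
    simp [insert_subset_iff, h1.1, h2.1, h3.1]
  have hz : ({z₁, z₂, z₃} : Finset B) ⊆ restR C := by
    simp [insert_subset_iff, hz1, hz2, hz3]
  have cs : #({s₁, s₂, s₃} : Finset A) = 3 := card_eq_three.2 ⟨_, _, _, h12, h13, h23, rfl⟩
  have cz : #({z₁, z₂, z₃} : Finset B) = 3 := card_eq_three.2 ⟨_, _, _, z12, z13, z23, rfl⟩
  -- If nothing else is uncovered, this is the hexagon outcome excluded by extremality. Otherwise
  -- there are at least four uncovered vertices on each side, which the count below needs.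
  by_cases h4 : #(restL C) ≤ 3
  · refine h.ext.no_hexagon C h.toIsPacking s₁ s₂ s₃ z₁ z₂ z₃ h1.2 h2.2 h3.2 h12 h13 h23 z12 z13
      z23 a1 a2 a3 a4 a5 a6 ?_ ?_
    · exact (eq_of_subset_of_card_le hs (by omega)).symm
    · exact (eq_of_subset_of_card_le hz (by rw [h.card_eq]; omega)).symm
  have e12 := fun y hy => h.eq_of_adj (y := y) h1 h2 h12 hy hz1 a1 a2
  have e23 := fun y hy => h.eq_of_adj (y := y) h2 h3 h23 hy hz2 a3 a4
  have e13 := fun y hy => h.eq_of_adj (y := y) h1 h3 h13 hy hz3 a6 a5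
  have dL := degL_add_add_le (G := G) (s₁ := s₁) (s₂ := s₂) (s₃ := s₃) (Y := restR C)
    {z₁, z₂, z₃} 1
    (fun y hy hyT => ind_add_add_le_one
      (fun p q => hyT (by simp [e12 y hy p q])) (fun p q => hyT (by simp [e13 y hy p q]))
      (fun p q => hyT (by simp [e23 y hy p q])))
    (fun y hy => ind_add_add_le_two fun p q r =>
      z12 ((e12 y hy p q).symm.trans (e23 y hy q r)))
  -- A second common neighbour of `z₁` and `z₂` yields a new short cycle: a four-cycle with `s₂` if
  -- it is marked, and otherwise a hexagon in which it takes the place of `s₂`.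
  have f2 : ∀ x ∈ restL C, G.adj x z₁ → G.adj x z₂ → x = s₂ := fun x hx p q => by
    by_contra hne
    by_cases hxS : x ∈ G.S
    · exact h.no_four_rest ⟨hx, hxS⟩ h2 hz1 hz2 hne z12 p q a2 a3
    · exact h.no_six_rest h1 hx hxS h3 hz1 hz2 hz3 h13 z12 z13 z23 a1 p q a4 a5 a6
  have f3 : ∀ x ∈ restL C, G.adj x z₂ → G.adj x z₃ → x = s₃ := fun x hx p q => by
    by_contra hne
    by_cases hxS : x ∈ G.S
    · exact h.no_four_rest ⟨hx, hxS⟩ h3 hz2 hz3 hne z23 p q a4 a5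
    · exact h.no_six_rest h2 hx hxS h1 hz2 hz3 hz1 h12.symm z23 z12.symm z13.symm a3 p q a6 a1 a2
  have f1 : ∀ x ∈ restL C, G.adj x z₁ → G.adj x z₃ → x = s₁ := fun x hx p q => by
    by_contra hne
    by_cases hxS : x ∈ G.S
    · exact h.no_four_rest ⟨hx, hxS⟩ h1 hz1 hz3 hne z13 p q a1 a6
    · exact h.no_six_rest h2 hx hxS h3 hz1 hz3 hz2 h23 z13 z12 z23.symm a2 p q a5 a4 a3
  have dR := degR_add_add_le (G := G) (y₁ := z₁) (y₂ := z₂) (y₃ := z₃) (X := restL C)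
    {s₁, s₂, s₃} 1
    (fun x hx hxT => ind_add_add_le_one
      (fun p q => hxT (by simp [f2 x hx p q])) (fun p q => hxT (by simp [f1 x hx p q]))
      (fun p q => hxT (by simp [f3 x hx p q])))
    (fun x hx => ind_add_add_le_two fun p q r =>
      h12 ((f1 x hx p r).symm.trans (f2 x hx p q)))
  rw [h.card_eq, cz] at dL
  rw [cs] at dR
  -- With `r` uncovered vertices on each side, `dL` and `dR` sum to at most `2 * r + 6`, and this is
  -- at most `3 * r + 2` because `r ≥ 4`.
  obtain ⟨i, u, v, c, d, hi, h7⟩ := h.exists_four h1 h2 h3 hz1 hz2 hz3 a1 a3 a5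
    (fun p => z12 (e12 _ hz2 p a3).symm) (fun p => z23 (e23 _ hz3 p a5).symm)
    (fun p => z13 (e13 _ hz1 a1 p)) (by unfold deg₆; simp only; omega)
  rw [hi.deg₆_eq] at h7
  have lab := labeling_three h hi h1 h2 h3 hz1 hz2 hz3 h12 h13 h23 z12 z13 z23
  -- Labels `0, 1, 2` are the uncovered vertices and `3, 4` the vertices of the four-cycle, on
  -- either side. Each clause exhibits two disjoint four-cycles.
  exact no_dense_hexagon h7
    (fun x1 x2 x4 x6 => lab.two 0 3 1 2 0 4 1 3 a1 x1 x6 hi.hud a3 x2 a4 x4)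
    (fun x0 x4 x6 x7 => lab.two 0 2 3 4 2 3 0 4 a6 x0 a5 x4 x6 hi.hud x7 hi.hvd)
    (fun x1 x2 x5 x7 => lab.two 0 2 1 4 2 4 0 3 a6 x1 a5 x5 a2 x2 x7 hi.hvc)
    (fun x3 x5 x6 x7 => lab.two 1 2 3 4 1 4 0 3 a3 x3 a4 x5 x6 hi.huc x7 hi.hvc)
    (fun x1 x5 x6 x8 => lab.two 0 2 1 3 2 4 0 1 a6 x1 a5 x5 a2 a3 x6 x8)
    (fun x4 x5 x6 x8 => lab.two 1 3 2 4 0 1 3 4 a2 a3 x6 x8 x4 x5 hi.hvc hi.hvd)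
    (fun x3 x4 x7 x8 => lab.two 1 4 2 3 0 4 1 3 a2 x3 x7 hi.hvd a4 x4 x8 hi.huc)
    (fun x1 x2 x5 x8 => lab.two 0 2 1 3 2 4 1 3 a6 x1 a5 x5 a3 x2 x8 hi.huc)
    (fun x0 x3 x7 x8 => lab.two 0 4 1 3 0 3 1 4 a1 x0 x7 hi.hvc a3 x3 x8 hi.hud)
    (fun x0 x4 x8 x9 => lab.two 0 2 3 4 2 3 1 4 a6 x0 a5 x4 x8 hi.hud x9 hi.hvd)
    (fun x0 x1 x7 x9 => lab.two 0 3 1 4 3 4 0 1 x0 x1 hi.huc hi.hud a2 a3 x7 x9)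
    (fun x0 x2 x5 x9 => lab.two 0 1 2 4 0 3 1 4 a1 x0 a2 x2 a4 x5 x9 hi.hvd)
    (fun x1 x3 x8 x9 => lab.two 0 1 3 4 0 4 1 3 a1 x1 a2 x3 x8 hi.huc x9 hi.hvc)
    (fun x0 x3 x6 x9 => lab.two 0 3 1 4 0 3 1 4 a1 x0 x6 hi.huc a3 x3 x9 hi.hvd)
    (fun x0 x2 x8 x10 => lab.two 0 1 2 3 0 3 1 2 a1 x0 a2 x2 a4 a5 x8 x10)
    (fun x5 x7 x9 x10 => lab.two 1 4 2 3 0 1 2 4 a2 a3 x7 x9 a5 x5 x10 hi.hud)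
    (fun x1 x3 x4 x10 => lab.two 0 1 2 3 0 4 2 3 a1 x1 a2 x3 a5 x4 x10 hi.huc)
    (fun x2 x3 x6 x10 => lab.two 0 3 1 4 0 2 3 4 a1 a6 x6 x10 x2 x3 hi.hvc hi.hvd)
    (fun x4 x6 x9 x10 => lab.two 0 3 2 4 0 2 1 3 a1 a6 x6 x10 a4 x4 x9 hi.hvc)
    (fun x0 x3 x7 x10 => lab.two 0 3 1 4 2 3 0 4 a6 x0 x10 hi.huc a2 x3 x7 hi.hvd)
    (fun x1 x7 x8 x10 => lab.two 0 4 2 3 0 4 1 2 a1 x1 x7 hi.hvd a4 a5 x8 x10)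
    (fun x0 x5 x9 x10 => lab.two 0 3 2 4 2 3 1 4 a6 x0 x10 hi.huc a4 x5 x9 hi.hvd)
    (fun x2 x5 x9 x10 => lab.two 1 4 2 3 1 3 2 4 a3 x2 x9 hi.hvc a5 x5 x10 hi.hud)
    (fun x1 x3 x9 x11 => lab.two 0 1 2 4 0 4 1 2 a1 x1 a2 x3 a4 a5 x9 x11)
    (fun x2 x4 x7 x11 => lab.two 0 4 1 2 0 2 1 3 a1 a6 x7 x11 a3 x2 a4 x4)
    (fun x0 x3 x5 x11 => lab.two 0 4 1 2 2 3 1 4 a6 x0 x11 hi.hvc a3 x3 a4 x5)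
    (fun x2 x6 x9 x11 => lab.two 1 3 2 4 0 3 1 2 a2 x2 x6 hi.huc a4 a5 x9 x11)
    (fun x3 x7 x8 x11 => lab.two 0 4 1 3 0 2 1 4 a1 a6 x7 x11 a3 x3 x8 hi.hud)
    (fun x1 x4 x8 x11 => lab.two 0 4 2 3 2 4 1 3 a6 x1 x11 hi.hvd a4 x4 x8 hi.huc)
    (fun x0 x6 x8 x11 => lab.two 0 4 1 3 2 3 0 1 a6 x0 x11 hi.hvc a2 a3 x6 x8)
    (fun x2 x4 x10 x11 => lab.two 1 2 3 4 1 3 2 4 a3 x2 a4 x4 x10 hi.hud x11 hi.hvd)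
    (fun x0 x5 x6 x11 => lab.two 0 3 2 4 0 3 2 4 a1 x0 x6 hi.huc a5 x5 x11 hi.hvd)
    (fun x2 x5 x8 x11 => lab.two 1 3 2 4 1 3 2 4 a3 x2 x8 hi.huc a5 x5 x11 hi.hvd)
    (fun x4 x5 x7 x11 => lab.two 0 4 2 3 0 2 3 4 a1 a6 x7 x11 x4 x5 hi.huc hi.hud)
    (fun x1 x2 x6 x11 => lab.two 0 4 1 3 2 4 0 3 a6 x1 x11 hi.hvd a2 x2 x6 hi.huc)
    (fun x3 x5 x10 x11 => lab.two 1 2 3 4 1 4 2 3 a3 x3 a4 x5 x10 hi.huc x11 hi.hvc)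

theorem Labeling.hexagon (h : G.Labeling C i f g) (p q a b c : Fin 5) (r t y₁ y₂ y₃ : Fin k)
    (a1 : G.adj (f p) (g r)) (a2 : G.adj (f p) (g t)) (a3 : G.adj (f q) (g r))
    (a4 : G.adj (f q) (g t)) (b1 : G.adj (f a) (g y₁)) (b2 : G.adj (f b) (g y₁))
    (b3 : G.adj (f b) (g y₂)) (b4 : G.adj (f c) (g y₂)) (b5 : G.adj (f c) (g y₃))
    (b6 : G.adj (f a) (g y₃))
    (hd : [p, q, a, b, c].Nodup := by decide) (hd' : [r, t, y₁, y₂, y₃].Nodup := by decide) :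
    False := by
  simp only [List.nodup_cons, List.mem_cons, List.not_mem_nil, or_false, not_or] at hd hd'
  obtain ⟨⟨pq, pa, pb, pc⟩, ⟨qa, qb, qc⟩, ⟨ab, ac⟩, bc, -⟩ := hd
  obtain ⟨⟨rt, r1, r2, r3⟩, ⟨t1, t2, t3⟩, ⟨y12, y13⟩, y23, -⟩ := hd'
  obtain ⟨C', h', hf, hg⟩ := h.swap pq rt a1 a2 a3 a4
  exact h'.no_hexagon (hf a (Ne.symm pa) (Ne.symm qa)) (hf b (Ne.symm pb) (Ne.symm qb))
    (hf c (Ne.symm pc) (Ne.symm qc)) (h.injL.ne ab) (h.injL.ne ac) (h.injL.ne bc)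
    (hg _ (Ne.symm r1) (Ne.symm t1)) (hg _ (Ne.symm r2) (Ne.symm t2))
    (hg _ (Ne.symm r3) (Ne.symm t3)) (h.injR.ne y12) (h.injR.ne y13) (h.injR.ne y23)
    b1 b2 b3 b4 b5 b6

/-- No path on six vertices through three marked vertices avoids the packing. -/
theorem State.no_path (h : G.State C) {s₁ s₂ s₃ : A} {y z z' : B} (h1 : G.Avail C s₁)
    (h2 : G.Avail C s₂) (h3 : G.Avail C s₃) (h12 : s₁ ≠ s₂) (h13 : s₁ ≠ s₃) (h23 : s₂ ≠ s₃)
    (hy : y ∈ restR C) (hz : z ∈ restR C) (hz' : z' ∈ restR C)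
    (yz : y ≠ z) (yz' : y ≠ z') (zz' : z ≠ z')
    (a1 : G.adj s₁ y) (a2 : G.adj s₁ z) (a3 : G.adj s₂ z) (a4 : G.adj s₂ z')
    (a5 : G.adj s₃ z') : False := by
  have e12 := fun y hy => h.eq_of_adj (y := y) h1 h2 h12 hy hz a2 a3
  have e23 := fun y hy => h.eq_of_adj (y := y) h2 h3 h23 hy hz' a4 a5
  have n1 : ¬ G.adj s₁ z' := fun p => zz' (e12 _ hz' p a4).symm
  have n2 : ¬ G.adj s₂ y := fun p => yz (e12 _ hy a1 p)
  have n3 : ¬ G.adj s₃ z := fun p => zz' (e23 _ hz a3 p)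
  have e13 : ∀ x ∈ restR C, G.adj s₁ x → G.adj s₃ x → False := fun x hx p q => by
    have hxz : x ≠ z := fun e => n3 (e ▸ q)
    have hxz' : x ≠ z' := fun e => n1 (e ▸ p)
    exact h.no_hexagon h1 h2 h3 h12 h13 h23 hz hz' hx zz' hxz.symm hxz'.symm a2 a3 a4 a5 q p
  have dL := degL_add_add_le (G := G) (s₁ := s₁) (s₂ := s₂) (s₃ := s₃) (Y := restR C)
    {z, z'} 1
    (fun y hy hyT => ind_add_add_le_one
      (fun p q => hyT (by simp [e12 y hy p q])) (fun p q => e13 y hy p q)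
      (fun p q => hyT (by simp [e23 y hy p q])))
    (fun y hy => ind_add_add_le_two fun p _ r => e13 y hy p r)
  -- A common neighbour of `y` and `z'` closes a hexagon with `s₁`, `z`, `s₂`. It is excluded by
  -- `no_hexagon` if the neighbour is marked, and is a short cycle otherwise.
  have dR := degR_add_le (G := G) (y₁ := y) (y₂ := z') (X := restL C) ∅
    (fun x hx p q => by
      exfalso
      have hx1 : x ≠ s₁ := fun e => n1 (e ▸ q)
      have hx2 : x ≠ s₂ := fun e => n2 (e ▸ p)
      by_cases hxS : x ∈ G.S
      · exact h.no_hexagon h1 h2 ⟨hx, hxS⟩ h12 hx1.symm hx2.symm hz hz' hy zz' yz.symm yz'.symm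
          a2 a3 a4 q p a1
      · exact h.no_six_rest h1 hx hxS h2 hy hz' hz h12 yz' yz zz'.symm a1 p q a4 a3 a2)
  have dz := degR_add_one_le h3.1 n3
  rw [h.card_eq, card_pair zz'] at dL
  rw [card_empty] at dR
  obtain ⟨i, u, v, c, d, hi, h7⟩ := h.exists_four h1 h3 h2 hy hz' hz a1 a5 a3
    n1 n3 n2 (by unfold deg₆; simp only; omega)
  rw [deg₆_swap, hi.deg₆_eq] at h7
  have lab := labeling_three h hi h1 h2 h3 hy hz hz' h12 h13 h23 yz yz' zz'
  exact no_dense_path h7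
    (fun x1 x2 x4 x6 => lab.two 0 3 1 2 0 4 2 3 a1 x1 x6 hi.hud a4 x2 a5 x4)
    (fun x0 x4 x6 x7 => lab.hexagon 3 4 0 1 2 0 4 1 2 3 x6 hi.hud x7 hi.hvd a2 a3 a4 a5 x4 x0)
    (fun x1 x3 x6 x7 => lab.two 0 1 3 4 1 4 0 3 a2 x1 a3 x3 x6 hi.huc x7 hi.hvc)
    (fun x1 x2 x4 x7 => lab.two 0 4 1 2 0 4 2 3 a1 x1 x7 hi.hvd a4 x2 a5 x4)
    (fun x2 x4 x6 x8 => lab.two 0 3 1 2 0 1 2 3 a1 a2 x6 x8 a4 x2 a5 x4)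
    (fun x0 x3 x5 x8 => lab.two 0 3 1 2 1 3 2 4 a2 x0 x8 hi.huc a4 x3 a5 x5)
    (fun x0 x3 x7 x8 => lab.two 0 4 1 3 0 3 1 4 a1 x0 x7 hi.hvc a3 x3 x8 hi.hud)
    (fun x0 x5 x7 x8 => lab.hexagon 0 4 1 2 3 0 3 2 4 1 a1 x0 x7 hi.hvc a4 a5 x5 hi.hud x8 a3)
    (fun x3 x5 x6 x8 => lab.two 0 3 1 2 0 1 2 4 a1 a2 x6 x8 a4 x3 a5 x5)
    (fun x2 x3 x6 x8 => lab.two 0 3 1 4 0 1 3 4 a1 a2 x6 x8 x2 x3 hi.hvc hi.hvd)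
    (fun x3 x5 x7 x8 => lab.hexagon 1 2 0 3 4 2 4 1 3 0 a4 x3 a5 x5 a2 x8 hi.huc hi.hvc x7 a1)
    (fun x3 x5 x7 x9 => lab.two 0 4 1 2 0 1 2 4 a1 a2 x7 x9 a4 x3 a5 x5)
    (fun x1 x2 x6 x9 => lab.two 0 3 1 4 0 4 1 3 a1 x1 x6 hi.hud a3 x2 x9 hi.hvc)
    (fun x2 x4 x8 x9 => lab.two 1 2 3 4 2 3 1 4 a4 x2 a5 x4 x8 hi.hud x9 hi.hvd)
    (fun x1 x4 x6 x9 => lab.hexagon 0 3 1 2 4 0 4 2 3 1 a1 x1 x6 hi.hud a4 a5 x4 hi.hvc x9 a3)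
    (fun x0 x3 x5 x9 => lab.two 0 4 1 2 1 3 2 4 a2 x0 x9 hi.hvc a4 x3 a5 x5)
    (fun x2 x4 x7 x9 => lab.two 0 4 1 2 0 1 2 3 a1 a2 x7 x9 a4 x2 a5 x4)
    (fun x0 x2 x5 x10 => lab.two 0 1 2 3 1 3 2 4 a2 x0 a3 x2 a5 x5 x10 hi.hud)
    (fun x1 x7 x8 x10 => lab.two 0 4 1 3 0 4 1 2 a1 x1 x7 hi.hvd a3 a4 x8 x10)
    (fun x3 x4 x9 x10 => lab.two 1 4 2 3 1 4 2 3 a3 x3 x9 hi.hvd a5 x4 x10 hi.huc)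
    (fun x2 x7 x9 x10 => lab.two 0 4 1 3 0 1 2 3 a1 a2 x7 x9 a4 x2 x10 hi.huc)
    (fun x4 x5 x6 x10 => lab.hexagon 2 4 0 1 3 3 4 1 2 0 x4 x5 hi.hvc hi.hvd a2 a3 a4 x10 x6 a1)
    (fun x0 x1 x8 x10 => lab.two 0 4 1 3 3 4 1 2 x0 x1 hi.hvc hi.hvd a3 a4 x8 x10)
    (fun x0 x5 x7 x10 => lab.two 0 4 2 3 0 3 2 4 a1 x0 x7 hi.hvc a5 x5 x10 hi.hud)
    (fun x4 x5 x8 x10 => lab.two 1 3 2 4 1 2 3 4 a3 a4 x8 x10 x4 x5 hi.hvc hi.hvd)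
    (fun x2 x5 x9 x10 => lab.two 1 4 2 3 1 3 2 4 a3 x2 x9 hi.hvc a5 x5 x10 hi.hud)
    (fun x4 x7 x9 x10 => lab.two 0 4 2 3 0 1 2 3 a1 a2 x7 x9 a5 x4 x10 hi.huc)
    (fun x3 x4 x7 x10 => lab.hexagon 2 3 0 1 4 2 3 1 4 0 a5 x4 x10 hi.huc a2 a3 x3 hi.hvd x7 a1)
    (fun x1 x3 x4 x11 => lab.two 0 1 2 4 1 4 2 3 a2 x1 a3 x3 a5 x4 x11 hi.hvc)
    (fun x0 x6 x9 x11 => lab.two 0 3 1 4 0 3 1 2 a1 x0 x6 hi.huc a3 a4 x9 x11)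
    (fun x4 x5 x7 x11 => lab.hexagon 2 3 0 1 4 3 4 1 2 0 x4 x5 hi.huc hi.hud a2 a3 a4 x11 x7 a1)
    (fun x1 x2 x8 x11 => lab.two 0 3 1 4 1 4 2 3 a2 x1 x8 hi.hud a4 x2 x11 hi.hvc)
    (fun x5 x6 x8 x11 => lab.two 0 3 2 4 0 1 2 4 a1 a2 x6 x8 a5 x5 x11 hi.hvd)
    (fun x0 x1 x9 x11 => lab.two 0 3 1 4 3 4 1 2 x0 x1 hi.huc hi.hud a3 a4 x9 x11)
    (fun x0 x2 x10 x11 => lab.two 0 1 3 4 1 3 2 4 a2 x0 a3 x2 x10 hi.hud x11 hi.hvd)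
    (fun x2 x5 x6 x11 => lab.hexagon 2 4 0 1 3 2 4 1 3 0 a5 x5 x11 hi.hvd a2 a3 x2 hi.huc x6 a1)
    (fun x3 x6 x8 x11 => lab.two 0 3 1 4 0 1 2 4 a1 a2 x6 x8 a4 x3 x11 hi.hvd)
    (fun x1 x3 x10 x11 => lab.two 0 1 3 4 1 4 2 3 a2 x1 a3 x3 x10 hi.huc x11 hi.hvc)
    (fun x0 x2 x5 x11 => lab.two 0 1 2 4 1 3 2 4 a2 x0 a3 x2 a5 x5 x11 hi.hvd)
    (fun x1 x6 x9 x11 => lab.two 0 3 1 4 0 4 1 2 a1 x1 x6 hi.hud a3 a4 x9 x11)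

theorem Labeling.path (h : G.Labeling C i f g) (p q a b c : Fin 5) (r t y₁ y₂ y₃ : Fin k)
    (a1 : G.adj (f p) (g r)) (a2 : G.adj (f p) (g t)) (a3 : G.adj (f q) (g r))
    (a4 : G.adj (f q) (g t)) (b1 : G.adj (f a) (g y₁)) (b2 : G.adj (f a) (g y₂))
    (b3 : G.adj (f b) (g y₂)) (b4 : G.adj (f b) (g y₃)) (b5 : G.adj (f c) (g y₃))
    (hd : [p, q, a, b, c].Nodup := by decide) (hd' : [r, t, y₁, y₂, y₃].Nodup := by decide) :
    False := by
  simp only [List.nodup_cons, List.mem_cons, List.not_mem_nil, or_false, not_or] at hd hd'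
  obtain ⟨⟨pq, pa, pb, pc⟩, ⟨qa, qb, qc⟩, ⟨ab, ac⟩, bc, -⟩ := hd
  obtain ⟨⟨rt, r1, r2, r3⟩, ⟨t1, t2, t3⟩, ⟨y12, y13⟩, y23, -⟩ := hd'
  obtain ⟨C', h', hf, hg⟩ := h.swap pq rt a1 a2 a3 a4
  exact h'.no_path (hf a (Ne.symm pa) (Ne.symm qa)) (hf b (Ne.symm pb) (Ne.symm qb))
    (hf c (Ne.symm pc) (Ne.symm qc)) (h.injL.ne ab) (h.injL.ne ac) (h.injL.ne bc)
    (hg _ (Ne.symm r1) (Ne.symm t1)) (hg _ (Ne.symm r2) (Ne.symm t2))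
    (hg _ (Ne.symm r3) (Ne.symm t3)) (h.injR.ne y12) (h.injR.ne y13) (h.injR.ne y23)
    b1 b2 b3 b4 b5

/-! ### Two marked vertices of small degree with a common neighbour -/

/-- The hexagon is rerouted through `s₁ b x y u a`. This releases `v` and `c`, and leaves the
six-vertex path `z s₂ c v y' s₃` uncovered. -/
theorem State.six_reroute (h : G.State C) {i : Fin m} {u x v s₁ s₂ s₃ : A} {a b c y y' z : B}
    (h1 : G.Avail C s₁) (h2 : G.Avail C s₂) (h3 : G.Avail C s₃) (h12 : s₁ ≠ s₂) (h13 : s₁ ≠ s₃)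
    (h23 : s₂ ≠ s₃) (hy : y ∈ restR C) (hy' : y' ∈ restR C) (hz : z ∈ restR C)
    (yy' : y ≠ y') (yz : y ≠ z) (yz' : y' ≠ z)
    (hP : (C i).1 = {u, x, v}) (hQ : (C i).2 = {a, b, c}) (hu : u ∈ G.S) (hx : x ∉ G.S)
    (hv : v ∈ G.S) (huv : u ≠ v) (hab : a ≠ b) (hac : a ≠ c) (hbc : b ≠ c)
    (hua : G.adj u a) (hxb : G.adj x b) (hvc : G.adj v c)
    (a1 : G.adj s₁ a) (a2 : G.adj s₁ b) (a3 : G.adj s₂ c) (a4 : G.adj x y) (a5 : G.adj u y)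
    (a6 : G.adj v y') (a7 : G.adj s₂ z) (a8 : G.adj s₃ y') : False := by
  have su := fun s (hs : G.Avail C s) => h.ne_of_mem (i := i) hs.1 (w := u) (by simp [hP])
  have sv := fun s (hs : G.Avail C s) => h.ne_of_mem (i := i) hs.1 (w := v) (by simp [hP])
  have ya := fun s (hs : s ∈ restR C) => h.ne_of_mem' (i := i) hs (w := a) (by simp [hQ])
  have yb := fun s (hs : s ∈ restR C) => h.ne_of_mem' (i := i) hs (w := b) (by simp [hQ])
  have yc := fun s (hs : s ∈ restR C) => h.ne_of_mem' (i := i) hs (w := c) (by simp [hQ])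
  have hsx := fun s (hs : s ∈ G.S) => ne_of_mem_of_not_mem hs hx
  have hg := Good.six h1.2 hx hu (su _ h1) (yb y hy).symm hab.symm (ya y hy) a2 hxb a4 a5 hua a1
  have e3 : #(C i).1 = 3 := by
    rw [hP]
    exact card_eq_three.2 ⟨_, _, _, hsx _ hu, huv, (hsx _ hv).symm, rfl⟩
  have h' := h.update hg (i := i) (by simp [insert_subset_iff, h1.1, hP])
    (by simp [insert_subset_iff, hQ, hy]) (by rw [e3]; exact card_le_three)
  refine h'.no_path (s₁ := s₂) (s₂ := v) (s₃ := s₃) (y := z) (z := c) (z' := y') ⟨?_, h2.2⟩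
    ⟨?_, hv⟩ ⟨?_, h3.2⟩ (sv _ h2) h23 (sv _ h3).symm ?_ ?_ ?_ (yc _ hz) yz'.symm
    (yc _ hy').symm a7 a3 hvc a6 a8
  · rw [mem_restL_update h.toIsPacking]
    exact ⟨Or.inl h2.1, by simp [h12.symm, hsx _ h2.2, su _ h2]⟩
  · rw [mem_restL_update h.toIsPacking]
    exact ⟨Or.inr (by simp [hP]), by simp [(sv _ h1).symm, hsx _ hv, huv.symm]⟩
  · rw [mem_restL_update h.toIsPacking]
    exact ⟨Or.inl h3.1, by simp [h13.symm, hsx _ h3.2, su _ h3]⟩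
  · rw [mem_restR_update h.toIsPacking]
    exact ⟨Or.inl hz, by simp [yb _ hz, yz.symm, ya _ hz]⟩
  · rw [mem_restR_update h.toIsPacking]
    exact ⟨Or.inr (by simp [hQ]), by simp [hbc.symm, (yc _ hy).symm, hac.symm]⟩
  · rw [mem_restR_update h.toIsPacking]
    exact ⟨Or.inl hy', by simp [yb _ hy', yy'.symm, ya _ hy']⟩

/-- Only a hexagon can exceed the bound, and only with exactly seven edges. This forces one of `s₁,
s₂` to see `a, b` and the other to see `c`, and `y, y'` to see `x` and one each of `u, v`, as
`six_reroute` requires. -/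
theorem State.link_long (h : G.State C) {i : Fin m} (h4 : 2 < #(C i).1)
    {s₁ s₂ s₃ : A} {z y y' : B} (h1 : G.Avail C s₁)
    (h2 : G.Avail C s₂) (h3 : G.Avail C s₃) (h12 : s₁ ≠ s₂) (h13 : s₁ ≠ s₃) (h23 : s₂ ≠ s₃)
    (hz : z ∈ restR C) (hy : y ∈ restR C) (hy' : y' ∈ restR C)
    (yz : y ≠ z) (yz' : y' ≠ z) (yy' : y ≠ y')
    (a1 : G.adj s₁ z) (a2 : G.adj s₂ z) (a3 : G.adj s₃ y) (a4 : G.adj s₃ y') :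
    G.degL s₁ (C i).2 + G.degL s₂ (C i).2 + (G.degR y (C i).1 + G.degR y' (C i).1) ≤
      2 * #(C i).1 := by
  have e1 := h.pair_long h1 hy (h.good i) h4
  have e2 := h.pair_long h2 hy' (h.good i) h4
  by_contra h7
  have hc : #(C i).1 = 3 := by omega
  have hg := h.good i
  obtain ⟨P, hP⟩ : ∃ P, (C i).1 = P := ⟨_, rfl⟩
  obtain ⟨Q, hQ⟩ : ∃ Q, (C i).2 = Q := ⟨_, rfl⟩
  have hs' : ∀ {s w}, G.Avail C s → w ∈ P → s ≠ w :=
    fun hs hw => h.ne_of_mem hs.1 (i := i) (hP ▸ hw)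
  have hy₀ : ∀ {y w}, y ∈ restR C → w ∈ Q → y ≠ w :=
    fun hy hw => h.ne_of_mem' hy (i := i) (hQ ▸ hw)
  have hUL : ∀ {w}, w ∈ P → w ∈ restL C ∪ (C i).1 := fun hw => mem_union_right _ (hP ▸ hw)
  have hUR : ∀ {w}, w ∈ Q → w ∈ restR C ∪ (C i).2 := fun hw => mem_union_right _ (hQ ▸ hw)
  have hRL : ∀ {w}, G.Avail C w → w ∈ restL C ∪ (C i).1 := fun hw => mem_union_left _ hw.1
  have hRR : ∀ {w}, w ∈ restR C → w ∈ restR C ∪ (C i).2 := fun hw => mem_union_left _ hw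
  rw [hP, hQ] at hg
  have n4 := @State.no_four _ _ _ _ _ _ G m C h i h4
  cases hg with
  | four _ _ huv => rw [hP, card_pair huv] at h4; omega
  | @eight u x v x' a b c d hu hx hv hx' huv hxx' =>
    have hux := ne_of_mem_of_not_mem hu hx
    have hvx := ne_of_mem_of_not_mem hv hx
    have hux' := ne_of_mem_of_not_mem hu hx'
    have hvx' := ne_of_mem_of_not_mem hv hx'
    rw [hP, card_insert_of_notMem (by simp [*]),
      card_eq_three.2 ⟨_, _, _, hvx.symm, hxx', hvx', rfl⟩] at hc
    omega
  | @six u x v a b c hu hx hv huv hab hac hbc hua hxa hxb hvb hvc huc =>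
    have hux := ne_of_mem_of_not_mem hu hx
    have hvx := ne_of_mem_of_not_mem hv hx
    have Ua := hUR (w := a) (by simp)
    have Ub := hUR (w := b) (by simp)
    have Uc := hUR (w := c) (by simp)
    have Uu := hUL (w := u) (by simp)
    have Uv := hUL (w := v) (by simp)
    have su := fun s (hs : G.Avail C s) => hs' hs (w := u) (by simp)
    have sv := fun s (hs : G.Avail C s) => hs' hs (w := v) (by simp)
    have ya := fun y (hy : y ∈ restR C) => hy₀ hy (w := a) (by simp)
    have yb := fun y (hy : y ∈ restR C) => hy₀ hy (w := b) (by simp)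
    have yc := fun y (hy : y ∈ restR C) => hy₀ hy (w := c) (by simp)
    have k1 : ∀ s, G.Avail C s → ind (G.adj s a) + ind (G.adj s c) ≤ 1 := fun s hs =>
      ind_add_le fun p q => n4 (hRL hs) Uu Ua Uc hs.2 hu (su s hs) hac p q hua huc
    have k2 : ∀ s, G.Avail C s → ind (G.adj s b) + ind (G.adj s c) ≤ 1 := fun s hs =>
      ind_add_le fun p q => n4 (hRL hs) Uv Ub Uc hs.2 hv (sv s hs) hbc p q hvb hvc
    have k3 : ∀ y ∈ restR C, ind (G.adj u y) + ind (G.adj v y) ≤ 1 := fun y hy =>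
      ind_add_le fun p q => n4 Uu Uv (hRR hy) Uc hu hv huv (yc y hy) p huc q hvc
    have k4 : ind (G.adj s₁ a) + ind (G.adj s₂ a) ≤ 1 := ind_add_le fun p q =>
      n4 (hRL h1) (hRL h2) Ua (hRR hz) h1.2 h2.2 h12 (ya z hz).symm p a1 q a2
    have k5 : ind (G.adj s₁ b) + ind (G.adj s₂ b) ≤ 1 := ind_add_le fun p q =>
      n4 (hRL h1) (hRL h2) Ub (hRR hz) h1.2 h2.2 h12 (yb z hz).symm p a1 q a2
    have k6 : ind (G.adj u y) + ind (G.adj u y') ≤ 1 := ind_add_le fun p q =>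
      n4 (hRL h3) Uu (hRR hy) (hRR hy') h3.2 hu (su _ h3) yy' a3 a4 p q
    have k7 : ind (G.adj v y) + ind (G.adj v y') ≤ 1 := ind_add_le fun p q =>
      n4 (hRL h3) Uv (hRR hy) (hRR hy') h3.2 hv (sv _ h3) yy' a3 a4 p q
    have := k1 _ h1
    have := k1 _ h2
    have := k2 _ h1
    have := k2 _ h2
    have := k3 _ hy
    have := k3 _ hy'
    rw [hc, hP, hQ, degL_insert (by simp [hab, hac]), degL_pair hbc,
      degL_insert (by simp [hab, hac]), degL_pair hbc, degR_insert (by simp [hux, huv]),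
      degR_pair hvx.symm, degR_insert (by simp [hux, huv]), degR_pair hvx.symm] at h7
    have pos : ∀ {p : Prop}, ind p ≠ 0 → p := fun {p} hp => by
      by_contra h
      exact hp (ind_not h)
    have := ind_le (G.adj x y)
    have := ind_le (G.adj x y')
    have xy : G.adj x y := pos (by omega)
    have xy' : G.adj x y' := pos (by omega)
    have key : ∀ t₁ t₂ w w', G.Avail C t₁ → G.Avail C t₂ → t₁ ≠ t₂ → t₁ ≠ s₃ → t₂ ≠ s₃ →
        G.adj t₂ z → w ∈ restR C → w' ∈ restR C → w ≠ w' → w ≠ z → w' ≠ z → G.adj s₃ w' →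
        G.adj x w → G.adj t₁ a → G.adj t₁ b → G.adj t₂ c → G.adj u w → G.adj v w' → False :=
      fun t₁ t₂ w w' g1 g2 g12 g13 g23 b1 hw hw' ww wz wz' b2 b3 b4 b5 b6 b7 b8 =>
      h.six_reroute g1 g2 h3 g12 g13 g23 hw hw' hz ww wz wz' hP hQ hu hx hv huv hab hac hbc hua
        hxb hvc b4 b5 b6 b3 b7 b8 b1 b2
    by_cases c1 : G.adj s₁ c
    · have := ind_of c1
      have p1 : G.adj s₂ a := pos (by omega)
      have p2 : G.adj s₂ b := pos (by omega)
      by_cases c2 : G.adj u y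
      · have := ind_of c2
        exact key s₂ s₁ y y' h2 h1 h12.symm h23 h13 a1 hy hy' yy' yz yz' a4 xy p1 p2 c1 c2
          (pos (by omega))
      · have := ind_not c2
        exact key s₂ s₁ y' y h2 h1 h12.symm h23 h13 a1 hy' hy yy'.symm yz' yz a3 xy' p1 p2 c1
          (pos (by omega)) (pos (by omega))
    · have := ind_not c1
      have p1 : G.adj s₁ a := pos (by omega)
      have p2 : G.adj s₁ b := pos (by omega)
      have p3 : G.adj s₂ c := pos (by omega)
      by_cases c2 : G.adj u y
      · have := ind_of c2
        exact key s₁ s₂ y y' h1 h2 h12 h13 h23 a2 hy hy' yy' yz yz' a4 xy p1 p2 p3 c2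
          (pos (by omega))
      · have := ind_not c2
        exact key s₁ s₂ y' y h1 h2 h12 h13 h23 a2 hy' hy yy'.symm yz' yz a3 xy' p1 p2 p3
          (pos (by omega)) (pos (by omega))

/-- Two marked vertices of small degree with a common neighbour cannot coexist with a third one
having two further neighbours. -/
theorem State.no_light_link (h : G.State C) {s₁ s₂ s₃ : A} {z y y' : B} (h1 : G.Avail C s₁)
    (h2 : G.Avail C s₂) (h3 : G.Avail C s₃) (h12 : s₁ ≠ s₂) (h13 : s₁ ≠ s₃) (h23 : s₂ ≠ s₃)
    (hz : z ∈ restR C) (hy : y ∈ restR C) (hy' : y' ∈ restR C)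
    (yz : y ≠ z) (yz' : y' ≠ z) (yy' : y ≠ y')
    (a1 : G.adj s₁ z) (a2 : G.adj s₂ z) (a3 : G.adj s₃ y) (a4 : G.adj s₃ y')
    (hdeg : G.degL s₁ (restR C) + G.degL s₂ (restR C) ≤ 5) : False := by
  -- Such an edge would complete the uncovered path `w' s₃ w s₁ z s₂`, or its mirror image with `s₁`
  -- and `s₂` interchanged.
  have n1 : ∀ w w', w ∈ restR C → w' ∈ restR C → w ≠ w' → w ≠ z → w' ≠ z → G.adj s₃ w →
      G.adj s₃ w' → ¬ G.adj s₁ w ∧ ¬ G.adj s₂ w := fun w w' hw hw' ww wz wz' b b' =>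
    ⟨fun p => h.no_path h3 h1 h2 h13.symm h23.symm h12 hw' hw hz ww.symm wz' wz b' b p a1 a2,
      fun p => h.no_path h3 h2 h1 h23.symm h13.symm h12.symm hw' hw hz ww.symm wz' wz b' b p a2
        a1⟩
  obtain ⟨m1, m2⟩ := n1 y y' hy hy' yy' yz yz' a3 a4
  obtain ⟨m3, m4⟩ := n1 y' y hy' hy yy'.symm yz' yz a4 a3
  have d1 := degR_add_two_le h1.1 h2.1 h12 m1 m2
  have d2 := degR_add_two_le h1.1 h2.1 h12 m3 m4
  have o1 := h.ore_sum h1.2 m1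
  have o2 := h.ore_sum h2.2 m4
  simp only [sum_add_distrib] at o1 o2
  -- With `r = #(restL C)`, the uncovered contribution is at most `5 + 2 * (r - 2)`, one less than
  -- the `2 * r + 2` required by the two degree conditions.
  obtain ⟨i, -, hi⟩ : ∃ i ∈ univ, 2 * #(C i).1 < G.degL s₁ (C i).2 + G.degL s₂ (C i).2 +
      (G.degR y (C i).1 + G.degR y' (C i).1) := by
    refine exists_lt_of_sum_lt ?_
    simp only [sum_add_distrib, ← mul_sum]
    omega
  rcases h.four_or_long i with ⟨u, v, c, d, h4⟩ | h4
  · rw [h4.card, h4.eq₁, h4.eq₂] at hi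
    simp only [degL_pair h4.hcd, degR_pair h4.huv] at hi
    have lab := labeling_three h h4 h1 h2 h3 hz hy hy' h12 h13 h23 yz.symm yz'.symm yy'
    have h7 : 5 ≤ ind (G.adj s₁ c) + ind (G.adj s₁ d) + ind (G.adj s₂ c) + ind (G.adj s₂ d) +
      ind (G.adj u y) + ind (G.adj v y) + ind (G.adj u y') + ind (G.adj v y') := by omega
    have hi := h4
    exact no_dense_link h7
      (fun x1 x3 x4 => lab.path 0 1 2 3 4 0 4 2 1 3 a1 x1 a2 x3 a4 a3 x4 hi.huc hi.hvc)
      (fun x0 x2 x4 => lab.path 0 1 2 3 4 0 3 2 1 4 a1 x0 a2 x2 a4 a3 x4 hi.hud hi.hvd)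
      (fun x0 x2 x5 => lab.path 0 1 2 4 3 0 3 2 1 4 a1 x0 a2 x2 a4 a3 x5 hi.hvd hi.hud)
      (fun x0 x2 x6 => lab.path 0 1 2 3 4 0 3 1 2 4 a1 x0 a2 x2 a3 a4 x6 hi.hud hi.hvd)
      (fun x0 x4 x6 => lab.path 2 3 4 0 1 1 2 4 3 0 a3 a4 x4 x6 hi.hvd hi.hvc x0 a1 a2)
      (fun x2 x4 x6 => lab.path 2 3 4 1 0 1 2 4 3 0 a3 a4 x4 x6 hi.hvd hi.hvc x2 a2 a1)
      (fun x1 x3 x6 => lab.path 0 1 2 3 4 0 4 1 2 3 a1 x1 a2 x3 a3 a4 x6 hi.huc hi.hvc)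
      (fun x1 x5 x7 => lab.path 2 4 3 0 1 1 2 3 4 0 a3 a4 x5 x7 hi.huc hi.hud x1 a1 a2)
      (fun x3 x5 x7 => lab.path 2 4 3 1 0 1 2 3 4 0 a3 a4 x5 x7 hi.huc hi.hud x3 a2 a1)
      (fun x0 x2 x7 => lab.path 0 1 2 4 3 0 3 1 2 4 a1 x0 a2 x2 a3 a4 x7 hi.hvd hi.hud)
  · exact absurd hi (h.link_long h4 h1 h2 h3 h12 h13 h23 hz hy hy' yz yz' yy' a1 a2 a3 a4).not_gt

/-! ### Excluding five-vertex paths with marked ends -/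

variable {C' : Fin m → Finset A × Finset B}

theorem SwapL.avail {s w t : A} (sw : G.SwapL C C' i s w) (ht : G.Avail C t) (hts : t ≠ s) :
    G.Avail C' t :=
  ⟨(sw.mem_restL t).2 (Or.inl ⟨ht.1, hts⟩), ht.2⟩

theorem SwapL.avail_new {s w : A} (sw : G.SwapL C C' i s w) : G.Avail C' w :=
  ⟨(sw.mem_restL w).2 (Or.inr rfl), sw.marked⟩

theorem SwapL.ne {s w t : A} (sw : G.SwapL C C' i s w) (ht : G.Avail C t) : t ≠ w :=
  ne_of_mem_of_not_mem ht.1 sw.notMem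

theorem SwapL.memR {s w : A} {y : B} (sw : G.SwapL C C' i s w) (hy : y ∈ restR C) :
    y ∈ restR C' :=
  sw.restR_eq ▸ hy

theorem SwapR.avail {y p : B} {t : A} (sw : G.SwapR C C' i y p) (ht : G.Avail C t) :
    G.Avail C' t :=
  ⟨sw.restL_eq ▸ ht.1, ht.2⟩

theorem SwapR.mem_new {y p : B} (sw : G.SwapR C C' i y p) : p ∈ restR C' :=
  (sw.mem_restR p).2 (Or.inr rfl)

theorem SwapR.memR {y p x : B} (sw : G.SwapR C C' i y p) (hx : x ∈ restR C) (hxy : x ≠ y) :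
    x ∈ restR C' :=
  (sw.mem_restR x).2 (Or.inl ⟨hx, hxy⟩)

theorem SwapR.ne {y p x : B} (sw : G.SwapR C C' i y p) (hx : x ∈ restR C) : x ≠ p :=
  ne_of_mem_of_not_mem hx sw.notMem

theorem exists_adj_of_card_lt {s : A} {Y : Finset B} (T : Finset B) (h : #T < G.degL s Y) :
    ∃ x ∈ Y, G.adj s x ∧ x ∉ T := by
  by_contra! hcon
  exact (degL_le_card T hcon).not_gt h

theorem exists_two_adj {s : A} {Y : Finset B} (z : B) (h : 2 < G.degL s Y) :
    ∃ x x', x ∈ Y ∧ x' ∈ Y ∧ x ≠ z ∧ x' ≠ z ∧ x ≠ x' ∧ G.adj s x ∧ G.adj s x' := by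
  obtain ⟨x, hx, ax, hxz⟩ := exists_adj_of_card_lt (G := G) (s := s) (Y := Y) {z}
    (by rw [card_singleton]; omega)
  obtain ⟨x', hx', ax', hxz'⟩ := exists_adj_of_card_lt {z, x} (card_le_two.trans_lt h)
  simp only [mem_insert, mem_singleton, not_or] at hxz hxz'
  exact ⟨x, x', hx, hx', hxz, hxz'.1, Ne.symm hxz'.2, ax, ax'⟩

/-- If the released `u` had three neighbours, two of them would avoid `y'`. If `s₂` sees `y₀`, one
of these extends `u y₀ s₂ y' s₃` to a six-vertex path. Otherwise `s₂` and `s₃` have small degree and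
share `y'`, against `no_light_link`. -/
theorem SwapL.degL_le_two {s s₂ s₃ u : A} {y y' y₀ : B} (sw : G.SwapL C C' i s u)
    (h2 : G.Avail C s₂) (h3 : G.Avail C s₃) (h12 : s₂ ≠ s) (h13 : s₃ ≠ s) (h23 : s₂ ≠ s₃)
    (hy' : y' ∈ restR C) (hy₀ : y₀ ∈ restR C) (y₀y' : y₀ ≠ y')
    (a3 : G.adj s₂ y') (a4 : G.adj s₃ y')
    (n3 : ∀ w ∈ restR C, G.adj s₃ w → w = y')
    (n2 : G.adj s₂ y₀ ∨ ∀ w ∈ restR C, G.adj s₂ w → w = y ∨ w = y')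
    (au : G.adj u y₀) : G.degL u (restR C) ≤ 2 := by
  have g2 := sw.avail h2 h12
  have g3 := sw.avail h3 h13
  have gu := sw.avail_new
  by_contra! hd
  obtain ⟨x, x', hx, hx', hxy, hxy', hxx', ax, ax'⟩ := exists_two_adj y' hd
  rcases n2 with n2 | n2
  · have key : ∀ x ∈ restR C, G.adj u x → x ≠ y' → x = y₀ := fun x hx ax hxy => by
      by_contra hne
      exact sw.state.no_path gu g2 g3 (sw.ne h2).symm (sw.ne h3).symm h23 (sw.memR hx)
        (sw.memR hy₀) (sw.memR hy') hne hxy y₀y' ax au n2 a3 a4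
    exact hxx' ((key x hx ax hxy).trans (key x' hx' ax' hxy').symm)
  · have d2 : G.degL s₂ (restR C) ≤ 2 := 
      (degL_le_card {y, y'} (by simpa using n2)).trans card_le_two
    have d3 := degL_le_one y' n3
    exact sw.state.no_light_link g2 g3 gu h23 (sw.ne h2) (sw.ne h3) (sw.memR hy') (sw.memR hx)
      (sw.memR hx') hxy hxy' hxx' a3 a4 ax ax' (by rw [sw.restR_eq]; omega)

/-- No path on five vertices through three marked vertices, with marked ends, avoids the packing. -/
theorem State.no_cherries (h : G.State C) {s₁ s₂ s₃ : A} {y y' : B} (h1 : G.Avail C s₁)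
    (h2 : G.Avail C s₂) (h3 : G.Avail C s₃) (h12 : s₁ ≠ s₂) (h13 : s₁ ≠ s₃) (h23 : s₂ ≠ s₃)
    (hy : y ∈ restR C) (hy' : y' ∈ restR C) (yy' : y ≠ y')
    (a1 : G.adj s₁ y) (a2 : G.adj s₂ y) (a3 : G.adj s₂ y') (a4 : G.adj s₃ y') : False := by
  have n1 : ∀ w ∈ restR C, G.adj s₁ w → w = y := fun w hw p => by
    by_contra hne
    have hwy : w ≠ y' := fun e => hne (h.eq_of_adj h1 h2 h12 hw hy a1 a2 p (e ▸ a3))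
    exact h.no_path h1 h2 h3 h12 h13 h23 hw hy hy' hne hwy yy' p a1 a2 a3 a4
  have n3 : ∀ w ∈ restR C, G.adj s₃ w → w = y' := fun w hw p => by
    by_contra hne
    have hwy : w ≠ y := fun e => hne (h.eq_of_adj h3 h2 h23.symm hw hy' a4 a3 p (e ▸ a2))
    exact h.no_path h3 h2 h1 h23.symm h13.symm h12.symm hw hy' hy hne hwy yy'.symm p a4 a3 a2 a1
  -- A third neighbour of `s₂` is preferred. If there is none, any third vertex serves, and then
  -- `s₂` has degree at most two.
  obtain ⟨y₀, hy₀, y₀y, y₀y', n2⟩ : ∃ y₀ ∈ restR C, y₀ ≠ y ∧ y₀ ≠ y' ∧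
      (G.adj s₂ y₀ ∨ ∀ w ∈ restR C, G.adj s₂ w → w = y ∨ w = y') := by
    by_cases hex : ∃ w ∈ restR C, G.adj s₂ w ∧ w ≠ y ∧ w ≠ y'
    · obtain ⟨w, hw, aw, hwy⟩ := hex
      exact ⟨w, hw, hwy.1, hwy.2, Or.inl aw⟩
    · obtain ⟨w, hw, hwy⟩ := h.exists_restR y y'
      refine ⟨w, hw, hwy.1, hwy.2, Or.inr fun x hx ax => ?_⟩
      by_contra hne
      rw [not_or] at hne
      exact hex ⟨x, hx, ax, hne⟩
  have m1 : ¬ G.adj s₁ y₀ := fun p => y₀y (n1 _ hy₀ p)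
  have m3 : ¬ G.adj s₃ y₀ := fun p => y₀y' (n3 _ hy₀ p)
  have d0 := degR_add_two_le h1.1 h3.1 h13 m1 m3
  have d1 := degL_le_one y n1
  have d3 := degL_le_one y' n3
  -- A new neighbour of an end of the five-vertex path would extend it to an uncovered path on six
  -- vertices.
  have r1 : ∀ i, ¬ G.PairR C i s₁ y₀ := fun i ⟨C', p, sw, ap⟩ =>
    sw.state.no_path (sw.avail h1) (sw.avail h2) (sw.avail h3) h12 h13 h23 sw.mem_new
      (sw.memR hy y₀y.symm) (sw.memR hy' y₀y'.symm) (sw.ne hy).symm (sw.ne hy').symm yy' ap a1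
      a2 a3 a4
  have r3 : ∀ i, ¬ G.PairR C i s₃ y₀ := fun i ⟨C', p, sw, ap⟩ =>
    sw.state.no_path (sw.avail h3) (sw.avail h2) (sw.avail h1) h23.symm h13.symm h12.symm
      sw.mem_new (sw.memR hy' y₀y'.symm) (sw.memR hy y₀y.symm) (sw.ne hy').symm (sw.ne hy).symm
      yy'.symm ap a4 a3 a2 a1
  have l1 : ∃ i, G.PairL C i s₁ y₀ := by
    obtain ⟨i, hi⟩ := h.exists_pair h1 hy₀ m1 (by omega)
    exact ⟨i, hi.resolve_right (r1 i)⟩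
  obtain ⟨i, C₁, u, sw, au⟩ := l1
  -- For `s₃` the count gives two exchanges at different cycles, so one of them avoids the cycle
  -- used for `s₁`. After both exchanges `u` and `u'` share `y₀` and have small degree, while `s₂`
  -- still sees `y` and `y'`.
  obtain ⟨l, hl, C₂, u', sw', au'⟩ : ∃ l, l ≠ i ∧ G.PairL C l s₃ y₀ := by
    rcases h.exists_pairs h3 hy₀ m3 (by omega) with ⟨l, hl⟩ | ⟨l, l', hll, hl, hl'⟩
    · exact absurd hl.2 (r3 l)
    · by_cases hli : l = i
      · exact ⟨l', hli ▸ hll.symm, hl'.resolve_right (r3 l')⟩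
      · exact ⟨l, hli, hl.resolve_right (r3 l)⟩
  have du := sw.degL_le_two h2 h3 h12.symm h13.symm h23 hy' hy₀ y₀y' a3 a4 n3 n2 au
  have du' := sw'.degL_le_two h2 h1 h23 h13 h12.symm hy hy₀ y₀y a2 a1 n1
    (n2.imp_right fun t w hw aw => (t w hw aw).symm) au'
  obtain ⟨C₃, sw₃⟩ := sw'.transfer sw.state (sw.other l hl) (sw.avail h3 h13.symm)
  exact sw₃.state.no_light_link (sw₃.avail sw.avail_new (sw.ne h3).symm) sw₃.avail_new
    (sw₃.avail (sw.avail h2 h12.symm) h23) (sw₃.ne sw.avail_new) (sw.ne h2).symm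
    (sw₃.ne (sw.avail h2 h12.symm)).symm (sw₃.memR (sw.memR hy₀)) (sw₃.memR (sw.memR hy))
    (sw₃.memR (sw.memR hy')) y₀y.symm y₀y'.symm yy' au au' a2 a3
    (by rw [sw₃.restR_eq, sw.restR_eq]; omega)

theorem Labeling.cherries (h : G.Labeling C i f g) (p q a b c : Fin 5) (r t y₁ y₂ : Fin k)
    (a1 : G.adj (f p) (g r)) (a2 : G.adj (f p) (g t)) (a3 : G.adj (f q) (g r))
    (a4 : G.adj (f q) (g t)) (b1 : G.adj (f a) (g y₁)) (b2 : G.adj (f b) (g y₁))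
    (b3 : G.adj (f b) (g y₂)) (b4 : G.adj (f c) (g y₂))
    (hd : [p, q, a, b, c].Nodup := by decide) (hd' : [r, t, y₁, y₂].Nodup := by decide) :
    False := by
  simp only [List.nodup_cons, List.mem_cons, List.not_mem_nil, or_false, not_or] at hd hd'
  obtain ⟨⟨pq, pa, pb, pc⟩, ⟨qa, qb, qc⟩, ⟨ab, ac⟩, bc, -⟩ := hd
  obtain ⟨⟨rt, r1, r2⟩, ⟨t1, t2⟩, y12, -⟩ := hd'
  obtain ⟨C', h', hf, hg⟩ := h.swap pq rt a1 a2 a3 a4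
  exact h'.no_cherries (hf a (Ne.symm pa) (Ne.symm qa)) (hf b (Ne.symm pb) (Ne.symm qb))
    (hf c (Ne.symm pc) (Ne.symm qc)) (h.injL.ne ab) (h.injL.ne ac) (h.injL.ne bc)
    (hg _ (Ne.symm r1) (Ne.symm t1)) (hg _ (Ne.symm r2) (Ne.symm t2))
    (h.injR.ne y12) b1 b2 b3 b4

/-! ### Finite checks for links with further edges and for matchings -/

set_option synthInstance.maxHeartbeats 0 in
set_option synthInstance.maxSize 100000 in
set_option maxRecDepth 100000 in
theorem no_dense_double_fork {p0 p1 p2 p3 p4 p5 p6 p7 p8 p9 p10 p11 : Prop}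
    (h : 7 ≤ ind p0 + ind p1 + ind p2 + ind p3 + ind p4 + ind p5 + ind p6 + ind p7 + ind p8 + ind
        p9 + ind p10 + ind p11)
    (n0 : p4 → p5 → p6 → False) (n1 : p1 → p3 → p6 → p7 → False) (n2 : p4 → p5 → p7 → False)
    (n3 : p0 → p3 → p7 → p8 → False) (n4 : p1 → p2 → p7 → p8 → False)
    (n5 : p0 → p1 → p2 → p3 → p6 → p8 → False) (n6 : p4 → p5 → p8 → False)
    (n7 : p4 → p5 → p9 → False) (n8 : p1 → p2 → p6 → p9 → False) (n9 : p0 → p3 → p6 → p9 → False)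
    (n10 : p2 → p4 → p8 → p9 → False) (n11 : p2 → p5 → p6 → p9 → False)
    (n12 : p1 → p5 → p8 → p9 → False) (n13 : p0 → p4 → p8 → p9 → False)
    (n14 : p0 → p1 → p2 → p3 → p7 → p9 → False) (n15 : p0 → p2 → p10 → False)
    (n16 : p4 → p7 → p10 → False) (n17 : p1 → p3 → p10 → False) (n18 : p5 → p7 → p10 → False)
    (n19 : p2 → p6 → p9 → p10 → False) (n20 : p0 → p1 → p8 → p10 → False)
    (n21 : p1 → p3 → p11 → False) (n22 : p5 → p8 → p11 → False) (n23 : p4 → p6 → p11 → False)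
    (n24 : p0 → p2 → p11 → False) (n25 : p0 → p1 → p9 → p11 → False)
    (n26 : p3 → p7 → p8 → p11 → False) (n27 : p0 → p6 → p9 → p11 → False)
    (n28 : p1 → p6 → p9 → p11 → False) :
    False := by
  obtain ⟨b0, rfl⟩ := exists_eq_true p0
  obtain ⟨b1, rfl⟩ := exists_eq_true p1
  obtain ⟨b2, rfl⟩ := exists_eq_true p2
  obtain ⟨b3, rfl⟩ := exists_eq_true p3
  obtain ⟨b4, rfl⟩ := exists_eq_true p4
  obtain ⟨b5, rfl⟩ := exists_eq_true p5
  obtain ⟨b6, rfl⟩ := exists_eq_true p6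
  obtain ⟨b7, rfl⟩ := exists_eq_true p7
  obtain ⟨b8, rfl⟩ := exists_eq_true p8
  obtain ⟨b9, rfl⟩ := exists_eq_true p9
  obtain ⟨b10, rfl⟩ := exists_eq_true p10
  obtain ⟨b11, rfl⟩ := exists_eq_true p11
  simp only [ind_eq_toNat] at h
  revert b0 b1 b2 b3 b4 b5 b6 b7 b8 b9 b10 b11
  decide +kernel

set_option synthInstance.maxHeartbeats 0 in
set_option synthInstance.maxSize 100000 in
set_option maxRecDepth 100000 in
-- Bounds the excess at a single four-cycle by two, so that an excess of three must spread over two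
-- cycles.
theorem no_very_dense_double_fork {p0 p1 p2 p3 p4 p5 p6 p7 p8 p9 p10 p11 : Prop}
    (h : 9 ≤ ind p0 + ind p1 + ind p2 + ind p3 + ind p4 + ind p5 + ind p6 + ind p7 + ind p8 + ind
        p9 + ind p10 + ind p11)
    (n0 : p0 → p3 → p7 → p8 → False) (n1 : p1 → p2 → p7 → p8 → False) (n2 : p4 → p5 → p9 → False)
    (n3 : p0 → p2 → p10 → False) (n4 : p4 → p7 → p10 → False) (n5 : p5 → p9 → p10 → False)
    (n6 : p1 → p3 → p11 → False) :
    False := by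
  obtain ⟨b0, rfl⟩ := exists_eq_true p0
  obtain ⟨b1, rfl⟩ := exists_eq_true p1
  obtain ⟨b2, rfl⟩ := exists_eq_true p2
  obtain ⟨b3, rfl⟩ := exists_eq_true p3
  obtain ⟨b4, rfl⟩ := exists_eq_true p4
  obtain ⟨b5, rfl⟩ := exists_eq_true p5
  obtain ⟨b6, rfl⟩ := exists_eq_true p6
  obtain ⟨b7, rfl⟩ := exists_eq_true p7
  obtain ⟨b8, rfl⟩ := exists_eq_true p8
  obtain ⟨b9, rfl⟩ := exists_eq_true p9
  obtain ⟨b10, rfl⟩ := exists_eq_true p10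
  obtain ⟨b11, rfl⟩ := exists_eq_true p11
  simp only [ind_eq_toNat] at h
  revert b0 b1 b2 b3 b4 b5 b6 b7 b8 b9 b10 b11
  decide +kernel

set_option synthInstance.maxHeartbeats 0 in
set_option synthInstance.maxSize 100000 in
set_option maxRecDepth 100000 in
theorem no_dense_fork {p0 p1 p2 p3 p4 p5 p6 p7 p8 p9 p10 p11 : Prop}
    (h : 7 ≤ ind p0 + ind p1 + ind p2 + ind p3 + ind p4 + ind p5 + ind p6 + ind p7 + ind p8 + ind
        p9 + ind p10 + ind p11)
    (n0 : p4 → p5 → p6 → False) (n1 : p4 → p5 → p7 → False) (n2 : p0 → p2 → p6 → p7 → False)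
    (n3 : p1 → p3 → p6 → p7 → False) (n4 : p1 → p2 → p7 → p8 → False) (n5 : p4 → p5 → p8 → False)
    (n6 : p0 → p3 → p7 → p8 → False) (n7 : p2 → p3 → p6 → p8 → False)
    (n8 : p0 → p3 → p6 → p9 → False) (n9 : p1 → p2 → p6 → p9 → False)
    (n10 : p2 → p3 → p7 → p9 → False) (n11 : p0 → p1 → p2 → p3 → p9 → False)
    (n12 : p0 → p5 → p6 → p9 → False) (n13 : p1 → p4 → p6 → p9 → False)
    (n14 : p0 → p2 → p10 → False) (n15 : p3 → p4 → p10 → False) (n16 : p5 → p7 → p10 → False)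
    (n17 : p4 → p7 → p10 → False) (n18 : p0 → p1 → p8 → p10 → False) (n19 : p1 → p3 → p10 → False)
    (n20 : p1 → p3 → p11 → False) (n21 : p4 → p6 → p11 → False) (n22 : p2 → p5 → p11 → False)
    (n23 : p0 → p1 → p9 → p11 → False) (n24 : p5 → p6 → p8 → p11 → False)
    (n25 : p0 → p2 → p11 → False) (n26 : p2 → p6 → p8 → p11 → False)
    (n27 : p3 → p6 → p8 → p11 → False) (n28 : p0 → p6 → p9 → p11 → False)
    (n29 : p1 → p6 → p9 → p11 → False) (n30 : p0 → p5 → p8 → p11 → False)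
    (n31 : p1 → p4 → p8 → p11 → False) :
    False := by
  obtain ⟨b0, rfl⟩ := exists_eq_true p0
  obtain ⟨b1, rfl⟩ := exists_eq_true p1
  obtain ⟨b2, rfl⟩ := exists_eq_true p2
  obtain ⟨b3, rfl⟩ := exists_eq_true p3
  obtain ⟨b4, rfl⟩ := exists_eq_true p4
  obtain ⟨b5, rfl⟩ := exists_eq_true p5
  obtain ⟨b6, rfl⟩ := exists_eq_true p6
  obtain ⟨b7, rfl⟩ := exists_eq_true p7
  obtain ⟨b8, rfl⟩ := exists_eq_true p8
  obtain ⟨b9, rfl⟩ := exists_eq_true p9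
  obtain ⟨b10, rfl⟩ := exists_eq_true p10
  obtain ⟨b11, rfl⟩ := exists_eq_true p11
  simp only [ind_eq_toNat] at h
  revert b0 b1 b2 b3 b4 b5 b6 b7 b8 b9 b10 b11
  decide +kernel

set_option synthInstance.maxHeartbeats 0 in
set_option synthInstance.maxSize 100000 in
set_option maxRecDepth 100000 in
theorem no_dense_matching {p0 p1 p2 p3 p4 p5 p6 p7 p8 p9 p10 p11 : Prop}
    (h : 7 ≤ ind p0 + ind p1 + ind p2 + ind p3 + ind p4 + ind p5 + ind p6 + ind p7 + ind p8 + ind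
        p9 + ind p10 + ind p11)
    (n0 : p1 → p4 → p6 → False) (n1 : p2 → p3 → p6 → False) (n2 : p0 → p3 → p7 → False)
    (n3 : p0 → p5 → p7 → False) (n4 : p1 → p7 → p8 → False) (n5 : p4 → p5 → p8 → False)
    (n6 : p0 → p6 → p9 → False) (n7 : p2 → p5 → p9 → False) (n8 : p0 → p1 → p9 → False)
    (n9 : p1 → p2 → p6 → p9 → False) (n10 : p4 → p7 → p10 → False) (n11 : p0 → p1 → p10 → False)
    (n12 : p3 → p9 → p10 → False) (n13 : p2 → p3 → p11 → False) (n14 : p5 → p6 → p11 → False)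
    (n15 : p2 → p8 → p11 → False) (n16 : p3 → p4 → p11 → False) :
    False := by
  obtain ⟨b0, rfl⟩ := exists_eq_true p0
  obtain ⟨b1, rfl⟩ := exists_eq_true p1
  obtain ⟨b2, rfl⟩ := exists_eq_true p2
  obtain ⟨b3, rfl⟩ := exists_eq_true p3
  obtain ⟨b4, rfl⟩ := exists_eq_true p4
  obtain ⟨b5, rfl⟩ := exists_eq_true p5
  obtain ⟨b6, rfl⟩ := exists_eq_true p6
  obtain ⟨b7, rfl⟩ := exists_eq_true p7
  obtain ⟨b8, rfl⟩ := exists_eq_true p8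
  obtain ⟨b9, rfl⟩ := exists_eq_true p9
  obtain ⟨b10, rfl⟩ := exists_eq_true p10
  obtain ⟨b11, rfl⟩ := exists_eq_true p11
  simp only [ind_eq_toNat] at h
  revert b0 b1 b2 b3 b4 b5 b6 b7 b8 b9 b10 b11
  decide +kernel


/-! ### Excluding common neighbours of marked vertices -/

theorem State.eq_of_link (h : G.State C) {s₁ s₂ s₃ : A} {z x : B} (h1 : G.Avail C s₁)
    (h2 : G.Avail C s₂) (h3 : G.Avail C s₃) (h12 : s₁ ≠ s₂) (h13 : s₁ ≠ s₃) (h23 : s₂ ≠ s₃)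
    (hz : z ∈ restR C) (a1 : G.adj s₁ z) (a2 : G.adj s₂ z) (hx : x ∈ restR C)
    (b1 : G.adj s₁ x) (b3 : G.adj s₃ x) : x = z := by
  by_contra hne
  exact h.no_cherries h3 h1 h2 h13.symm h23.symm h12 hx hz hne b3 b1 a1 a2

/-- A common neighbour of `y₁` and `y₂` is impossible: a marked one yields a five-vertex path with
marked ends, and an unmarked one a hexagon with the two marked vertices `s₁, s₂`. -/
theorem State.degR_le_of_link (h : G.State C) {s₁ s₂ : A} {y₁ y₂ z : B} (h1 : G.Avail C s₁)
    (h2 : G.Avail C s₂) (h12 : s₁ ≠ s₂) (hz : z ∈ restR C) (hy1 : y₁ ∈ restR C)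
    (hy2 : y₂ ∈ restR C) (yz1 : y₁ ≠ z) (yz2 : y₂ ≠ z) (a1 : G.adj s₁ z) (a2 : G.adj s₂ z)
    (b1 : G.adj s₁ y₁) (b2 : G.adj s₂ y₂) :
    G.degR y₁ (restL C) + G.degR y₂ (restL C) ≤ #(restL C) := by
  have e12 := fun y hy => h.eq_of_adj (y := y) h1 h2 h12 hy hz a1 a2
  have y12 : y₁ ≠ y₂ := fun e => yz1 (e12 _ hy1 b1 (e ▸ b2))
  refine (degR_add_le (G := G) (y₁ := y₁) (y₂ := y₂) ∅ fun x hx p q => ?_).trans (by simp)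
  exfalso
  have hx1 : x ≠ s₁ := fun e => yz2 (e12 _ hy2 (e ▸ q) b2)
  have hx2 : x ≠ s₂ := fun e => yz1 (e12 _ hy1 b1 (e ▸ p))
  by_cases hxS : x ∈ G.S
  · exact h.no_cherries ⟨hx, hxS⟩ h1 h2 hx1 hx2 h12 hy1 hz yz1 p b1 a1 a2
  · exact h.no_six_rest h1 hx hxS h2 hy1 hy2 hz h12 y12 yz1 yz2 b1 p q b2 a2 a1

theorem State.no_two_private (h : G.State C) {s₁ s₂ s₃ : A} {z y₁ y₂ y₃ : B}
    (h1 : G.Avail C s₁) (h2 : G.Avail C s₂) (h3 : G.Avail C s₃) (h12 : s₁ ≠ s₂) (h13 : s₁ ≠ s₃)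
    (h23 : s₂ ≠ s₃) (hz : z ∈ restR C) (hy1 : y₁ ∈ restR C) (hy2 : y₂ ∈ restR C)
    (hy3 : y₃ ∈ restR C) (yz1 : y₁ ≠ z) (yz2 : y₂ ≠ z) (yz3 : y₃ ≠ z)
    (a1 : G.adj s₁ z) (a2 : G.adj s₂ z) (b1 : G.adj s₁ y₁) (b2 : G.adj s₂ y₂)
    (b3 : G.adj s₃ y₃) : False := by
  have e12 := fun y hy => h.eq_of_adj (y := y) h1 h2 h12 hy hz a1 a2
  have e13 := fun y hy => h.eq_of_link (x := y) h1 h2 h3 h12 h13 h23 hz a1 a2 hy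
  have e23 := fun y hy => h.eq_of_link (x := y) h2 h1 h3 h12.symm h23 h13 hz a2 a1 hy
  have y12 : y₁ ≠ y₂ := fun e => yz1 (e12 _ hy1 b1 (e ▸ b2))
  have y13 : y₁ ≠ y₃ := fun e => yz1 (e13 _ hy1 b1 (e ▸ b3))
  have y23 : y₂ ≠ y₃ := fun e => yz2 (e23 _ hy2 b2 (e ▸ b3))
  have n1 : ¬ G.adj s₁ y₂ := fun p => yz2 (e12 _ hy2 p b2)
  have n2 : ¬ G.adj s₂ y₃ := fun p => yz3 (e23 _ hy3 p b3)
  have n3 : ¬ G.adj s₃ y₁ := fun p => yz1 (e13 _ hy1 b1 p)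
  have dL := degL_add_add_le (G := G) (s₁ := s₁) (s₂ := s₂) (s₃ := s₃) (Y := restR C) {z} 2
    (fun y hy hyT => ind_add_add_le_one
      (fun p q => hyT (by simp [e12 y hy p q])) (fun p q => hyT (by simp [e13 y hy p q]))
      (fun p q => hyT (by simp [e23 y hy p q])))
    (fun y hy => ind_add_add_le_three _ _ _)
  have dR := h.degR_le_of_link h1 h2 h12 hz hy1 hy2 yz1 yz2 a1 a2 b1 b2
  have d3 := degR_add_two_le h1.1 h2.1 h12 (fun p => yz3 (e13 _ hy3 p b3)) n2
  rw [h.card_eq, card_singleton] at dL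
  have o := h.ore_six h1.2 h2.2 h3.2 n1 n2 n3
  -- The finite check leaves a single surviving pattern: `s₁` and `s₂` both see `c, d`, and one of
  -- the two marked cycle vertices sees both `y₁` and `y₂`.
  have key : ∀ i, 3 * #(C i).1 < G.deg₆ (C i) s₁ s₂ s₃ y₁ y₂ y₃ →
      G.deg₆ (C i) s₁ s₂ s₃ y₁ y₂ y₃ ≤ 3 * #(C i).1 + 2 ∧ ∃ u v c d, G.IsFour (C i) u v c d ∧
      G.adj s₁ c ∧ G.adj s₁ d ∧ G.adj s₂ c ∧ G.adj s₂ d ∧ G.adj u y₁ ∧ G.adj u y₂ := by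
    intro i hlt
    obtain ⟨u, v, c, d, hi⟩ := h.four_of_deg₆ h1 h2 h3 hy1 hy2 hy3 b1 b2 b3 hlt
    rw [hi.card, hi.deg₆_eq] at *
    have lab := labeling_four h hi h1 h2 h3 hy1 hy2 hy3 hz h12 h13 h23 y12 y13 y23 yz1 yz2 yz3
    constructor
    · by_contra h9
      rw [not_le] at h9
      exact no_very_dense_double_fork h9
        (fun x0 x3 x7 x8 => lab.two 0 4 1 3 0 4 1 5 b1 x0 x7 hi.hvc b2 x3 x8 hi.hud)
        (fun x1 x2 x7 x8 => lab.two 0 4 1 3 0 5 1 4 b1 x1 x7 hi.hvd b2 x2 x8 hi.huc)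
        (fun x4 x5 x9 => lab.cherries 2 3 0 1 4 4 5 3 1 x4 x5 hi.huc hi.hud a1 a2 b2 x9)
        (fun x0 x2 x10 => lab.cherries 0 1 2 3 4 3 4 2 5 a1 x0 a2 x2 b3 x10 hi.hud hi.hvd)
        (fun x4 x7 x10 => lab.cherries 2 3 1 0 4 2 4 3 0 b3 x4 x10 hi.huc a2 a1 b1 x7)
        (fun x5 x9 x10 => lab.cherries 2 3 0 1 4 2 5 3 1 b3 x5 x10 hi.hud a1 a2 b2 x9)
        (fun x1 x3 x11 => lab.cherries 0 1 2 4 3 3 5 2 4 a1 x1 a2 x3 b3 x11 hi.hvc hi.huc)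
    · by_contra hcon
      have e0 : G.adj s₁ c → G.adj s₁ d → G.adj s₂ c → G.adj s₂ d → G.adj u y₁ → G.adj u y₂ →
          False := fun p1 p2 p3 p4 p5 p6 => hcon ⟨u, v, c, d, hi, p1, p2, p3, p4, p5, p6⟩
      have e1 : G.adj s₁ c → G.adj s₁ d → G.adj s₂ c → G.adj s₂ d → G.adj v y₁ → G.adj v y₂ →
          False := fun p1 p2 p3 p4 p5 p6 => hcon ⟨v, u, c, d, hi.symmL, p1, p2, p3, p4, p5, p6⟩
      exact no_dense_double_fork hlt
        (fun x4 x5 x6 => lab.cherries 2 4 1 0 3 4 5 3 0 x4 x5 hi.hvc hi.hvd a2 a1 b1 x6)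
        (fun x1 x3 x6 x7 => lab.two 0 1 3 4 3 5 0 4 a1 x1 a2 x3 x6 hi.huc x7 hi.hvc)
        (fun x4 x5 x7 => lab.cherries 2 3 1 0 4 4 5 3 0 x4 x5 hi.huc hi.hud a2 a1 b1 x7)
        (fun x0 x3 x7 x8 => lab.two 0 4 1 3 0 4 1 5 b1 x0 x7 hi.hvc b2 x3 x8 hi.hud)
        (fun x1 x2 x7 x8 => lab.two 0 4 1 3 0 5 1 4 b1 x1 x7 hi.hvd b2 x2 x8 hi.huc)
        (e0)
        (fun x4 x5 x8 => lab.cherries 2 4 0 1 3 4 5 3 1 x4 x5 hi.hvc hi.hvd a1 a2 b2 x8)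
        (fun x4 x5 x9 => lab.cherries 2 3 0 1 4 4 5 3 1 x4 x5 hi.huc hi.hud a1 a2 b2 x9)
        (fun x1 x2 x6 x9 => lab.two 0 3 1 4 0 5 1 4 b1 x1 x6 hi.hud b2 x2 x9 hi.hvc)
        (fun x0 x3 x6 x9 => lab.two 0 3 1 4 0 4 1 5 b1 x0 x6 hi.huc b2 x3 x9 hi.hvd)
        (fun x2 x4 x8 x9 => lab.cherries 3 4 0 1 2 1 5 3 4 x8 hi.hud x9 hi.hvd a1 a2 x2 x4)
        (fun x2 x5 x6 x9 => lab.cherries 1 4 0 3 2 1 4 0 5 b2 x2 x9 hi.hvc b1 x6 hi.hud x5)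
        (fun x1 x5 x8 x9 => lab.cherries 3 4 1 0 2 1 4 3 5 x8 hi.huc x9 hi.hvc a2 a1 x1 x5)
        (fun x0 x4 x8 x9 => lab.cherries 3 4 1 0 2 1 5 3 4 x8 hi.hud x9 hi.hvd a2 a1 x0 x4)
        (e1)
        (fun x0 x2 x10 => lab.cherries 0 1 2 3 4 3 4 2 5 a1 x0 a2 x2 b3 x10 hi.hud hi.hvd)
        (fun x4 x7 x10 => lab.cherries 2 3 1 0 4 2 4 3 0 b3 x4 x10 hi.huc a2 a1 b1 x7)
        (fun x1 x3 x10 => lab.cherries 0 1 2 3 4 3 5 2 4 a1 x1 a2 x3 b3 x10 hi.huc hi.hvc)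
        (fun x5 x7 x10 => lab.cherries 2 3 1 0 4 2 5 3 0 b3 x5 x10 hi.hud a2 a1 b1 x7)
        (fun x2 x6 x9 x10 => lab.cherries 1 4 0 3 2 1 4 0 2 b2 x2 x9 hi.hvc b1 x6 x10 b3)
        (fun x0 x1 x8 x10 => lab.cherries 0 4 1 3 2 4 5 1 2 x0 x1 hi.hvc hi.hvd b2 x8 x10 b3)
        (fun x1 x3 x11 => lab.cherries 0 1 2 4 3 3 5 2 4 a1 x1 a2 x3 b3 x11 hi.hvc hi.huc)
        (fun x5 x8 x11 => lab.cherries 2 4 0 1 3 2 5 3 1 b3 x5 x11 hi.hvd a1 a2 b2 x8)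
        (fun x4 x6 x11 => lab.cherries 2 4 1 0 3 2 4 3 0 b3 x4 x11 hi.hvc a2 a1 b1 x6)
        (fun x0 x2 x11 => lab.cherries 0 1 2 4 3 3 4 2 5 a1 x0 a2 x2 b3 x11 hi.hvd hi.hud)
        (fun x0 x1 x9 x11 => lab.cherries 0 3 1 4 2 4 5 1 2 x0 x1 hi.huc hi.hud b2 x9 x11 b3)
        (fun x3 x7 x8 x11 => lab.cherries 1 3 0 4 2 1 5 0 2 b2 x3 x8 hi.hud b1 x7 x11 b3)
        (fun x0 x6 x9 x11 => lab.cherries 0 3 1 4 2 0 4 1 2 b1 x0 x6 hi.huc b2 x9 x11 b3)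
        (fun x1 x6 x9 x11 => lab.cherries 0 3 1 4 2 0 5 1 2 b1 x1 x6 hi.hud b2 x9 x11 b3)
  -- The total excess is at least three and each cycle carries at most two. Exchanging `s₁` at one
  -- cycle and `s₂` at another releases two marked vertices that both see `y₁` and `y₂`, an
  -- uncovered four-cycle.
  obtain ⟨i, j, hij, hi, hj⟩ := exists_two_of_sum (k := 2)
    (f := fun i => G.deg₆ (C i) s₁ s₂ s₃ y₁ y₂ y₃) (g := fun i => 3 * #(C i).1)
    (by unfold deg₆ at *; simp only at *; omega)
    (fun i => by
      by_cases hlt : 3 * #(C i).1 < G.deg₆ (C i) s₁ s₂ s₃ y₁ y₂ y₃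
      · exact (key i hlt).1
      · omega)
  obtain ⟨-, u, v, c, d, hfi, p1, p2, -, -, p5, p6⟩ := key i hi
  obtain ⟨-, u', v', c', d', hfj, -, -, q3, q4, q5, q6⟩ := key j hj
  obtain ⟨C₁, sw⟩ := h.swapL hfi h1 p1 p2
  obtain ⟨C₂, sw'⟩ := h.swapL hfj h2 q3 q4
  obtain ⟨C₃, sw₃⟩ := sw'.transfer sw.state (sw.other j hij.symm) (sw.avail h2 h12.symm)
  exact sw₃.state.no_four_rest (sw₃.avail sw.avail_new (sw.ne h2).symm) sw₃.avail_new
    (sw₃.memR (sw.memR hy1)) (sw₃.memR (sw.memR hy2)) (sw₃.ne sw.avail_new) y12 p5 p6 q5 q6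

/-- Here `s₃` sees only `z`. Exchanging `y₁` and `y₂` at two different cycles gives it two further
neighbours, while `s₁` and `s₂` keep only `z`; this contradicts `no_light_link`. -/
theorem State.no_two_private_star (h : G.State C) {s₁ s₂ s₃ : A} {z y₁ y₂ : B}
    (h1 : G.Avail C s₁) (h2 : G.Avail C s₂) (h3 : G.Avail C s₃) (h12 : s₁ ≠ s₂) (h13 : s₁ ≠ s₃)
    (h23 : s₂ ≠ s₃) (hz : z ∈ restR C) (hy1 : y₁ ∈ restR C) (hy2 : y₂ ∈ restR C)
    (yz1 : y₁ ≠ z) (yz2 : y₂ ≠ z) (a1 : G.adj s₁ z) (a2 : G.adj s₂ z) (a3 : G.adj s₃ z)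
    (b1 : G.adj s₁ y₁) (b2 : G.adj s₂ y₂) : False := by
  have n3 : ∀ x ∈ restR C, G.adj s₃ x → x = z := fun x hx p => by
    by_contra hne
    exact h.no_two_private h1 h2 h3 h12 h13 h23 hz hy1 hy2 hx yz1 yz2 hne a1 a2 b1 b2 p
  have y12 : y₁ ≠ y₂ := fun e => yz1 (h.eq_of_adj h1 h2 h12 hy1 hz a1 a2 b1 (e ▸ b2))
  have key : ∀ s t y y', G.Avail C s → G.Avail C t → s ≠ t → s ≠ s₃ → t ≠ s₃ → y ∈ restR C →
      y' ∈ restR C → y ≠ z → y' ≠ z → G.adj s z → G.adj t z → G.adj s y → G.adj t y' →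
      (∀ x ∈ restR C, G.adj s x → x = z ∨ x = y) ∧
      ∃ i j, i ≠ j ∧ G.PairR C i s₃ y ∧ G.PairR C j s₃ y := by
    intro s t y y' hs ht hst hs3 ht3 hy hy' yz yz' as at' bs bt
    have m3 : ¬ G.adj s₃ y := fun p => yz (n3 _ hy p)
    have mt : ¬ G.adj t y := fun p => yz (h.eq_of_adj hs ht hst hy hz as at' bs p)
    have hyy : y ≠ y' := fun e => mt (e ▸ bt)
    have d0 := degR_add_two_le ht.1 h3.1 ht3 mt m3
    have d1 := degL_le_one z n3
    -- A released marked neighbour `w` of `y` would give the five-vertex path `w y s z t`.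
    have l : ∀ i, ¬ G.PairL C i s₃ y := fun i ⟨C', w, sw, aw⟩ =>
      sw.state.no_cherries sw.avail_new (sw.avail hs hs3) (sw.avail ht ht3) (sw.ne hs).symm
        (sw.ne ht).symm hst (sw.memR hy) (sw.memR hz) yz aw bs as at'
    obtain ⟨i, j, hij, hi, hj⟩ : ∃ i j, i ≠ j ∧ G.PairR C i s₃ y ∧ G.PairR C j s₃ y := by
      rcases h.exists_pairs h3 hy m3 (by omega) with ⟨i, hi⟩ | ⟨i, j, hij, hi, hj⟩
      · exact absurd hi.1 (l i)
      · exact ⟨i, j, hij, hi.resolve_left (l i), hj.resolve_left (l j)⟩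
    refine ⟨fun x hx p => ?_, i, j, hij, hi, hj⟩
    by_contra! hne
    obtain ⟨C', p', sw, ap⟩ := hi
    exact sw.state.no_two_private (sw.avail hs) (sw.avail ht) (sw.avail h3) hst hs3 ht3
      (sw.memR hz yz.symm) (sw.memR hx hne.2) (sw.memR hy' hyy.symm) sw.mem_new hne.1 yz'
      (sw.ne hz).symm as at' p bt ap
  obtain ⟨n1, i, -, -, ⟨C₁, p₁, sw, ap⟩, -⟩ :=
    key s₁ s₂ y₁ y₂ h1 h2 h12 h13 h23 hy1 hy2 yz1 yz2 a1 a2 b1 b2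
  obtain ⟨n2, j, j', hjj, hj, hj'⟩ :=
    key s₂ s₁ y₂ y₁ h2 h1 h12.symm h23 h13 hy2 hy1 yz2 yz1 a2 a1 b2 b1
  obtain ⟨l, hl, C₂, p₂, sw', ap'⟩ : ∃ l, l ≠ i ∧ G.PairR C l s₃ y₂ := by
    by_cases hji : j = i
    · exact ⟨j', hji ▸ hjj.symm, hj'⟩
    · exact ⟨j, hji, hj⟩
  obtain ⟨C₃, sw₃⟩ := sw'.transfer sw.state (sw.other l hl) (sw.memR hy2 y12.symm)
  have g1 := sw₃.avail (sw.avail h1)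
  have g2 := sw₃.avail (sw.avail h2)
  have g3 := sw₃.avail (sw.avail h3)
  have hz1 := sw.memR hz yz1.symm
  have gz := sw₃.memR hz1 yz2.symm
  have y2p : y₂ ≠ p₁ := sw.ne hy2
  have gp := sw₃.memR sw.mem_new y2p.symm
  have hd : ∀ s, G.Avail C₃ s → s ≠ s₃ → G.adj s z →
      (∀ x ∈ restR C, G.adj s x → x = z ∨ x = y₁ ∨ x = y₂) → G.degL s (restR C₃) ≤ 1 := by
    refine fun s hs hs3 as hN => degL_le_one z fun x hx p => ?_
    have hx' := hx
    rw [sw₃.mem_restR, sw.mem_restR] at hx'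
    rcases hx' with ⟨⟨hx1, hx2⟩ | rfl, hx3⟩ | rfl
    · have := hN x hx1 p
      tauto
    · exact sw₃.state.eq_of_adj hs g3 hs3 hx gz as a3 p ap
    · exact sw₃.state.eq_of_adj hs g3 hs3 hx gz as a3 p ap'
  have d1 := hd s₁ g1 h13 a1 fun x hx p => (n1 x hx p).imp_right Or.inl
  have d2 := hd s₂ g2 h23 a2 fun x hx p => (n2 x hx p).imp_right Or.inr
  exact sw₃.state.no_light_link g1 g2 g3 h12 h13 h23 gz gp sw₃.mem_new (sw.ne hz).symm
    (sw₃.ne hz1).symm (sw₃.ne sw.mem_new) a1 a2 ap ap' (by omega)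

theorem State.no_two_at_star (h : G.State C) {s₁ s₂ s₃ : A} {z y y' : B}
    (h1 : G.Avail C s₁) (h2 : G.Avail C s₂) (h3 : G.Avail C s₃) (h12 : s₁ ≠ s₂) (h13 : s₁ ≠ s₃)
    (h23 : s₂ ≠ s₃) (hz : z ∈ restR C) (hy : y ∈ restR C) (hy' : y' ∈ restR C)
    (yz : y ≠ z) (yz' : y' ≠ z) (yy' : y ≠ y') (a1 : G.adj s₁ z) (a2 : G.adj s₂ z)
    (a3 : G.adj s₃ z) (b : G.adj s₁ y) (b' : G.adj s₁ y') : False := by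
  have n2 : ∀ x ∈ restR C, G.adj s₂ x → x = z := fun x hx p => by
    by_contra hne
    exact h.no_two_private_star h1 h2 h3 h12 h13 h23 hz hy hx yz hne a1 a2 a3 b p
  have n3 : ∀ x ∈ restR C, G.adj s₃ x → x = z := fun x hx p => by
    by_contra hne
    exact h.no_two_private_star h1 h3 h2 h13 h12 h23.symm hz hy hx yz hne a1 a3 a2 b p
  have d2 := degL_le_one z n2
  have d3 := degL_le_one z n3
  exact h.no_light_link h2 h3 h1 h23 h12.symm h13.symm hz hy hy' yz yz' yy' a2 a3 b b' (by omega)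

/-- The two common neighbours are used to close octagons: one of them differs from any given vertex.
-/
theorem degR_add_le_succ_or {y₁ y₂ : B} {X : Finset A} :
    G.degR y₁ X + G.degR y₂ X ≤ #X + 1 ∨ ∃ x x', x ∈ X ∧ x' ∈ X ∧ x ≠ x' ∧
      G.adj x y₁ ∧ G.adj x y₂ ∧ G.adj x' y₁ ∧ G.adj x' y₂ := by
  classical
  have h := degR_add_le (G := G) (y₁ := y₁) (y₂ := y₂) (X := X)
    (X.filter fun x => G.adj x y₁ ∧ G.adj x y₂) (fun x hx p q => by simp [hx, p, q])
  by_cases hc : 1 < #(X.filter fun x => G.adj x y₁ ∧ G.adj x y₂)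
  · obtain ⟨x, hx, x', hx', hne⟩ := one_lt_card.1 hc
    rw [mem_filter] at hx hx'
    exact Or.inr ⟨x, x', hx.1, hx'.1, hne, hx.2.1, hx.2.2, hx'.2.1, hx'.2.2⟩
  · left
    omega

theorem State.no_eight_rest (h : G.State C) {u x v x' : A} {a b c d : B}
    (hu : G.Avail C u) (hx : x ∈ restL C) (hxS : x ∉ G.S) (hv : G.Avail C v) (hx' : x' ∈ restL C)
    (hxS' : x' ∉ G.S) (ha : a ∈ restR C) (hb : b ∈ restR C) (hc : c ∈ restR C) (hd : d ∈ restR C)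
    (huv : u ≠ v) (hxx' : x ≠ x') (hab : a ≠ b) (hac : a ≠ c) (had : a ≠ d)
    (hbc : b ≠ c) (hbd : b ≠ d) (hcd : c ≠ d) (hua : G.adj u a) (hxa : G.adj x a)
    (hxb : G.adj x b) (hvb : G.adj v b) (hvc : G.adj v c) (hxc : G.adj x' c)
    (hxd : G.adj x' d) (hud : G.adj u d) : False :=
  h.no_good (Good.eight hu.2 hxS hv.2 hxS' huv hxx' hab hac had hbc hbd hcd hua hxa hxb hvb hvc
    hxc hxd hud) (by simp [insert_subset_iff, hu.1, hv.1, hx, hx'])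
    (by simp [insert_subset_iff, ha, hb, hc, hd])

theorem State.no_link_two_private (h : G.State C) {s₁ s₂ s₃ : A} {z y₁ y₃ y₃' : B}
    (h1 : G.Avail C s₁) (h2 : G.Avail C s₂) (h3 : G.Avail C s₃) (h12 : s₁ ≠ s₂) (h13 : s₁ ≠ s₃)
    (h23 : s₂ ≠ s₃) (hz : z ∈ restR C) (hy1 : y₁ ∈ restR C) (hy3 : y₃ ∈ restR C)
    (hy3' : y₃' ∈ restR C) (yz1 : y₁ ≠ z) (yz3 : y₃ ≠ z) (yz3' : y₃' ≠ z) (y33 : y₃ ≠ y₃')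
    (a1 : G.adj s₁ z) (a2 : G.adj s₂ z) (b1 : G.adj s₁ y₁) (b3 : G.adj s₃ y₃)
    (b3' : G.adj s₃ y₃') : False := by
  have n2 : ∀ x ∈ restR C, G.adj s₂ x → x = z := fun x hx p => by
    by_contra hne
    exact h.no_two_private h1 h2 h3 h12 h13 h23 hz hy1 hx hy3 yz1 hne yz3 a1 a2 b1 p b3
  have n3 : ¬ G.adj s₃ z := fun p =>
    h.no_two_private_star h1 h3 h2 h13 h12 h23.symm hz hy1 hy3 yz1 yz3 a1 p a2 b1 b3
  have e13 : ∀ x ∈ restR C, G.adj s₁ x → G.adj s₃ x → False := fun x hx p q =>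
    n3 (h.eq_of_link h1 h2 h3 h12 h13 h23 hz a1 a2 hx p q ▸ q)
  -- Otherwise `no_light_link` applies, as `s₂` has degree at most one.
  have d1 : 5 ≤ G.degL s₁ (restR C) := by
    by_contra hd
    have := degL_le_one z n2
    exact h.no_light_link h1 h2 h3 h12 h13 h23 hz hy3 hy3' yz3 yz3' y33 a1 a2 b3 b3' (by omega)
  have dL := degL_add_add_le (G := G) (s₁ := s₁) (s₂ := s₂) (s₃ := s₃) (Y := restR C) {z} 1
    (fun y hy hyT => ind_add_add_le_one
      (fun p q => hyT (by simp [n2 y hy q])) (fun p q => e13 y hy p q)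
      (fun p q => hyT (by simp [n2 y hy p])))
    (fun y hy => ind_add_add_le_two fun p _ q => e13 y hy p q)
  rw [h.card_eq, card_singleton] at dL
  have m2 : ¬ G.adj s₂ y₁ := fun p => yz1 (n2 _ hy1 p)
  have dy1 := degR_add_two_le h2.1 h3.1 h23 m2 (e13 _ hy1 b1)
  have dz := degR_add_one_le h3.1 n3
  -- If `y₁` and `y₃` share too many neighbours, use `y₃'` instead. A common neighbour `t` of `z`
  -- and `y₃'` would close the octagon `s₁ z t y₃' s₃ y₃ x y₁` for some common neighbour `x ≠ t` of
  -- `y₁` and `y₃`.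
  obtain ⟨y, hy, yz, b, hdy⟩ : ∃ y ∈ restR C, y ≠ z ∧ G.adj s₃ y ∧
      G.degR y₁ (restL C) + G.degR z (restL C) + G.degR y (restL C) ≤ 2 * #(restL C) + 1 := by
    rcases degR_add_le_succ_or (G := G) (y₁ := y₁) (y₂ := y₃) (X := restL C) with
      hc | ⟨x, x', hx, hx', hxx', c1, c2, c3, c4⟩
    · exact ⟨y₃, hy3, yz3, b3, by omega⟩
    refine ⟨y₃', hy3', yz3', b3', ?_⟩
    have hd := degR_add_le (G := G) (y₁ := z) (y₂ := y₃') (X := restL C) ∅ (fun t ht p q => by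
      exfalso
      have ht1 : t ≠ s₁ := fun e => e13 _ hy3' (e ▸ q) b3'
      have ht3 : t ≠ s₃ := fun e => n3 (e ▸ p)
      have htS : t ∉ G.S := fun htS =>
        h.no_cherries h3 ⟨ht, htS⟩ h1 ht3.symm h13.symm ht1 hy3' hz yz3' b3' q p a1
      have hxS : ∀ x ∈ restL C, G.adj x y₁ → G.adj x y₃ → x ∉ G.S := fun x hx c1 c2 hxS => by
        have hx1 : x ≠ s₁ := fun e => e13 _ hy3 (e ▸ c2) b3
        have hx2 : x ≠ s₂ := fun e => m2 (e ▸ c1)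
        exact h.no_cherries ⟨hx, hxS⟩ h1 h2 hx1 hx2 h12 hy1 hz yz1 c1 b1 a1 a2
      have y13 : y₁ ≠ y₃ := fun e => e13 _ hy3 (e ▸ b1) b3
      have y13' : y₁ ≠ y₃' := fun e => e13 _ hy3' (e ▸ b1) b3'
      have key : ∀ x ∈ restL C, t ≠ x → G.adj x y₁ → G.adj x y₃ → False :=
        fun x hx htx c1 c2 => h.no_eight_rest h1 ht htS h3 hx (hxS x hx c1 c2) hz hy3' hy3 hy1 h13
          htx yz3'.symm yz3.symm yz1.symm y33.symm y13'.symm y13.symm a1 p q b3' b3 c2 c1 b1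
      by_cases htx : t = x
      · exact key x' hx' (htx ▸ hxx') c3 c4
      · exact key x hx htx c1 c2)
    rw [card_empty] at hd
    omega
  have n1 : ¬ G.adj s₁ y := fun p => e13 _ hy p b
  have y1y : y₁ ≠ y := fun e => n1 (e ▸ b1)
  obtain ⟨i, u, v, c, d, hi, h7⟩ := h.exists_four h1 h3 h2 hy1 hy hz b1 b a2
    n1 n3 m2 (by unfold deg₆; simp only; omega)
  rw [deg₆_swap, hi.deg₆_eq] at h7
  have lab := labeling_three h hi h1 h2 h3 hy1 hz hy h12 h13 h23 yz1 y1y yz.symm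
  -- Exchanging `s₃` for `u` gives three marked vertices at `z`, with `s₁` of large degree.
  have E : ∀ u v, G.IsFour (C i) u v c d → G.adj s₃ c → G.adj s₃ d → G.adj u z → False := by
    intro u v hi p1 p2 p3
    obtain ⟨C', sw⟩ := h.swapL hi h3 p1 p2
    obtain ⟨x, x', hx, hx', hxz, hxz', hxx', ax, ax'⟩ := exists_two_adj z
      (show 2 < G.degL s₁ (restR C) by omega)
    exact sw.state.no_two_at_star (sw.avail h1 h13) (sw.avail h2 h23) sw.avail_new h12 (sw.ne h1)
      (sw.ne h2) (sw.memR hz) (sw.memR hx) (sw.memR hx') hxz hxz' hxx' a1 a2 p3 ax ax'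
  -- First, exchanging `s₂` for `u` shows that `u` sees only `z`. Then exchanging `s₁` for `u`
  -- leaves `s₂` and `u` at `z` with degree at most one each, next to `s₃` with two other
  -- neighbours.
  have F : ∀ u v, G.IsFour (C i) u v c d → G.adj s₁ c → G.adj s₁ d → G.adj s₂ c → G.adj s₂ d →
      G.adj u z → False := by
    intro u v hi p1 p2 p3 p4 p5
    obtain ⟨C', sw⟩ := h.swapL hi h2 p3 p4
    have nu : ∀ x ∈ restR C, G.adj u x → x = z := fun x hx p => by
      by_contra hne
      exact sw.state.no_two_private (sw.avail h1 h12) sw.avail_new (sw.avail h3 h23.symm)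
        (sw.ne h1) h13 (sw.ne h3).symm (sw.memR hz) (sw.memR hy1) (sw.memR hx) (sw.memR hy3) yz1
        hne yz3 a1 p5 b1 p b3
    obtain ⟨C'', sw'⟩ := h.swapL hi h1 p1 p2
    have d2 := degL_le_one z n2
    have du := degL_le_one z nu
    exact sw'.state.no_light_link (sw'.avail h2 h12.symm) sw'.avail_new (sw'.avail h3 h13.symm)
      (sw'.ne h2) h23 (sw'.ne h3).symm (sw'.memR hz) (sw'.memR hy3) (sw'.memR hy3') yz3 yz3' y33
      a2 p5 b3 b3' (by rw [sw'.restR_eq]; omega)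
  have e0 := E u v hi
  have e1 := E v u hi.symmL
  have e2 := F u v hi
  have e3 := F v u hi.symmL
  have b2 := b1
  replace b3 := b
  exact no_dense_fork h7
    (fun x4 x5 x6 => lab.cherries 2 4 1 0 3 3 4 1 0 x4 x5 hi.hvc hi.hvd a2 a1 b1 x6)
    (fun x4 x5 x7 => lab.cherries 2 3 1 0 4 3 4 1 0 x4 x5 hi.huc hi.hud a2 a1 b1 x7)
    (fun x0 x2 x6 x7 => lab.two 0 1 3 4 1 3 0 4 a1 x0 a2 x2 x6 hi.hud x7 hi.hvd)
    (fun x1 x3 x6 x7 => lab.two 0 1 3 4 1 4 0 3 a1 x1 a2 x3 x6 hi.huc x7 hi.hvc)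
    (fun x1 x2 x7 x8 => lab.two 0 4 1 3 0 4 1 3 b1 x1 x7 hi.hvd a2 x2 x8 hi.huc)
    (e0)
    (fun x0 x3 x7 x8 => lab.two 0 4 1 3 0 3 1 4 b1 x0 x7 hi.hvc a2 x3 x8 hi.hud)
    (fun x2 x3 x6 x8 => lab.two 0 3 1 4 0 1 3 4 b1 a1 x6 x8 x2 x3 hi.hvc hi.hvd)
    (fun x0 x3 x6 x9 => lab.two 0 3 1 4 0 3 1 4 b1 x0 x6 hi.huc a2 x3 x9 hi.hvd)
    (fun x1 x2 x6 x9 => lab.two 0 3 1 4 0 4 1 3 b1 x1 x6 hi.hud a2 x2 x9 hi.hvc)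
    (fun x2 x3 x7 x9 => lab.two 0 4 1 3 0 1 3 4 b1 a1 x7 x9 x2 x3 hi.huc hi.hud)
    (e3)
    (fun x0 x5 x6 x9 => lab.cherries 0 3 1 4 2 0 3 1 4 b1 x0 x6 hi.huc a2 x9 hi.hvd x5)
    (fun x1 x4 x6 x9 => lab.cherries 0 3 1 4 2 0 4 1 3 b1 x1 x6 hi.hud a2 x9 hi.hvc x4)
    (fun x0 x2 x10 => lab.cherries 0 1 2 3 4 1 3 2 4 a1 x0 a2 x2 b3 x10 hi.hud hi.hvd)
    (fun x3 x4 x10 => lab.cherries 2 3 0 1 4 2 3 1 4 b3 x4 x10 hi.huc a1 a2 x3 hi.hvd)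
    (fun x5 x7 x10 => lab.cherries 2 3 1 0 4 2 4 1 0 b3 x5 x10 hi.hud a2 a1 b1 x7)
    (fun x4 x7 x10 => lab.cherries 2 3 1 0 4 2 3 1 0 b3 x4 x10 hi.huc a2 a1 b1 x7)
    (fun x0 x1 x8 x10 => lab.cherries 0 4 1 3 2 3 4 1 2 x0 x1 hi.hvc hi.hvd a2 x8 x10 b3)
    (fun x1 x3 x10 => lab.cherries 0 1 2 3 4 1 4 2 3 a1 x1 a2 x3 b3 x10 hi.huc hi.hvc)
    (fun x1 x3 x11 => lab.cherries 0 1 2 4 3 1 4 2 3 a1 x1 a2 x3 b3 x11 hi.hvc hi.huc)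
    (fun x4 x6 x11 => lab.cherries 2 4 1 0 3 2 3 1 0 b3 x4 x11 hi.hvc a2 a1 b1 x6)
    (fun x2 x5 x11 => lab.cherries 2 4 0 1 3 2 4 1 3 b3 x5 x11 hi.hvd a1 a2 x2 hi.huc)
    (fun x0 x1 x9 x11 => lab.cherries 0 3 1 4 2 3 4 1 2 x0 x1 hi.huc hi.hud a2 x9 x11 b3)
    (fun x5 x6 x8 x11 => lab.two 0 3 2 4 0 1 2 4 b1 a1 x6 x8 b3 x5 x11 hi.hvd)
    (fun x0 x2 x11 => lab.cherries 0 1 2 4 3 1 3 2 4 a1 x0 a2 x2 b3 x11 hi.hvd hi.hud)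
    (fun x2 x6 x8 x11 => lab.cherries 0 3 1 4 2 0 1 3 2 b1 a1 x6 x8 x2 hi.hvc x11 b3)
    (fun x3 x6 x8 x11 => lab.cherries 0 3 1 4 2 0 1 4 2 b1 a1 x6 x8 x3 hi.hvd x11 b3)
    (fun x0 x6 x9 x11 => lab.cherries 0 3 1 4 2 0 3 1 2 b1 x0 x6 hi.huc a2 x9 x11 b3)
    (fun x1 x6 x9 x11 => lab.cherries 0 3 1 4 2 0 4 1 2 b1 x1 x6 hi.hud a2 x9 x11 b3)
    (fun x0 x5 x8 x11 => lab.two 0 3 2 4 1 3 2 4 a1 x0 x8 hi.huc b3 x5 x11 hi.hvd)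
    (fun x1 x4 x8 x11 => lab.two 0 3 2 4 1 4 2 3 a1 x1 x8 hi.hud b3 x4 x11 hi.hvc)

/-- By the previous exclusions `s₃` sees only `y₃`. An exchange for `s₃` and `y₁` yields a
five-vertex path, or gives `s₃` a second neighbour. In the latter case either `s₁` keeps a private
neighbour, or its degree is small enough for `no_light_link`. -/
theorem State.no_link_private (h : G.State C) {s₁ s₂ s₃ : A} {z y₁ y₃ : B}
    (h1 : G.Avail C s₁) (h2 : G.Avail C s₂) (h3 : G.Avail C s₃) (h12 : s₁ ≠ s₂) (h13 : s₁ ≠ s₃)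
    (h23 : s₂ ≠ s₃) (hz : z ∈ restR C) (hy1 : y₁ ∈ restR C) (hy3 : y₃ ∈ restR C)
    (yz1 : y₁ ≠ z) (yz3 : y₃ ≠ z)
    (a1 : G.adj s₁ z) (a2 : G.adj s₂ z) (b1 : G.adj s₁ y₁) (b3 : G.adj s₃ y₃) : False := by
  have n2 : ∀ x ∈ restR C, G.adj s₂ x → x = z := fun x hx p => by
    by_contra hne
    exact h.no_two_private h1 h2 h3 h12 h13 h23 hz hy1 hx hy3 yz1 hne yz3 a1 a2 b1 p b3
  have n3 : ¬ G.adj s₃ z := fun p =>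
    h.no_two_private_star h1 h3 h2 h13 h12 h23.symm hz hy1 hy3 yz1 yz3 a1 p a2 b1 b3
  have n3' : ∀ x ∈ restR C, G.adj s₃ x → x = y₃ := fun x hx p => by
    by_contra hne
    have hxz : x ≠ z := fun e => n3 (e ▸ p)
    exact h.no_link_two_private h1 h2 h3 h12 h13 h23 hz hy1 hx hy3 yz1 hxz yz3 hne a1 a2 b1 p b3
  have y13 : y₁ ≠ y₃ := fun e => yz3 (h.eq_of_link h1 h2 h3 h12 h13 h23 hz a1 a2 hy3 (e ▸ b1) b3)
  have m3 : ¬ G.adj s₃ y₁ := fun p => y13 (n3' _ hy1 p)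
  have m2 : ¬ G.adj s₂ y₁ := fun p => yz1 (n2 _ hy1 p)
  have d1 := degR_add_two_le h2.1 h3.1 h23 m2 m3
  have d3 := degL_le_one y₃ n3'
  obtain ⟨i, ⟨C', w, sw, aw⟩ | ⟨C', p, sw, ap⟩⟩ := h.exists_pair h3 hy1 m3 (by omega)
  · exact sw.state.no_cherries sw.avail_new (sw.avail h1 h13) (sw.avail h2 h23) (sw.ne h1).symm
      (sw.ne h2).symm h12 (sw.memR hy1) (sw.memR hz) yz1 aw b1 a1 a2
  · have g1 := sw.avail h1
    have g2 := sw.avail h2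
    have g3 := sw.avail h3
    have hz' := sw.memR hz yz1.symm
    have hy3' := sw.memR hy3 y13.symm
    by_cases hex : ∃ x ∈ restR C, G.adj s₁ x ∧ x ≠ z ∧ x ≠ y₁
    · obtain ⟨x, hx, ax, hxz, hxy⟩ := hex
      exact sw.state.no_link_two_private g1 g2 g3 h12 h13 h23 hz' (sw.memR hx hxy) hy3' sw.mem_new
        hxz yz3 (sw.ne hz).symm (sw.ne hy3) a1 a2 ax b3 ap
    · have k1 : G.degL s₁ (restR C') ≤ 2 := (degL_le_card {z, p} fun x hx q => by
        by_contra hne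
        simp only [mem_insert, mem_singleton, not_or] at hne
        obtain ⟨hx1, hx2⟩ := ((sw.mem_restR x).1 hx).resolve_right hne.2
        exact hex ⟨x, hx1, q, hne.1, hx2⟩).trans card_le_two
      have k2 : G.degL s₂ (restR C') ≤ 2 := (degL_le_card {z, p} fun x hx q => by
        by_contra hne
        simp only [mem_insert, mem_singleton, not_or] at hne
        exact hne.1 (n2 x (((sw.mem_restR x).1 hx).resolve_right hne.2).1 q)).trans card_le_two
      exact sw.state.no_light_link g1 g2 g3 h12 h13 h23 hz' hy3' sw.mem_new yz3 (sw.ne hz).symm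
        (sw.ne hy3) a1 a2 b3 ap (by omega)

theorem State.no_link_adj (h : G.State C) {s₁ s₂ s₃ : A} {z y₃ : B}
    (h1 : G.Avail C s₁) (h2 : G.Avail C s₂) (h3 : G.Avail C s₃) (h12 : s₁ ≠ s₂) (h13 : s₁ ≠ s₃)
    (h23 : s₂ ≠ s₃) (hz : z ∈ restR C) (hy3 : y₃ ∈ restR C) (yz3 : y₃ ≠ z)
    (a1 : G.adj s₁ z) (a2 : G.adj s₂ z) (b3 : G.adj s₃ y₃) : False := by
  have n1 : ∀ x ∈ restR C, G.adj s₁ x → x = z := fun x hx p => by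
    by_contra hne
    exact h.no_link_private h1 h2 h3 h12 h13 h23 hz hx hy3 hne yz3 a1 a2 p b3
  have n2 : ∀ x ∈ restR C, G.adj s₂ x → x = z := fun x hx p => by
    by_contra hne
    exact h.no_link_private h2 h1 h3 h12.symm h23 h13 hz hx hy3 hne yz3 a2 a1 p b3
  obtain ⟨y₀, hy0, y0z, y03⟩ := h.exists_restR z y₃
  have m1 : ¬ G.adj s₁ y₀ := fun p => y0z (n1 _ hy0 p)
  have m2 : ¬ G.adj s₂ y₀ := fun p => y0z (n2 _ hy0 p)
  have d0 := degR_add_two_le h1.1 h2.1 h12 m1 m2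
  have d1 := degL_le_one z n1
  have d2 := degL_le_one z n2
  have o1 := h.ore_sum h1.2 m1
  have o2 := h.ore_sum h2.2 m2
  simp only [sum_add_distrib] at o1 o2
  -- Such an exchange would give `s₁` a private neighbour, the case just excluded.
  have r1 : ∀ i, ¬ G.PairR C i s₁ y₀ := fun i ⟨C', p, sw, ap⟩ =>
    sw.state.no_link_private (sw.avail h1) (sw.avail h2) (sw.avail h3) h12 h13 h23
      (sw.memR hz y0z.symm) sw.mem_new (sw.memR hy3 y03.symm) (sw.ne hz).symm yz3 a1 a2 ap b3
  have r2 : ∀ i, ¬ G.PairR C i s₂ y₀ := fun i ⟨C', p, sw, ap⟩ =>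
    sw.state.no_link_private (sw.avail h2) (sw.avail h1) (sw.avail h3) h12.symm h23 h13
      (sw.memR hz y0z.symm) sw.mem_new (sw.memR hy3 y03.symm) (sw.ne hz).symm yz3 a2 a1 ap b3
  obtain ⟨i, -, hi⟩ : ∃ i ∈ univ, 2 * #(C i).1 < G.degL s₁ (C i).2 + G.degL s₂ (C i).2 +
      2 * G.degR y₀ (C i).1 := by
    refine exists_lt_of_sum_lt ?_
    simp only [sum_add_distrib, ← mul_sum]
    omega
  rcases h.four_or_long i with ⟨u, v, c, d, h4⟩ | h4
  · rw [h4.card, h4.eq₁, h4.eq₂] at hi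
    simp only [degL_pair h4.hcd, degR_pair h4.huv] at hi
    have i1 := ind_le (G.adj s₁ c)
    have i2 := ind_le (G.adj s₁ d)
    have i3 := ind_le (G.adj s₂ c)
    have i4 := ind_le (G.adj s₂ d)
    by_cases huv : G.adj u y₀ ∧ G.adj v y₀
    · obtain ⟨C₁, sw⟩ := h.swapR h4 hy0 huv.1 huv.2
      obtain ⟨C₂, sw'⟩ := h.swapR h4.symmR hy0 huv.1 huv.2
      have k1 : ¬ G.adj s₁ c := fun p => r1 i ⟨_, _, sw, p⟩
      have k2 : ¬ G.adj s₁ d := fun p => r1 i ⟨_, _, sw', p⟩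
      have k3 : ¬ G.adj s₂ c := fun p => r2 i ⟨_, _, sw, p⟩
      have k4 : ¬ G.adj s₂ d := fun p => r2 i ⟨_, _, sw', p⟩
      have := ind_le (G.adj u y₀)
      have := ind_le (G.adj v y₀)
      simp only [ind_not k1, ind_not k2, ind_not k3, ind_not k4] at hi
      omega
    have i5 : ind (G.adj u y₀) + ind (G.adj v y₀) ≤ 1 := ind_add_le fun p q => huv ⟨p, q⟩
    -- The four-cycle `s₁ c s₂ z` replaces the old one and releases `u, v, d`. Now `u` and `v` share
    -- `d`, and `u` also sees `y₀`.
    have key : ∀ u v c d, G.IsFour (C i) u v c d → G.adj u y₀ → G.adj s₁ c → G.adj s₂ c →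
        False := by
      intro u v c d h4 p0 p1 p2
      have hu : u ∈ (C i).1 := by simp [h4.eq₁]
      have hv : v ∈ (C i).1 := by simp [h4.eq₁]
      have hc : c ∈ (C i).2 := by simp [h4.eq₂]
      have hd : d ∈ (C i).2 := by simp [h4.eq₂]
      have hcz : c ≠ z := (h.ne_of_mem' hz hc).symm
      have h' := h.update (i := i) (Good.four h1.2 h2.2 h12 hcz p1 a1 p2 a2)
        (by simp [insert_subset_iff, h1.1, h2.1]) (by simp [insert_subset_iff, hc, hz])
        (by rw [h4.card]; exact card_le_two)
      refine h'.no_link_private (s₁ := u) (s₂ := v) (s₃ := s₃) (z := d) (y₁ := y₀) (y₃ := y₃)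
        ⟨?_, h4.hu⟩ ⟨?_, h4.hv⟩ ⟨?_, h3.2⟩ h4.huv (h.ne_of_mem h3.1 hu).symm
        (h.ne_of_mem h3.1 hv).symm ?_ ?_ ?_ (h.ne_of_mem' hy0 hd) (h.ne_of_mem' hy3 hd) h4.hud
        h4.hvd p0 b3
      · rw [mem_restL_update h.toIsPacking]
        exact ⟨Or.inr hu, by simp [(h.ne_of_mem h1.1 hu).symm, (h.ne_of_mem h2.1 hu).symm]⟩
      · rw [mem_restL_update h.toIsPacking]
        exact ⟨Or.inr hv, by simp [(h.ne_of_mem h1.1 hv).symm, (h.ne_of_mem h2.1 hv).symm]⟩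
      · rw [mem_restL_update h.toIsPacking]
        exact ⟨Or.inl h3.1, by simp [h13.symm, h23.symm]⟩
      · rw [mem_restR_update h.toIsPacking]
        exact ⟨Or.inr hd, by simp [h4.hcd.symm, (h.ne_of_mem' hz hd).symm]⟩
      · rw [mem_restR_update h.toIsPacking]
        exact ⟨Or.inl hy0, by simp [h.ne_of_mem' hy0 hc, y0z]⟩
      · rw [mem_restR_update h.toIsPacking]
        exact ⟨Or.inl hy3, by simp [h.ne_of_mem' hy3 hc, yz3]⟩
    have key' : ∀ u v, G.IsFour (C i) u v c d → G.adj u y₀ → False := by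
      intro u v h4 p0
      by_cases hc : G.adj s₁ c ∧ G.adj s₂ c
      · exact key u v c d h4 p0 hc.1 hc.2
      by_cases hd : G.adj s₁ d ∧ G.adj s₂ d
      · exact key u v d c h4.symmR p0 hd.1 hd.2
      have := ind_add_le fun p q => hc ⟨p, q⟩
      have := ind_add_le fun p q => hd ⟨p, q⟩
      omega
    by_cases hu : G.adj u y₀
    · exact key' u v h4 hu
    by_cases hv : G.adj v y₀
    · exact key' v u h4.symmL hv
    have := ind_not hu
    have := ind_not hv
    omega
  · have p1 := h.pair_long h1 hy0 (h.good i) h4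
    have p2 := h.pair_long h2 hy0 (h.good i) h4
    have q1 := p1.resolve_right fun h' => r1 i h'.2.2.1
    have q2 := p2.resolve_right fun h' => r2 i h'.2.2.1
    omega

/-- All three vertices see only `z`, so `s₁` admits an exchange. It creates an edge away from `z` at
the third marked vertex, while `s₂` and `s₃` still share `z`. -/
theorem State.no_star (h : G.State C) {s₁ s₂ s₃ : A} {z : B}
    (h1 : G.Avail C s₁) (h2 : G.Avail C s₂) (h3 : G.Avail C s₃) (h12 : s₁ ≠ s₂) (h13 : s₁ ≠ s₃)
    (h23 : s₂ ≠ s₃) (hz : z ∈ restR C) (a1 : G.adj s₁ z) (a2 : G.adj s₂ z) (a3 : G.adj s₃ z) :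
    False := by
  have n1 : ∀ x ∈ restR C, G.adj s₁ x → x = z := fun x hx p => by
    by_contra hne
    exact h.no_link_adj h2 h3 h1 h23 h12.symm h13.symm hz hx hne a2 a3 p
  have n2 : ∀ x ∈ restR C, G.adj s₂ x → x = z := fun x hx p => by
    by_contra hne
    exact h.no_link_adj h1 h3 h2 h13 h12 h23.symm hz hx hne a1 a3 p
  obtain ⟨y₀, hy0, y0z, -⟩ := h.exists_restR z z
  have m1 : ¬ G.adj s₁ y₀ := fun p => y0z (n1 _ hy0 p)
  have m2 : ¬ G.adj s₂ y₀ := fun p => y0z (n2 _ hy0 p)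
  have d0 := degR_add_two_le h1.1 h2.1 h12 m1 m2
  have d1 := degL_le_one z n1
  obtain ⟨i, ⟨C', w, sw, aw⟩ | ⟨C', p, sw, ap⟩⟩ := h.exists_pair h1 hy0 m1 (by omega)
  · exact sw.state.no_link_adj (sw.avail h2 h12.symm) (sw.avail h3 h13.symm) sw.avail_new h23
      (sw.ne h2) (sw.ne h3) (sw.memR hz) (sw.memR hy0) y0z a2 a3 aw
  · exact sw.state.no_link_adj (sw.avail h2) (sw.avail h3) (sw.avail h1) h23 h12.symm h13.symm
      (sw.memR hz y0z.symm) sw.mem_new (sw.ne hz).symm a2 a3 ap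

/-- Two marked vertices outside the packing have no common neighbour outside the packing. -/
theorem State.no_link (h : G.State C) {s₁ s₂ : A} {z : B}
    (h1 : G.Avail C s₁) (h2 : G.Avail C s₂) (h12 : s₁ ≠ s₂) (hz : z ∈ restR C)
    (a1 : G.adj s₁ z) (a2 : G.adj s₂ z) : False := by
  obtain ⟨s₃, h3, h13, h23⟩ := h.exists_avail s₁ s₂
  -- A third uncovered marked vertex has no uncovered neighbour at all, but an exchange would
  -- provide an edge away from `z`.
  have n3 : ∀ x ∈ restR C, ¬ G.adj s₃ x := fun x hx p => by
    by_cases hxz : x = z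
    · exact h.no_star h1 h2 h3 h12 h13.symm h23.symm hz a1 a2 (hxz ▸ p)
    · exact h.no_link_adj h1 h2 h3 h12 h13.symm h23.symm hz hx hxz a1 a2 p
  obtain ⟨y, hy, yz, -⟩ := h.exists_restR z z
  have d0 := degR_add_one_le h3.1 (n3 y hy)
  have d1 := degL_le_one z fun x hx p => absurd p (n3 x hx)
  obtain ⟨i, ⟨C', w, sw, aw⟩ | ⟨C', p, sw, ap⟩⟩ := h.exists_pair h3 hy (n3 y hy) (by omega)
  · exact sw.state.no_link_adj (sw.avail h1 h13.symm) (sw.avail h2 h23.symm) sw.avail_new h12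
      (sw.ne h1) (sw.ne h2) (sw.memR hz) (sw.memR hy) yz a1 a2 aw
  · exact sw.state.no_link_adj (sw.avail h1) (sw.avail h2) (sw.avail h3) h12 h13.symm h23.symm
      (sw.memR hz yz.symm) sw.mem_new (sw.ne hz).symm a1 a2 ap

/-! ### Excluding three disjoint edges -/

theorem Labeling.link (h : G.Labeling C i f g) (p q a b : Fin 5) (r t y : Fin k)
    (a1 : G.adj (f p) (g r)) (a2 : G.adj (f p) (g t)) (a3 : G.adj (f q) (g r))
    (a4 : G.adj (f q) (g t)) (b1 : G.adj (f a) (g y)) (b2 : G.adj (f b) (g y))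
    (hd : [p, q, a, b].Nodup := by decide) (hd' : [r, t, y].Nodup := by decide) : False := by
  simp only [List.nodup_cons, List.mem_cons, List.not_mem_nil, or_false, not_or] at hd hd'
  obtain ⟨⟨pq, pa, pb⟩, ⟨qa, qb⟩, ab, -⟩ := hd
  obtain ⟨⟨rt, r1⟩, t1, -⟩ := hd'
  obtain ⟨C', h', hf, hg⟩ := h.swap pq rt a1 a2 a3 a4
  exact h'.no_link (hf a (Ne.symm pa) (Ne.symm qa)) (hf b (Ne.symm pb) (Ne.symm qb))
    (h.injL.ne ab) (hg _ (Ne.symm r1) (Ne.symm t1)) b1 b2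

/-- With fewer uncovered edges some four-cycle would be dense, and the finite check would uncover a
common neighbour of two marked vertices. The remaining lemmas bound the same quantity from above. -/
theorem State.lt_of_matching (h : G.State C) {s₁ s₂ s₃ : A} {y₁ y₂ y₃ : B}
    (h1 : G.Avail C s₁) (h2 : G.Avail C s₂) (h3 : G.Avail C s₃) (h12 : s₁ ≠ s₂) (h13 : s₁ ≠ s₃)
    (h23 : s₂ ≠ s₃) (hy1 : y₁ ∈ restR C) (hy2 : y₂ ∈ restR C) (hy3 : y₃ ∈ restR C)
    (a1 : G.adj s₁ y₁) (a2 : G.adj s₂ y₂) (a3 : G.adj s₃ y₃) :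
    3 * #(restL C) + 2 < G.deg₆ (restL C, restR C) s₁ s₂ s₃ y₁ y₂ y₃ := by
  by_contra! hd
  have n1 : ¬ G.adj s₁ y₂ := fun p => h.no_link h1 h2 h12 hy2 p a2
  have n2 : ¬ G.adj s₂ y₃ := fun p => h.no_link h2 h3 h23 hy3 p a3
  have n3 : ¬ G.adj s₃ y₁ := fun p => h.no_link h1 h3 h13 hy1 a1 p
  obtain ⟨i, u, v, c, d, hi, h7⟩ := h.exists_four h1 h2 h3 hy1 hy2 hy3 a1 a2 a3 n1 n2 n3 hd
  rw [hi.deg₆_eq] at h7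
  have lab := labeling_three h hi h1 h2 h3 hy1 hy2 hy3 h12 h13 h23 (fun e => n1 (e ▸ a1))
    (fun e => n3 (e ▸ a3)) (fun e => n2 (e ▸ a2))
  exact no_dense_matching h7
    (fun x1 x4 x6 => lab.link 0 3 2 4 0 4 3 a1 x1 x6 hi.hud x4 hi.hvc)
    (fun x2 x3 x6 => lab.link 1 4 0 3 3 4 0 x2 x3 hi.hvc hi.hvd a1 x6)
    (fun x0 x3 x7 => lab.link 0 4 1 3 0 3 4 a1 x0 x7 hi.hvc x3 hi.hud)
    (fun x0 x5 x7 => lab.link 0 4 2 3 0 3 4 a1 x0 x7 hi.hvc x5 hi.hud)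
    (fun x1 x7 x8 => lab.link 0 4 1 3 0 4 1 a1 x1 x7 hi.hvd a2 x8)
    (fun x4 x5 x8 => lab.link 2 4 1 3 3 4 1 x4 x5 hi.hvc hi.hvd a2 x8)
    (fun x0 x6 x9 => lab.link 0 3 1 4 0 3 1 a1 x0 x6 hi.huc a2 x9)
    (fun x2 x5 x9 => lab.link 1 4 2 3 1 3 4 a2 x2 x9 hi.hvc x5 hi.hud)
    (fun x0 x1 x9 => lab.link 0 3 1 4 3 4 1 x0 x1 hi.huc hi.hud a2 x9)
    (fun x1 x2 x6 x9 => lab.two 0 3 1 4 0 4 1 3 a1 x1 x6 hi.hud a2 x2 x9 hi.hvc)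
    (fun x4 x7 x10 => lab.link 2 3 0 4 2 3 0 a3 x4 x10 hi.huc a1 x7)
    (fun x0 x1 x10 => lab.link 0 4 2 3 3 4 2 x0 x1 hi.hvc hi.hvd a3 x10)
    (fun x3 x9 x10 => lab.link 1 4 2 3 1 4 2 a2 x3 x9 hi.hvd a3 x10)
    (fun x2 x3 x11 => lab.link 1 3 2 4 3 4 2 x2 x3 hi.huc hi.hud a3 x11)
    (fun x5 x6 x11 => lab.link 2 4 0 3 2 4 0 a3 x5 x11 hi.hvd a1 x6)
    (fun x2 x8 x11 => lab.link 1 3 2 4 1 3 2 a2 x2 x8 hi.huc a3 x11)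
    (fun x3 x4 x11 => lab.link 2 4 1 3 2 3 4 a3 x4 x11 hi.hvc x3 hi.hud)

theorem State.degL_le_of_matching (h : G.State C) {s₁ s₂ s₃ : A} (h1 : G.Avail C s₁)
    (h2 : G.Avail C s₂) (h3 : G.Avail C s₃) (h12 : s₁ ≠ s₂) (h13 : s₁ ≠ s₃) (h23 : s₂ ≠ s₃) :
    G.degL s₁ (restR C) + G.degL s₂ (restR C) + G.degL s₃ (restR C) ≤ #(restL C) := by
  have := degL_add_add_le (G := G) (s₁ := s₁) (s₂ := s₂) (s₃ := s₃) (Y := restR C) ∅ 0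
    (fun y hy _ => ind_add_add_le_one (h.no_link h1 h2 h12 hy) (h.no_link h1 h3 h13 hy)
      (h.no_link h2 h3 h23 hy))
    (fun y hy => ind_add_add_le_one (h.no_link h1 h2 h12 hy) (h.no_link h1 h3 h13 hy)
      (h.no_link h2 h3 h23 hy))
  rw [h.card_eq] at this
  simpa using this

/-- By the lower bound for matchings, `y₁, y₂` have two common neighbours, and so have `y₁', y₂'`.
All are unmarked, as marked vertices share no neighbour, so two distinct ones close an octagon
through `s₁` and `s₂`. -/
theorem State.no_two_double (h : G.State C) {s₁ s₂ s₃ : A} {y₁ y₁' y₂ y₂' y₃ : B}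
    (h1 : G.Avail C s₁) (h2 : G.Avail C s₂) (h3 : G.Avail C s₃) (h12 : s₁ ≠ s₂) (h13 : s₁ ≠ s₃)
    (h23 : s₂ ≠ s₃) (hy1 : y₁ ∈ restR C) (hy1' : y₁' ∈ restR C) (hy2 : y₂ ∈ restR C)
    (hy2' : y₂' ∈ restR C) (hy3 : y₃ ∈ restR C) (y11 : y₁ ≠ y₁') (y22 : y₂ ≠ y₂')
    (a1 : G.adj s₁ y₁) (a1' : G.adj s₁ y₁') (a2 : G.adj s₂ y₂) (a2' : G.adj s₂ y₂')
    (a3 : G.adj s₃ y₃) : False := by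
  have ne12 : ∀ y y', y ∈ restR C → G.adj s₁ y → G.adj s₂ y' → y ≠ y' := fun y y' hy p q e =>
    h.no_link h1 h2 h12 hy p (e ▸ q)
  have dL := h.degL_le_of_matching h1 h2 h3 h12 h13 h23
  have d3 := degR_add_two_le h1.1 h2.1 h12 (fun p => h.no_link h1 h3 h13 hy3 p a3)
    (fun p => h.no_link h2 h3 h23 hy3 p a3)
  have l := fun y y' hy hy' p q => h.lt_of_matching (y₁ := y) (y₂ := y') h1 h2 h3 h12 h13 h23 hy
    hy' hy3 p q a3
  simp only [deg₆] at l
  have hS : ∀ y y' x, y ∈ restR C → y' ∈ restR C → x ∈ restL C → G.adj s₁ y → G.adj s₂ y' →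
      G.adj x y → G.adj x y' → x ∉ G.S := by
    intro y y' x hy hy' hx p p' q q' hxS
    have hx1 : x ≠ s₁ := fun e => h.no_link h1 h2 h12 hy' (e ▸ q') p'
    exact h.no_link ⟨hx, hxS⟩ h1 hx1 hy q p
  rcases degR_add_le_succ_or (G := G) (y₁ := y₁) (y₂ := y₂) (X := restL C) with
    hc | ⟨x, -, hx, -, -, c1, c2, -, -⟩
  · have := l _ _ hy1 hy2 a1 a2
    omega
  rcases degR_add_le_succ_or (G := G) (y₁ := y₁') (y₂ := y₂') (X := restL C) with
    hc | ⟨t, t', ht, ht', htt, e1, e2, e3, e4⟩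
  · have := l _ _ hy1' hy2' a1' a2'
    omega
  have key : ∀ t ∈ restL C, x ≠ t → G.adj t y₁' → G.adj t y₂' → False := fun t ht hxt p q =>
    h.no_eight_rest h1 hx (hS _ _ x hy1 hy2 hx a1 a2 c1 c2) h2 ht
      (hS _ _ t hy1' hy2' ht a1' a2' p q) hy1 hy2 hy2' hy1' h12 hxt (ne12 _ _ hy1 a1 a2)
      (ne12 _ _ hy1 a1 a2') y11 y22 (ne12 _ _ hy1' a1' a2).symm (ne12 _ _ hy1' a1' a2').symm a1
      c1 c2 a2 a2' q p a1'
  by_cases hxt : x = t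
  · exact key t' ht' (hxt ▸ htt) e3 e4
  · exact key t ht hxt e1 e2

/-- If `s₁` has two neighbours besides `y₁`, then `s₂` sees only `y₂`. An exchange for `s₂` and `y₁`
then produces a common neighbour or a second neighbour of `s₂`. -/
theorem State.no_large_degree (h : G.State C) {s₁ s₂ s₃ : A} {y₁ y₂ y₃ : B}
    (h1 : G.Avail C s₁) (h2 : G.Avail C s₂) (h3 : G.Avail C s₃) (h12 : s₁ ≠ s₂) (h13 : s₁ ≠ s₃)
    (h23 : s₂ ≠ s₃) (hy1 : y₁ ∈ restR C) (hy2 : y₂ ∈ restR C) (hy3 : y₃ ∈ restR C)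
    (a1 : G.adj s₁ y₁) (a2 : G.adj s₂ y₂) (a3 : G.adj s₃ y₃) :
    G.degL s₁ (restR C) ≤ 3 := by
  by_contra! hd
  have m2 : ¬ G.adj s₂ y₁ := fun p => h.no_link h1 h2 h12 hy1 a1 p
  have m3 : ¬ G.adj s₃ y₁ := fun p => h.no_link h1 h3 h13 hy1 a1 p
  obtain ⟨x, x', hx, hx', hxz, hxz', hxx', ax, ax'⟩ := exists_two_adj y₁
    (show 2 < G.degL s₁ (restR C) by omega)
  have n2 : ∀ y ∈ restR C, G.adj s₂ y → y = y₂ := fun y hy p => by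
    by_contra hne
    exact h.no_two_double h1 h2 h3 h12 h13 h23 hx hx' hy hy2 hy3 hxx' hne ax ax' p a2 a3
  have d2 := degL_le_one y₂ n2
  have d1 := degR_add_two_le h2.1 h3.1 h23 m2 m3
  obtain ⟨i, ⟨C', w, sw, aw⟩ | ⟨C', p, sw, ap⟩⟩ := h.exists_pair h2 hy1 m2 (by omega)
  · exact sw.state.no_link (sw.avail h1 h12) sw.avail_new (sw.ne h1) (sw.memR hy1) a1 aw
  · exact sw.state.no_two_double (sw.avail h1) (sw.avail h2) (sw.avail h3) h12 h13 h23
      (sw.memR hx hxz) (sw.memR hx' hxz') sw.mem_new (sw.memR hy2 fun e => m2 (e ▸ a2))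
      (sw.memR hy3 fun e => m3 (e ▸ a3)) hxx' (sw.ne hy2).symm ax ax' ap a2 a3

/-- Three marked vertices outside the packing cannot be matched outside the packing. -/
theorem State.no_matching (h : G.State C) {s₁ s₂ s₃ : A} {y₁ y₂ y₃ : B}
    (h1 : G.Avail C s₁) (h2 : G.Avail C s₂) (h3 : G.Avail C s₃) (h12 : s₁ ≠ s₂) (h13 : s₁ ≠ s₃)
    (h23 : s₂ ≠ s₃) (hy1 : y₁ ∈ restR C) (hy2 : y₂ ∈ restR C) (hy3 : y₃ ∈ restR C)
    (a1 : G.adj s₁ y₁) (a2 : G.adj s₂ y₂) (a3 : G.adj s₃ y₃) : False := by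
  have l := h.lt_of_matching h1 h2 h3 h12 h13 h23 hy1 hy2 hy3 a1 a2 a3
  have e1 := degR_add_two_le h2.1 h3.1 h23 (fun p => h.no_link h1 h2 h12 hy1 a1 p)
    (fun p => h.no_link h1 h3 h13 hy1 a1 p)
  have e2 := degR_add_two_le h1.1 h3.1 h13 (fun p => h.no_link h1 h2 h12 hy2 p a2)
    (fun p => h.no_link h2 h3 h23 hy2 a2 p)
  have e3 := degR_add_two_le h1.1 h2.1 h12 (fun p => h.no_link h1 h3 h13 hy3 p a3)
    (fun p => h.no_link h2 h3 h23 hy3 p a3)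
  have two : ∀ s t r x, G.Avail C s → G.Avail C t → G.Avail C r → s ≠ t → s ≠ r → t ≠ r →
      x ∈ restR C → G.adj r x → G.degL s (restR C) ≤ 1 ∨ G.degL t (restR C) ≤ 1 := by
    intro s t r x hs ht hr hst hsr htr hx ax
    by_contra! hcon
    obtain ⟨y, hy, ay, -⟩ := exists_adj_of_card_lt ∅ (show _ < G.degL s (restR C) by simp; omega)
    obtain ⟨y', hy', ay', hyy⟩ := exists_adj_of_card_lt {y} (by rw [card_singleton]; exact hcon.1)
    obtain ⟨w, hw, aw, -⟩ := exists_adj_of_card_lt ∅ (show _ < G.degL t (restR C) by simp; omega)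
    obtain ⟨w', hw', aw', hww⟩ := exists_adj_of_card_lt {w} (by rw [card_singleton]; exact hcon.2)
    simp only [mem_singleton] at hyy hww
    exact h.no_two_double hs ht hr hst hsr htr hy hy' hw hw' hx (Ne.symm hyy) (Ne.symm hww) ay ay'
      aw aw' ax
  have l1 := h.no_large_degree h1 h2 h3 h12 h13 h23 hy1 hy2 hy3 a1 a2 a3
  have l2 := h.no_large_degree h2 h1 h3 h12.symm h23 h13 hy2 hy1 hy3 a2 a1 a3
  have l3 := h.no_large_degree h3 h1 h2 h13.symm h23.symm h12 hy3 hy1 hy2 a3 a1 a2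
  have t12 := two s₁ s₂ s₃ y₃ h1 h2 h3 h12 h13 h23 hy3 a3
  have t13 := two s₁ s₃ s₂ y₂ h1 h3 h2 h13 h12 h23.symm hy2 a2
  -- Of any two marked vertices, one has degree at most one, and all degrees are at most three. Each
  -- `yⱼ` misses two of the three marked vertices, so the total falls below the lower bound `l`.
  simp only [deg₆] at l
  omega

/-- If `s` has no uncovered neighbour, the degree condition provides an exchange that creates an
edge. It costs at most `s` and `y`, so edges built earlier elsewhere survive. -/
theorem State.exists_adj_step (h : G.State C) {s : A} {y : B} (hs : G.Avail C s)
    (hy : y ∈ restR C) : ∃ (C' : Fin m → Finset A × Finset B) (s' : A) (y' : B), G.State C' ∧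
      G.Avail C' s' ∧ y' ∈ restR C' ∧ G.adj s' y' ∧
      (∀ t, G.Avail C t → t ≠ s → G.Avail C' t ∧ t ≠ s') ∧
      ∀ x ∈ restR C, x ≠ y → x ∈ restR C' := by
  by_cases hex : ∃ x ∈ restR C, G.adj s x
  · obtain ⟨x, hx, ax⟩ := hex
    exact ⟨C, s, x, h, hs, hx, ax, fun t ht hts => ⟨ht, hts⟩, fun x hx _ => hx⟩
  have hn : ∀ x ∈ restR C, ¬ G.adj s x := fun x hx p => hex ⟨x, hx, p⟩
  have d0 := degR_add_one_le hs.1 (hn y hy)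
  have d1 := degL_le_one y fun x hx p => absurd p (hn x hx)
  obtain ⟨i, ⟨C', w, sw, aw⟩ | ⟨C', p, sw, ap⟩⟩ := h.exists_pair hs hy (hn y hy) (by omega)
  · exact ⟨C', w, y, sw.state, sw.avail_new, sw.memR hy, aw,
      fun t ht hts => ⟨sw.avail ht hts, sw.ne ht⟩, fun x hx _ => sw.memR hx⟩
  · exact ⟨C', s, p, sw.state, sw.avail hs, sw.mem_new, ap,
      fun t ht hts => ⟨sw.avail ht, hts⟩, fun x hx hxy => sw.memR hx hxy⟩

/-- A packing as in `State` does not exist. -/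
theorem State.elim (h : G.State C) : False := by
  obtain ⟨s, -⟩ := card_pos.1 (lt_of_lt_of_le (by simp) h.three_le_card)
  obtain ⟨y, -⟩ := card_pos.1 (lt_of_lt_of_le (by simp) (h.card_eq ▸ h.three_le_card))
  obtain ⟨s₁, h1, -, -⟩ := h.exists_avail s s
  obtain ⟨x₁, hx1, -, -⟩ := h.exists_restR y y
  obtain ⟨C₁, s₁, y₁, h', h1, hy1, a1, -, -⟩ := h.exists_adj_step h1 hx1
  obtain ⟨t, ht, hts, -⟩ := h'.exists_avail s₁ s₁
  obtain ⟨x, hx, hxy, -⟩ := h'.exists_restR y₁ y₁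
  obtain ⟨C₂, s₂, y₂, h', h2, hy2, a2, k, k'⟩ := h'.exists_adj_step ht hx
  obtain ⟨h1, h12⟩ := k _ h1 hts.symm
  replace hy1 := k' _ hy1 hxy.symm
  obtain ⟨t, ht, ht1, ht2⟩ := h'.exists_avail s₁ s₂
  obtain ⟨x, hx, hx1, hx2⟩ := h'.exists_restR y₁ y₂
  obtain ⟨C₃, s₃, y₃, h', h3, hy3, a3, k, k'⟩ := h'.exists_adj_step ht hx
  obtain ⟨h1, h13⟩ := k _ h1 ht1.symm
  obtain ⟨h2, h23⟩ := k _ h2 ht2.symm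
  exact h'.no_matching h1 h2 h3 h12 h13 h23 (k' _ hy1 hx1.symm) (k' _ hy2 hx2.symm) hy3 a1 a2 a3

end MarkedBigraph
end Exchange

/-! ### Cycles of length four, six and eight as subgraphs -/

section Cycles

theorem exists_cycle_four {V : Type*} {G : SimpleGraph V} {a b c d : V}
    (hd : [a, b, c, d].Nodup) (h1 : G.Adj a b) (h2 : G.Adj b c) (h3 : G.Adj c d)
    (h4 : G.Adj d a) : ∃ H : G.Subgraph, IsCycleSubgraph H ∧ ∀ w, w ∈ H.verts ↔ w ∈ [a, b, c, d] := by
  refine ⟨_, ⟨a, .cons h1 (.cons h2 (.cons h3 (.cons h4 .nil))), ?_, rfl⟩, fun w => ?_⟩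
  · simp only [List.nodup_cons, List.mem_cons, List.not_mem_nil, or_false, not_or] at hd
    rw [SimpleGraph.Walk.cons_isCycle_iff]
    simp [SimpleGraph.Walk.cons_isPath_iff]
    grind
  · rw [SimpleGraph.Walk.verts_toSubgraph]
    simp
    tauto

theorem exists_cycle_six {V : Type*} {G : SimpleGraph V} {a b c d e f : V}
    (hd : [a, b, c, d, e, f].Nodup) (h1 : G.Adj a b) (h2 : G.Adj b c) (h3 : G.Adj c d)
    (h4 : G.Adj d e) (h5 : G.Adj e f) (h6 : G.Adj f a) :
    ∃ H : G.Subgraph, IsCycleSubgraph H ∧ ∀ w, w ∈ H.verts ↔ w ∈ [a, b, c, d, e, f] := by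
  refine ⟨_, ⟨a, .cons h1 (.cons h2 (.cons h3 (.cons h4 (.cons h5 (.cons h6 .nil))))), ?_, rfl⟩,
    fun w => ?_⟩
  · simp only [List.nodup_cons, List.mem_cons, List.not_mem_nil, or_false, not_or] at hd
    rw [SimpleGraph.Walk.cons_isCycle_iff]
    simp [SimpleGraph.Walk.cons_isPath_iff]
    grind
  · rw [SimpleGraph.Walk.verts_toSubgraph]
    simp
    tauto

theorem exists_cycle_eight {V : Type*} {G : SimpleGraph V} {a b c d e f g h : V}
    (hd : [a, b, c, d, e, f, g, h].Nodup) (h1 : G.Adj a b) (h2 : G.Adj b c) (h3 : G.Adj c d)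
    (h4 : G.Adj d e) (h5 : G.Adj e f) (h6 : G.Adj f g) (h7 : G.Adj g h) (h8 : G.Adj h a) :
    ∃ H : G.Subgraph, IsCycleSubgraph H ∧ ∀ w, w ∈ H.verts ↔ w ∈ [a, b, c, d, e, f, g, h] := by
  refine ⟨_, ⟨a, .cons h1 (.cons h2 (.cons h3 (.cons h4 (.cons h5 (.cons h6 (.cons h7
    (.cons h8 .nil))))))), ?_, rfl⟩, fun w => ?_⟩
  · simp only [List.nodup_cons, List.mem_cons, List.not_mem_nil, or_false, not_or] at hd
    rw [SimpleGraph.Walk.cons_isCycle_iff]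
    simp [SimpleGraph.Walk.cons_isPath_iff]
    grind
  · rw [SimpleGraph.Walk.verts_toSubgraph]
    simp
    tauto

end Cycles

/-! ### Induction on the number of cycles and translation to graphs -/

section Induction
open Finset
namespace MarkedBigraph
variable {A B : Type*} [DecidableEq A] [DecidableEq B] [Fintype A] [Fintype B]

/-- Under the degree condition there are `k` disjoint short cycles, or `k - 1` of them together with
a hexagon through three marked vertices covering the rest. -/
theorem exists_packing_or_hexagon (G : MarkedBigraph A B) (hcard : Fintype.card A = Fintype.card B)
    (ore : ∀ s ∈ G.S, ∀ y, ¬ G.adj s y → Fintype.card A + 1 ≤ G.degL s univ + G.degR y univ)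
    (k : ℕ) (hk : 2 * k + 1 ≤ #G.S) :
    (∃ C : Fin k → Finset A × Finset B, G.IsPacking C) ∨
    ∃ m, k = m + 1 ∧ ∃ C : Fin m → Finset A × Finset B, G.IsPacking C ∧ ∃ s₁ s₂ s₃ z₁ z₂ z₃,
      s₁ ∈ G.S ∧ s₂ ∈ G.S ∧ s₃ ∈ G.S ∧ s₁ ≠ s₂ ∧ s₁ ≠ s₃ ∧ s₂ ≠ s₃ ∧ z₁ ≠ z₂ ∧ z₁ ≠ z₃ ∧ z₂ ≠ z₃ ∧
      G.adj s₁ z₁ ∧ G.adj s₂ z₁ ∧ G.adj s₂ z₂ ∧ G.adj s₃ z₂ ∧ G.adj s₃ z₃ ∧ G.adj s₁ z₃ ∧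
      restL C = {s₁, s₂, s₃} ∧ restR C = {z₁, z₂, z₃} := by
  induction k with
  | zero => exact Or.inl ⟨fun i => i.elim0, fun i => i.elim0, fun i => i.elim0, fun i => i.elim0⟩
  | succ m ih =>
    by_contra hcon
    rw [not_or] at hcon
    have hne : {C : Fin m → Finset A × Finset B | G.IsPacking C}.Nonempty := by
      -- The hexagon outcome for `m = m' + 1` would allow only `2 * m' + 3` marked vertices in
      -- total, but `2 * m' + 5` are present.
      rcases ih (by omega) with ⟨C, hC⟩ | ⟨m', rfl, C, hC, s₁, s₂, s₃, z₁, z₂, z₃, h1, h2, h3,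
        h12, h13, h23, -, -, -, -, -, -, -, -, -, hr, -⟩
      · exact ⟨C, hC⟩
      · exfalso
        have := hC.card_marked
        have h4 : #((restL C).filter (· ∈ G.S)) ≤ 3 :=
          (card_filter_le _ _).trans (hr ▸ card_le_three)
        omega
    obtain ⟨C, hC, hmax⟩ := Set.exists_max_image _ (fun C => #(restL C)) (Set.toFinite _) hne
    refine State.elim (G := G) (C := C) ⟨hC, ⟨hcard, ore, by omega, fun C' hC' =>
      hcon.1 ⟨C', hC'⟩, ?_⟩, hmax⟩
    intro C' hC' s₁ s₂ s₃ z₁ z₂ z₃ h1 h2 h3 h4 h5 h6 h7 h8 h9 h10 h11 h12 h13 h14 h15 h16 h17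
    exact hcon.2 ⟨m, rfl, C', hC', s₁, s₂, s₃, z₁, z₂, z₃, h1, h2, h3, h4, h5, h6, h7, h8, h9,
      h10, h11, h12, h13, h14, h15, h16, h17⟩

/-- The marked bigraph of a bipartite graph with marked vertices `S`. -/
noncomputable def ofGraph {V : Type*} (G : SimpleGraph V) (X Y S : Set V) [Finite X] :
    MarkedBigraph X Y where
  adj x y := G.Adj x y
  S := (Set.toFinite {x : X | (x : V) ∈ S}).toFinset

theorem mem_ofGraph {V : Type*} {G : SimpleGraph V} {X Y S : Set V} [Finite X] {x : X} :
    x ∈ (ofGraph G X Y S).S ↔ (x : V) ∈ S := by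
  simp [ofGraph]

/-- The vertex set in the graph of a member of a packing. -/
def support {V : Type*} {X Y : Set V} (P : Finset X) (Q : Finset Y) : Set V :=
  Subtype.val '' (P : Set X) ∪ Subtype.val '' (Q : Set Y)

/-- Independent of the marking, so it serves both for the hexagons of a packing and for the final
hexagon with three marked vertices. -/
theorem hexagon_exists_cycle {V : Type*} {G : SimpleGraph V} {X Y : Set V} [DecidableEq X]
    [DecidableEq Y] (hG : G.IsBipartiteWith X Y) {u x v : X} {a b c : Y} (hux : u ≠ x)
    (huv : u ≠ v) (hxv : x ≠ v) (hab : a ≠ b) (hac : a ≠ c) (hbc : b ≠ c) (hua : G.Adj u a)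
    (hxa : G.Adj x a) (hxb : G.Adj x b) (hvb : G.Adj v b) (hvc : G.Adj v c) (huc : G.Adj u c) :
    ∃ H : G.Subgraph, IsCycleSubgraph H ∧ H.verts = support {u, x, v} {a, b, c} := by
  have hne : ∀ (x : X) (y : Y), (x : V) ≠ y := fun x y => hG.disjoint.ne_of_mem x.2 y.2
  obtain ⟨H, h1, h2⟩ := exists_cycle_six (G := G) (a := u) (b := a) (c := x) (d := b) (e := v)
    (f := c)
    (by simp only [List.nodup_cons, List.mem_cons, List.not_mem_nil, or_false, not_or]; grind)
    hua hxa.symm hxb hvb.symm hvc huc.symm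
  refine ⟨H, h1, ?_⟩
  ext w
  rw [h2]
  simp [support, Set.image_insert_eq]
  tauto

theorem Good.exists_cycle {V : Type*} {G : SimpleGraph V} {X Y S : Set V} [DecidableEq X]
    [DecidableEq Y] [Finite X] (hG : G.IsBipartiteWith X Y) {P : Finset X} {Q : Finset Y}
    (h : (ofGraph G X Y S).Good P Q) :
    ∃ H : G.Subgraph, IsCycleSubgraph H ∧ H.verts = support P Q := by
  have hne : ∀ (x : X) (y : Y), (x : V) ≠ y := fun x y => hG.disjoint.ne_of_mem x.2 y.2
  cases h with
  | @four u v c d hu hv huv hcd huc hud hvc hvd =>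
    obtain ⟨H, h1, h2⟩ := exists_cycle_four (G := G) (a := u) (b := c) (c := v) (d := d)
      (by simp only [List.nodup_cons, List.mem_cons, List.not_mem_nil, or_false, not_or]; grind)
      huc hvc.symm hvd hud.symm
    refine ⟨H, h1, ?_⟩
    ext w
    rw [h2]
    simp [support, Set.image_insert_eq]
    tauto
  | @six u x v a b c hu hx hv huv hab hac hbc hua hxa hxb hvb hvc huc =>
    exact hexagon_exists_cycle hG (ne_of_mem_of_not_mem hu hx) huv
      (ne_of_mem_of_not_mem hv hx).symm hab hac hbc hua hxa hxb hvb hvc huc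
  | @eight u x v x' a b c d hu hx hv hx' huv hxx' hab hac had hbc hbd hcd hua hxa hxb hvb hvc hxc
      hxd hud =>
    have := ne_of_mem_of_not_mem hu hx
    have := ne_of_mem_of_not_mem hu hx'
    have := (ne_of_mem_of_not_mem hv hx).symm
    have := ne_of_mem_of_not_mem hv hx'
    obtain ⟨H, h1, h2⟩ := exists_cycle_eight (G := G) (a := u) (b := a) (c := x) (d := b) (e := v)
      (f := c) (g := x') (h := d)
      (by simp [fun y x => (hne x y).symm, Subtype.val_injective.eq_iff, *])
      hua hxa.symm hxb hvb.symm hvc hxc.symm hxd hud.symm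
    refine ⟨H, h1, ?_⟩
    ext w
    rw [h2]
    simp [support, Set.image_insert_eq]
    tauto

theorem ncard_support_inter {V : Type*} {G : SimpleGraph V} {X Y S : Set V} [Finite X]
    [DecidableEq X] (hXY : Disjoint X Y) (hS : S ⊆ X) (P : Finset X) (Q : Finset Y) :
    (support P Q ∩ S).ncard = #(P.filter (· ∈ (ofGraph G X Y S).S)) := by
  have h1 : support P Q ∩ S =
      Subtype.val '' ((P.filter (· ∈ (ofGraph G X Y S).S) : Finset X) : Set X) := by
    ext w
    simp only [support, Set.mem_inter_iff, Set.mem_union, Set.mem_image, coe_filter,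
      Set.mem_ofPred_eq, mem_coe, mem_ofGraph]
    constructor
    · rintro ⟨⟨x, hx, rfl⟩ | ⟨y, hy, rfl⟩, hw⟩
      · exact ⟨x, ⟨hx, hw⟩, rfl⟩
      · exact absurd (hS hw) fun h => Set.disjoint_left.1 hXY h y.2
    · rintro ⟨x, ⟨hx, hw⟩, rfl⟩
      exact ⟨Or.inl ⟨x, hx, rfl⟩, hw⟩
  rw [h1, Set.ncard_image_of_injective _ Subtype.val_injective, Set.ncard_coe_finset]

theorem disjoint_support {V : Type*} {X Y : Set V} (hXY : Disjoint X Y) {P P' : Finset X}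
    {Q Q' : Finset Y} (hP : Disjoint P P') (hQ : Disjoint Q Q') :
    Disjoint (support P Q) (support P' Q') := by
  rw [Set.disjoint_left]
  rintro _ (⟨x, hx, rfl⟩ | ⟨y, hy, rfl⟩) (⟨x', hx', h⟩ | ⟨y', hy', h⟩)
  · rw [Subtype.val_injective h] at hx'
    exact Finset.disjoint_left.1 hP hx hx'
  · exact Set.disjoint_left.1 hXY x.2 (h ▸ y'.2)
  · exact Set.disjoint_left.1 hXY x'.2 (h ▸ y.2)
  · rw [Subtype.val_injective h] at hy'
    exact Finset.disjoint_left.1 hQ hy hy'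

theorem exists_family {V : Type*} {G : SimpleGraph V} {X Y S : Set V} [Finite X] [DecidableEq X]
    (hG : G.IsBipartiteWith X Y) (hS : S ⊆ X) {k : ℕ} (D : Fin k → Finset X × Finset Y)
    (hc : ∀ i, ∃ H : G.Subgraph, IsCycleSubgraph H ∧ H.verts = support (D i).1 (D i).2)
    (h2 : ∀ i, 2 ≤ #((D i).1.filter (· ∈ (ofGraph G X Y S).S)))
    (hL : ∀ i j, i ≠ j → Disjoint (D i).1 (D j).1) (hR : ∀ i j, i ≠ j → Disjoint (D i).2 (D j).2) :
    ∃ C : Fin k → G.Subgraph, IsDisjointFeasibleFamily S C ∧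
      ∀ i, (C i).verts = support (D i).1 (D i).2 := by
  choose H hH hv using hc
  refine ⟨H, ⟨fun i => ⟨hH i, ?_⟩, fun i j hij => ?_⟩, hv⟩
  · rw [hv, ncard_support_inter (G := G) hG.disjoint hS]
    exact h2 i
  · simp only [Function.onFun, hv]
    exact disjoint_support hG.disjoint (hL i j hij) (hR i j hij)

theorem degL_ofGraph {V : Type*} [Fintype V] {G : SimpleGraph V} [DecidableRel G.Adj]
    {X Y S : Set V} [Finite X] [Fintype Y] (hG : G.IsBipartiteWith X Y) (x : X) :
    (ofGraph G X Y S).degL x univ = G.degree x := by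
  classical
  rw [degL, ← card_map (Function.Embedding.subtype _), ← SimpleGraph.card_neighborFinset_eq_degree]
  congr 1
  ext w
  simp only [mem_map, mem_filter, mem_univ, true_and, Function.Embedding.subtype_apply,
    SimpleGraph.mem_neighborFinset]
  exact ⟨fun ⟨y, hy, h⟩ => h ▸ hy, fun h => ⟨⟨w, hG.mem_of_mem_adj x.2 h⟩, h, rfl⟩⟩

theorem degR_ofGraph {V : Type*} [Fintype V] {G : SimpleGraph V} [DecidableRel G.Adj]
    {X Y S : Set V} [Fintype X] (hG : G.IsBipartiteWith X Y) (y : Y) :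
    (ofGraph G X Y S).degR y univ = G.degree y := by
  classical
  rw [degR, ← card_map (Function.Embedding.subtype _), ← SimpleGraph.card_neighborFinset_eq_degree]
  congr 1
  ext w
  simp only [mem_map, mem_filter, mem_univ, true_and, Function.Embedding.subtype_apply,
    SimpleGraph.mem_neighborFinset]
  exact ⟨fun ⟨x, hx, h⟩ => h ▸ (show G.Adj x y from hx).symm,
    fun h => ⟨⟨w, hG.symm.mem_of_mem_adj y.2 h⟩, h.symm, rfl⟩⟩

end MarkedBigraph
end Induction

/-! ### The main theorem -/

open Finset MarkedBigraph in
theorem mainTheorem2 {V : Type*} [Fintype V] (G : SimpleGraph V) [DecidableRel G.Adj]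
    (X Y : Set V) (hG : G.IsBipartiteWith X Y) (hXY : X ∪ Y = Set.univ)
    (hbal : X.ncard = Y.ncard) (n : ℕ) (hn : Fintype.card V = 2 * n)
    (k : ℕ) (hk : 1 ≤ k) (S : Set V) (hS : S ⊆ X)
    (hsigma : (n : ℕ∞) + 1 ≤ sigmaOneOne G X Y S) (hScard : 2 * k + 1 ≤ S.ncard) :
    IsSKFeasible G S k ∧
      ∃ C : Fin k → G.Subgraph, IsDisjointFeasibleFamily S C ∧
        ((⋃ i, (C i).verts) = Set.univ ∨ ∀ i, ((C i).verts ∩ S).ncard = 2) := by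
  classical
  have := Fintype.ofFinite X
  have := Fintype.ofFinite Y
  suffices h : ∃ C : Fin k → G.Subgraph, IsDisjointFeasibleFamily S C ∧
      ((⋃ i, (C i).verts) = Set.univ ∨ ∀ i, ((C i).verts ∩ S).ncard = 2) from
    ⟨h.imp fun _ hC => hC.1, h⟩
  have cX : Fintype.card X = X.ncard := by
    rw [← Nat.card_eq_fintype_card, Nat.card_coe_set_eq]
  have cY : Fintype.card Y = Y.ncard := by
    rw [← Nat.card_eq_fintype_card, Nat.card_coe_set_eq]
  have hn' : X.ncard = n := by
    have := Set.ncard_union_eq hG.disjoint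
    rw [hXY, Set.ncard_univ, Nat.card_eq_fintype_card, hn] at this
    omega
  have cS : #(ofGraph G X Y S).S = S.ncard := by
    rw [← Set.ncard_coe_finset, ← Set.ncard_image_of_injective _ Subtype.val_injective]
    congr 1
    ext w
    simp only [Set.mem_image, mem_coe, mem_ofGraph]
    exact ⟨fun ⟨x, hx, h⟩ => h ▸ hx, fun h => ⟨⟨w, hS h⟩, h, rfl⟩⟩
  have ore : ∀ s ∈ (ofGraph G X Y S).S, ∀ y, ¬ (ofGraph G X Y S).adj s y →
      Fintype.card X + 1 ≤ (ofGraph G X Y S).degL s univ + (ofGraph G X Y S).degR y univ := by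
    intro s hs y hsy
    rw [degL_ofGraph hG, degR_ofGraph hG, cX, hn']
    have h1 : sigmaOneOne G X Y S ≤ ((G.degree s + G.degree y : ℕ) : ℕ∞) :=
      iInf_le_of_le (s : V) (iInf_le_of_le (y : V) (iInf_le_of_le s.2 (iInf_le_of_le y.2
        (iInf_le_of_le (Or.inl (mem_ofGraph.1 hs)) (iInf_le_of_le hsy le_rfl)))))
    exact_mod_cast hsigma.trans h1
  rcases exists_packing_or_hexagon (ofGraph G X Y S) (by rw [cX, cY, hbal]) ore k (by omega) with
    ⟨D, hD⟩ | ⟨m, rfl, D, hD, s₁, s₂, s₃, z₁, z₂, z₃, h1, h2, h3, h12, h13, h23, z12, z13, z23,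
      a1, a2, a3, a4, a5, a6, hrL, hrR⟩
  · obtain ⟨C, hC, hv⟩ := exists_family hG hS D (fun i => (hD.good i).exists_cycle hG)
      (fun i => (hD.good i).card_marked.ge) hD.disjL hD.disjR
    refine ⟨C, hC, Or.inr fun i => ?_⟩
    rw [hv, ncard_support_inter (G := G) hG.disjoint hS, (hD.good i).card_marked]
  · have dL : ∀ i, Disjoint (restL D) (D i).1 := fun i =>
      Finset.disjoint_left.2 fun a ha => mem_restL.1 ha i
    have dR : ∀ i, Disjoint (restR D) (D i).2 := fun i =>
      Finset.disjoint_left.2 fun a ha => mem_restR.1 ha i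
    -- The hexagon on the uncovered vertices becomes the cycle with index `0`. It has three marked
    -- vertices, so here the conclusion is that the cycles cover everything.
    obtain ⟨C, hC, hv⟩ := exists_family hG hS (Fin.cons (restL D, restR D) D) (fun i => by
        cases i using Fin.cases with
        | zero =>
          simp only [Fin.cons_zero, hrL, hrR]
          exact hexagon_exists_cycle hG h12 h13 h23 z12 z13 z23 a1 a2 a3 a4 a5 a6
        | succ i => simpa using (hD.good i).exists_cycle hG)
      (fun i => by
        cases i using Fin.cases with
        | zero =>
          simp only [Fin.cons_zero, hrL]
          rw [filter_true_of_mem (by simp [h1, h2, h3]), card_eq_three.2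
            ⟨_, _, _, h12, h13, h23, rfl⟩]
          simp
        | succ i => simpa using (hD.good i).card_marked.ge)
      (fun i j hij => by
        cases i using Fin.cases <;> cases j using Fin.cases
        · exact absurd rfl hij
        · simpa using dL _
        · simpa using (dL _).symm
        · simpa using hD.disjL _ _ (by simpa using hij))
      (fun i j hij => by
        cases i using Fin.cases <;> cases j using Fin.cases
        · exact absurd rfl hij
        · simpa using dR _
        · simpa using (dR _).symm
        · simpa using hD.disjR _ _ (by simpa using hij))
    refine ⟨C, hC, Or.inl (Set.eq_univ_of_forall fun w => ?_)⟩
    rw [Set.mem_iUnion]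
    rcases (hXY ▸ Set.mem_univ w : w ∈ X ∪ Y) with hw | hw
    · by_cases hr : (⟨w, hw⟩ : X) ∈ restL D
      · exact ⟨0, by rw [hv]; exact Or.inl ⟨⟨w, hw⟩, hr, rfl⟩⟩
      · rw [mem_restL] at hr
        push Not at hr
        obtain ⟨i, hi⟩ := hr
        exact ⟨i.succ, by rw [hv]; exact Or.inl ⟨⟨w, hw⟩, by simpa using hi, rfl⟩⟩
    · by_cases hr : (⟨w, hw⟩ : Y) ∈ restR D
      · exact ⟨0, by rw [hv]; exact Or.inr ⟨⟨w, hw⟩, hr, rfl⟩⟩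
      · rw [mem_restR] at hr
        push Not at hr
        obtain ⟨i, hi⟩ := hr
        exact ⟨i.succ, by rw [hv]; exact Or.inr ⟨⟨w, hw⟩, by simpa using hi, rfl⟩⟩
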